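/- Consider the class of potential equations $\mathcal P_{f,\lambda}$: $$v_t+\frac1{2\lambda}v_x^2+fv_{xx}-f_xv_x=0,\qquad f_{xxx}=0,\quad \lambda_t=f_{xx}\lambda,\quad f\lambda\neq0,$$ where $f=f(t,x)=f^2(t)x^2+f^1(t)x+f^0(t)$ and $\lambda=\lambda(t)$ are smooth, $t$ runs through an open interval $I$ (which may depend on the equation), $x\in\mathbb R$, $\lambda$ vanishes nowhere on $I$, and $f^2,f^1,f^0$ have no common zero. Let $\mathcal P^2$ be the subclass of those equations with $f\ne\mathrm{const}$, in the sense that $f$ is not constant on $J\times\mathbb R$ for any nonempty open $J\subseteq I$. An admissible transformation of $\mathcal P^2$ is a triple consisting of a source equation $\mathcal P_{f,\lambda}$ and a target equation $\mathcal P_{\tilde f,\tilde\lambda}$ from $\mathcal P^2$, and a point transformation $\varphi\colon(t,x,v)\mapsto(\tilde t,\tilde x,\tilde v)$ (smooth, with nonvanishing Jacobian, on a nonempty connected open set of $(t,x,v)$) that maps the source equation to the target equation; the admissible transformations constitute the equivalence groupoid of $\mathcal P^2$. Then the equivalence groupoid of $\mathcal P^2$ consists exactly of the triples, with source and target in $\mathcal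 P^2$, for which on the domain of $\varphi$ (where $\gamma t+\delta\neq0$) $$\tilde t=\frac{\alpha t+\beta}{\gamma t+\delta},\qquad \tilde x=\frac{\kappa x+\mu_1t+\mu_0}{\gamma t+\delta},$$ $$\tilde v=c_0\left(v-\frac{\gamma\lambda(t)}{2(\gamma t+\delta)}x^2+\frac{\delta\mu_1-\gamma\mu_0}{\kappa(\gamma t+\delta)}\lambda(t)x+V^0(t)\right),$$ $$V^0(t)=\int\left(\frac{(\delta\mu_1-\gamma\mu_0)^2}{2\kappa^2(\gamma t+\delta)^2}+\frac{\delta\mu_1-\gamma\mu_0}{\kappa(\gamma t+\delta)}f^1(t)+\frac{\gamma}{\gamma t+\delta}f^0(t)\right)\lambda(t)\,dt+\sigma,$$ and the source and target arbitrary elements are related, at corresponding points, by $$\tilde f^2=\frac{(\gamma t+\delta)^2}{\Delta}f^2,\qquad \tilde f^1=\frac{\gamma t+\delta}{\Delta}\bigl(\kappa f^1-2(\mu_1t+\mu_0)f^2\bigr),$$ $$\tilde f^0=\frac1\Delta\bigl(\kappa^2f^0-\kappa(\mu_1t+\mu_0)f^1+(\mu_1t+\mu_0)^2f^2\bigr),\quad\text{i.e.}\quad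 \tilde f=\frac{\kappa^2}{\Delta}f,\qquad \tilde\lambda=c_0\frac{\Delta}{\kappa^2}\lambda.$$ Here $\alpha,\beta,\gamma,\delta,\mu_0,\mu_1,\kappa$ are arbitrary constants with $\Delta:=\alpha\delta-\beta\gamma\ne0$ and $\kappa\neq0$, which are determined by the triple up to a common nonzero multiplier; $c_0\neq0$ and $\sigma$ are arbitrary constants, determined by the triple once the antiderivative is fixed. For every source equation in $\mathcal P^2$, all such constants, and every nonempty open interval $J\subseteq I$ on which $\gamma t+\delta\neq0$, the above formulas do define on $J\times\mathbb R^2$ an admissible transformation to some equation from $\mathcal P^2$ over the image of $J$ under $t\mapsto\tilde t$. -/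

import Mathlib

open Set Filter Topology
open scoped ContDiff

noncomputable section

namespace PotentialBurgers

/-- A value of the (extended) arbitrary element `(f, lam)` of the class of potential equations,
together with the interval `I` of the time axis on which the equation is considered.
Values of `f` and `lam` at times outside `I` play no role. -/
structure ArbitraryElement where
  I : Set ℝ
  f : ℝ → ℝ → ℝ
  lam : ℝ → ℝ

namespace ArbitraryElement

/-- Coefficient of `x ^ 2` in `f t x` (for `f` quadratic in `x`). -/
def f2 (θ : ArbitraryElement) (t : ℝ) : ℝ := iteratedDeriv 2 (θ.f t) 0 / 2

/-- Coefficient of `x` in `f t x` (for `f` quadratic in `x`). -/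
def f1 (θ : ArbitraryElement) (t : ℝ) : ℝ := deriv (θ.f t) 0

/-- Coefficient of `1` in `f t x` (for `f` quadratic in `x`). -/
def f0 (θ : ArbitraryElement) (t : ℝ) : ℝ := θ.f t 0

/-- The function `v` satisfies `v_t + v_x ^ 2 / (2 λ) + f v_xx - f_x v_x = 0` at `(t, x)`. -/
def EquationAt (θ : ArbitraryElement) (v : ℝ → ℝ → ℝ) (t x : ℝ) : Prop :=
  deriv (fun s => v s x) t + 1 / (2 * θ.lam t) * (deriv (v t) x) ^ 2
    + θ.f t x * iteratedDeriv 2 (v t) x - deriv (θ.f t) x * deriv (v t) x = 0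

end ArbitraryElement

/-- The class of all potential equations: `I` is a nonempty open interval, `f` and `lam` are smooth,
`f_xxx = 0`, `λ_t = f_xx λ`, `λ ≠ 0`, and `f t` is not the zero polynomial for any time `t`. -/
structure IsPotential (θ : ArbitraryElement) : Prop where
  isOpen : IsOpen θ.I
  isConnected : IsConnected θ.I
  smooth_f : ContDiffOn ℝ ∞ (fun p : ℝ × ℝ => θ.f p.1 p.2) (θ.I ×ˢ univ)
  smooth_lam : ContDiffOn ℝ ∞ θ.lam θ.I
  f_xxx : ∀ t ∈ θ.I, ∀ x, iteratedDeriv 3 (θ.f t) x = 0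
  lam_t : ∀ t ∈ θ.I, ∀ x, deriv θ.lam t = iteratedDeriv 2 (θ.f t) x * θ.lam t
  f_ne_zero : ∀ t ∈ θ.I, ∃ x, θ.f t x ≠ 0
  lam_ne_zero : ∀ t ∈ θ.I, θ.lam t ≠ 0

/-- The subclass of potential equations with nonconstant `f`. As the objects are local,
`f ≠ const` means that `f` is not constant over any nonempty open set of times. -/
def P2 : Set ArbitraryElement :=
  {θ | IsPotential θ ∧ ∀ J ⊆ θ.I, IsOpen J → J.Nonempty → ¬ ∃ c, ∀ t ∈ J, ∀ x, θ.f t x = c}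

/-- A (local) point transformation `(t, x, v) ↦ (T, X, V)`: a smooth map with nonvanishing
Jacobian on a domain (nonempty connected open set) of the space of `(t, x, v)`. -/
structure PointTransformation where
  dom : Set (ℝ × ℝ × ℝ)
  map : ℝ × ℝ × ℝ → ℝ × ℝ × ℝ
  isOpen : IsOpen dom
  isConnected : IsConnected dom
  smooth : ContDiffOn ℝ ∞ map dom
  jacobian : ∀ p ∈ dom, (fderiv ℝ map p).det ≠ 0

namespace PointTransformation

/-- The set of times occurring in the domain of the transformation. -/
def times (φ : PointTransformation) : Set ℝ := Prod.fst '' φ.dom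

/-- The transformation acts from the space where the source equation lives to the space where
the target equation lives. -/
def Between (φ : PointTransformation) (θ θ' : ArbitraryElement) : Prop :=
  ∀ p ∈ φ.dom, p.1 ∈ θ.I ∧ (φ.map p).1 ∈ θ'.I

/-- Near `(t, x)`, the image under `φ` of the graph of `v` lies in the graph of `w`. -/
def RelatesGraphs (φ : PointTransformation) (v w : ℝ → ℝ → ℝ) (t x : ℝ) : Prop :=
  ∀ᶠ q : ℝ × ℝ in 𝓝 (t, x),
    w (φ.map (q.1, q.2, v q.1 q.2)).1 (φ.map (q.1, q.2, v q.1 q.2)).2.1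
      = (φ.map (q.1, q.2, v q.1 q.2)).2.2

/-- `φ` maps the equation with arbitrary element `θ` to the one with arbitrary element `θ'`: the
prolongation of `φ` to the second-order jets identifies the two equations, viewed as subsets of
the jet space. Jets are represented by smooth functions: if `w` is the image of `v` under `φ`,
then `v` satisfies the source equation at a point if and only if `w` satisfies the target
equation at the corresponding point. -/
def MapsEquation (φ : PointTransformation) (θ θ' : ArbitraryElement) : Prop :=
  φ.Between θ θ' ∧
  ∀ v w : ℝ → ℝ → ℝ, ∀ t x : ℝ, (t, x, v t x) ∈ φ.dom →
    ContDiffAt ℝ ∞ (fun q : ℝ × ℝ => v q.1 q.2) (t, x) →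
    ContDiffAt ℝ ∞ (fun q : ℝ × ℝ => w q.1 q.2)
      ((φ.map (t, x, v t x)).1, (φ.map (t, x, v t x)).2.1) →
    φ.RelatesGraphs v w t x →
    (θ.EquationAt v t x ↔
      θ'.EquationAt w (φ.map (t, x, v t x)).1 (φ.map (t, x, v t x)).2.1)

end PointTransformation

/-- The equivalence groupoid of a class `S` of potential equations, as a set of admissible
transformations (source, point transformation, target). -/
def equivalenceGroupoid (S : Set ArbitraryElement) :
    Set (ArbitraryElement × PointTransformation × ArbitraryElement) :=
  {τ | τ.1 ∈ S ∧ τ.2.2 ∈ S ∧ τ.2.1.MapsEquation τ.1 τ.2.2}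

/-- The constants parameterizing the transformations. -/
structure Params where
  α : ℝ
  β : ℝ
  γ : ℝ
  δ : ℝ
  μ1 : ℝ
  μ0 : ℝ
  κ : ℝ
  c0 : ℝ
  σ : ℝ

namespace Params

def Δ (p : Params) : ℝ := p.α * p.δ - p.β * p.γ

/-- The constraints on the constants. -/
def Valid (p : Params) : Prop := p.Δ ≠ 0 ∧ p.κ ≠ 0 ∧ p.c0 ≠ 0

/-- Multiplication of `α, β, γ, δ, μ1, μ0, κ` by a common multiplier. -/
def scale (m : ℝ) (p : Params) : Params :=
  ⟨m * p.α, m * p.β, m * p.γ, m * p.δ, m * p.μ1, m * p.μ0, m * p.κ, p.c0, p.σ⟩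

def T (p : Params) (t : ℝ) : ℝ := (p.α * t + p.β) / (p.γ * t + p.δ)

def X (p : Params) (t x : ℝ) : ℝ := (p.κ * x + p.μ1 * t + p.μ0) / (p.γ * t + p.δ)

/-- The function `V⁰`; the fixed antiderivative is the one vanishing at `t₀`. -/
def V0 (p : Params) (θ : ArbitraryElement) (t₀ t : ℝ) : ℝ :=
  (∫ s in t₀..t,
    ((p.δ * p.μ1 - p.γ * p.μ0) ^ 2 / (2 * p.κ ^ 2 * (p.γ * s + p.δ) ^ 2)
      + (p.δ * p.μ1 - p.γ * p.μ0) / (p.κ * (p.γ * s + p.δ)) * θ.f1 s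
      + p.γ / (p.γ * s + p.δ) * θ.f0 s) * θ.lam s) + p.σ

def V (p : Params) (θ : ArbitraryElement) (t₀ t x v : ℝ) : ℝ :=
  p.c0 * (v - p.γ * θ.lam t / (2 * (p.γ * t + p.δ)) * x ^ 2
    + (p.δ * p.μ1 - p.γ * p.μ0) / (p.κ * (p.γ * t + p.δ)) * θ.lam t * x
    + p.V0 θ t₀ t)

end Params

/-- The triple `(θ, φ, θ')` has the explicit form with constants `p`, the antiderivative in `V⁰`
being the one that vanishes at `t₀`. -/
structure HasForm (θ : ArbitraryElement) (φ : PointTransformation) (θ' : ArbitraryElement)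
    (t₀ : ℝ) (p : Params) : Prop where
  valid : p.Valid
  denom : ∀ t ∈ φ.times, p.γ * t + p.δ ≠ 0
  transformation : ∀ t x v, (t, x, v) ∈ φ.dom →
    φ.map (t, x, v) = (p.T t, p.X t x, p.V θ t₀ t x v)
  f2_rel : ∀ t ∈ φ.times, θ'.f2 (p.T t) = (p.γ * t + p.δ) ^ 2 / p.Δ * θ.f2 t
  f1_rel : ∀ t ∈ φ.times, θ'.f1 (p.T t) =
    (p.γ * t + p.δ) / p.Δ * (p.κ * θ.f1 t - 2 * (p.μ1 * t + p.μ0) * θ.f2 t)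
  f0_rel : ∀ t ∈ φ.times, θ'.f0 (p.T t) =
    1 / p.Δ * (p.κ ^ 2 * θ.f0 t - p.κ * (p.μ1 * t + p.μ0) * θ.f1 t
      + (p.μ1 * t + p.μ0) ^ 2 * θ.f2 t)
  f_rel : ∀ t ∈ φ.times, ∀ x, θ'.f (p.T t) (p.X t x) = p.κ ^ 2 / p.Δ * θ.f t x
  lam_rel : ∀ t ∈ φ.times, θ'.lam (p.T t) = p.c0 * (p.Δ / p.κ ^ 2) * θ.lam t

end PotentialBurgers

end

/-!
A point transformation acts on the 2-jets of functions `v(t, x)`. By the inverse function theorem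
every 2-jet over a point of the domain at which `(t, x) ↦ (T, X)` is nondegenerate has an image jet
(`MapsEquation.exists_jet`), so `MapsEquation` yields polynomial identities in the jet variables.
The source equation does not restrict `v_tt`, which forces `T = T(t)` (`Dx_T_Dv_T`); a comparison of
the terms with `v_xx` gives `X = X(t, x)` and `f̃ T_t = f X_x ^ 2` (`Dv_X_f_rel`). These steps
divide by `f` and `f̃`; they are made on the dense set where both are nonzero and extended by
continuity. The part of the transformed equation without `v_xx` is a quadratic polynomial in `v_x`, whose
coefficients are the determining equations for `V` (`determiningSystem`).

The determining equations express `2 f V_vv` and `2 f V_xv` through `V_v` and `V_x`. Cross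
differentiation gives `2 f_x V_vv = -β_x V_v ^ 2`, where `β` is a coefficient independent of `v`
(`compat_x`). Elimination of `V_vv` leaves an equation that is linear in `V_v` with coefficients
independent of `v`, so `f_x = 0` wherever `f V_vv ≠ 0`; the same argument with `t` in place of `x`
(`compat_t`) gives `f_t = 0` there. Hence `V_vv ≠ 0` makes `f` locally constant, which is excluded
in the subclass `P2` (`Dv_Dv_V`).

With `V` affine in `v`, the remaining equations say that `V_v` is a constant, that `X_xx = 0`, and
that `q = X_t / X_x` satisfies `q_t = q q_x` and `q_xx = 0`. Thus `1 / X_x` is an affine function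
`γ t + δ` of `t`, and `λ̃ / λ` is constant since `λ_t = f_xx λ` on both sides. The functions `T`,
`X`, `V` are then found by integration: in each case a suitable combination has zero gradient on the
connected domain (`exists_T_eq`, `exists_X_eq`, `exists_hasForm`). Connectedness of the domain makes
the constants global.

Conversely, substitution into the target equation shows that it is `c₀ (γ t + δ) ^ 2 / Δ` times the
source equation (`transformed_equation_eq`). The constants are recovered from `T`, `X`, `V` because
the coefficients of a linear fractional function are determined up to a multiplier
(`Params.exists_multiplier`), and the target equation is obtained from the source one by inverting
the linear fractional function `T` and the affine function `X` (`Params.target`).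
-/

namespace PotentialBurgers

/-! ### Directional derivatives of functions of `(t, x, v)` -/

/-- The derivative of `g` at `p` in the direction `e`, as an operator on functions of
`(t, x, v)`. -/
noncomputable def dirDeriv (e : ℝ × ℝ × ℝ) (g : ℝ × ℝ × ℝ → ℝ) (p : ℝ × ℝ × ℝ) : ℝ :=
  fderiv ℝ g p e

/-- The partial derivative with respect to `t`. -/
notation "Dt" => dirDeriv (1, 0, 0)

/-- The partial derivative with respect to `x`. -/
notation "Dx" => dirDeriv (0, 1, 0)

/-- The partial derivative with respect to `v`. -/
notation "Dv" => dirDeriv (0, 0, 1)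

section Calculus

variable {U : Set (ℝ × ℝ × ℝ)} {g h : ℝ × ℝ × ℝ → ℝ} {p e e' : ℝ × ℝ × ℝ} {d d' : ℝ}

theorem dirDeriv_eq (e g p) :
    dirDeriv e g p = e.1 * Dt g p + e.2.1 * Dx g p + e.2.2 * Dv g p := by
  have : e = e.1 • ((1, 0, 0) : ℝ × ℝ × ℝ) + e.2.1 • ((0, 1, 0) : ℝ × ℝ × ℝ)
      + e.2.2 • ((0, 0, 1) : ℝ × ℝ × ℝ) := by
    ext <;> simp
  simp only [dirDeriv]
  conv_lhs => rw [this]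
  simp only [map_add, map_smul, smul_eq_mul]

theorem differentiableAt_of_smooth (hU : IsOpen U) (hg : ContDiffOn ℝ ∞ g U) (hp : p ∈ U) :
    DifferentiableAt ℝ g p :=
  (hg.contDiffAt (hU.mem_nhds hp)).differentiableAt (by simp)

theorem hasLineDerivAt_dirDeriv (hU : IsOpen U) (hg : ContDiffOn ℝ ∞ g U) (hp : p ∈ U)
    (e : ℝ × ℝ × ℝ) : HasLineDerivAt ℝ g (dirDeriv e g p) p e :=
  (differentiableAt_of_smooth hU hg hp).hasFDerivAt.hasLineDerivAt e

theorem smooth_dirDeriv (hU : IsOpen U) (hg : ContDiffOn ℝ ∞ g U) (e : ℝ × ℝ × ℝ) :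
    ContDiffOn ℝ ∞ (dirDeriv e g) U :=
  (hg.fderiv_of_isOpen hU (by simp)).clm_apply contDiffOn_const

theorem dirDeriv_dirDeriv (hU : IsOpen U) (hg : ContDiffOn ℝ ∞ g U) (hp : p ∈ U)
    (e e' : ℝ × ℝ × ℝ) :
    dirDeriv e (dirDeriv e' g) p = fderiv ℝ (fderiv ℝ g) p e e' := by
  have h : DifferentiableAt ℝ (fderiv ℝ g) p :=
    ((hg.fderiv_of_isOpen (m := ∞) hU (by simp)).contDiffAt
      (hU.mem_nhds hp)).differentiableAt (by simp)
  have := (h.hasFDerivAt.clm_apply (hasFDerivAt_const e' p)).fderiv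
  have h2 : dirDeriv e' g = fun y => fderiv ℝ g y e' := rfl
  rw [h2, dirDeriv, this]
  simp

theorem two_le_infty : (2 : WithTop ℕ∞) ≤ ∞ := by
  exact WithTop.coe_le_coe.2 (le_top : (2 : ℕ∞) ≤ ⊤)

theorem dirDeriv_comm (hU : IsOpen U) (hg : ContDiffOn ℝ ∞ g U) (hp : p ∈ U)
    (e e' : ℝ × ℝ × ℝ) :
    dirDeriv e (dirDeriv e' g) p = dirDeriv e' (dirDeriv e g) p := by
  rw [dirDeriv_dirDeriv hU hg hp, dirDeriv_dirDeriv hU hg hp]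
  exact (hg.contDiffAt (hU.mem_nhds hp)).isSymmSndFDerivAt
    (by simpa using two_le_infty) e e'

theorem eq_of_hasLineDerivAt (hU : IsOpen U) (hp : p ∈ U) (hg : HasLineDerivAt ℝ g d p e)
    (hh : HasLineDerivAt ℝ h d' p e) (heq : ∀ q ∈ U, g q = h q) : d = d' := by
  have h1 : HasLineDerivAt ℝ g d' p e :=
    hh.congr_of_eventuallyEq (Filter.eventually_of_mem (hU.mem_nhds hp) fun q hq => heq q hq)
  exact hg.unique h1

theorem dirDeriv_congr (hU : IsOpen U) (hp : p ∈ U) (heq : ∀ q ∈ U, g q = h q) :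
    dirDeriv e g p = dirDeriv e h p := by
  have : g =ᶠ[𝓝 p] h := Filter.eventually_of_mem (hU.mem_nhds hp) fun q hq => heq q hq
  rw [dirDeriv, dirDeriv, this.fderiv_eq]

theorem dirDeriv_eq_zero_of_eq_const (hU : IsOpen U) (hp : p ∈ U) {c : ℝ}
    (heq : ∀ q ∈ U, g q = c) : dirDeriv e g p = 0 := by
  rw [dirDeriv_congr hU hp heq, dirDeriv]
  simp

theorem lineDeriv_mul (hg : HasLineDerivAt ℝ g d p e) (hh : HasLineDerivAt ℝ h d' p e) :
    HasLineDerivAt ℝ (fun q => g q * h q) (d * h p + g p * d') p e := by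
  have := HasDerivAt.mul hg hh
  simp only [zero_smul, add_zero] at this
  exact this

theorem lineDeriv_add (hg : HasLineDerivAt ℝ g d p e) (hh : HasLineDerivAt ℝ h d' p e) :
    HasLineDerivAt ℝ (fun q => g q + h q) (d + d') p e := HasDerivAt.add hg hh

theorem lineDeriv_sub (hg : HasLineDerivAt ℝ g d p e) (hh : HasLineDerivAt ℝ h d' p e) :
    HasLineDerivAt ℝ (fun q => g q - h q) (d - d') p e := HasDerivAt.sub hg hh

theorem lineDeriv_const (c : ℝ) : HasLineDerivAt ℝ (fun _ => c) 0 p e :=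
  hasDerivAt_const _ _

theorem lineDeriv_time : HasLineDerivAt ℝ (fun q : ℝ × ℝ × ℝ => q.1) e.1 p e := by
  have : HasDerivAt (fun t : ℝ => p.1 + t * e.1) (1 * e.1) 0 :=
    ((hasDerivAt_id (0 : ℝ)).mul_const e.1).const_add p.1
  simpa [HasLineDerivAt] using this

theorem lineDeriv_space : HasLineDerivAt ℝ (fun q : ℝ × ℝ × ℝ => q.2.1) e.2.1 p e := by
  have : HasDerivAt (fun t : ℝ => p.2.1 + t * e.2.1) (1 * e.2.1) 0 :=
    ((hasDerivAt_id (0 : ℝ)).mul_const e.2.1).const_add p.2.1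
  simpa [HasLineDerivAt] using this

theorem lineDeriv_value : HasLineDerivAt ℝ (fun q : ℝ × ℝ × ℝ => q.2.2) e.2.2 p e := by
  have : HasDerivAt (fun t : ℝ => p.2.2 + t * e.2.2) (1 * e.2.2) 0 :=
    ((hasDerivAt_id (0 : ℝ)).mul_const e.2.2).const_add p.2.2
  simpa [HasLineDerivAt] using this

/-- Chain rule for the composition of a function of one variable with a function of
`(t, x, v)`. -/
theorem lineDeriv_comp {k : ℝ → ℝ} {k' : ℝ} (hk : HasDerivAt k k' (g p))
    (hg : HasLineDerivAt ℝ g d p e) : HasLineDerivAt ℝ (fun q => k (g q)) (k' * d) p e := by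
  have hk' : HasDerivAt k k' (g (p + (0 : ℝ) • e)) := by simpa using hk
  exact HasDerivAt.comp (0 : ℝ) hk' hg

/-- A smooth function with zero gradient on a domain is constant. -/
theorem eq_const_of_gradient_eq_zero (hU : IsOpen U) (hc : IsConnected U)
    (hg : ContDiffOn ℝ ∞ g U) (ht : ∀ q ∈ U, Dt g q = 0) (hx : ∀ q ∈ U, Dx g q = 0)
    (hv : ∀ q ∈ U, Dv g q = 0) : ∃ c, ∀ q ∈ U, g q = c := by
  obtain ⟨p, hp⟩ := hc.nonempty
  refine ⟨g p, fun q hq => ?_⟩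
  refine hU.is_const_of_fderiv_eq_zero hc.isPreconnected (hg.differentiableOn (by simp)) ?_ hq hp
  intro q hq
  refine ContinuousLinearMap.ext fun e => ?_
  have := dirDeriv_eq e g q
  rwa [ht q hq, hx q hq, hv q hq, mul_zero, mul_zero, mul_zero, add_zero, add_zero] at this

/-- Second derivative of the composition of a function with a curve. -/
theorem hasDerivAt_deriv_comp {E : Type*} [NormedAddCommGroup E] [NormedSpace ℝ E] {k : E → ℝ}
    {c c' : ℝ → E} {c'' : E} {s : ℝ} (hk : ContDiffAt ℝ ∞ k (c s))
    (hc : ∀ᶠ r in 𝓝 s, HasDerivAt c (c' r) r) (hc' : HasDerivAt c' c'' s) :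
    HasDerivAt (deriv (k ∘ c))
      (fderiv ℝ (fderiv ℝ k) (c s) (c' s) (c' s) + fderiv ℝ k (c s) c'') s := by
  have h0 : HasDerivAt c (c' s) s := hc.self_of_nhds
  have h1 : ∀ᶠ y in 𝓝 (c s), DifferentiableAt ℝ k y :=
    ((hk.of_le (m := 1) (by simp)).eventually (by simp)).mono
      fun y hy => hy.differentiableAt (by simp)
  have h2 : ∀ᶠ r in 𝓝 s, deriv (k ∘ c) r = fderiv ℝ k (c r) (c' r) := by
    filter_upwards [hc, h0.continuousAt.eventually h1] with r hr hr1
    exact (hr1.hasFDerivAt.comp_hasDerivAt r hr).deriv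
  refine HasDerivAt.congr_of_eventuallyEq ?_ h2
  have h3 : HasFDerivAt (fderiv ℝ k) (fderiv ℝ (fderiv ℝ k) (c s)) (c s) :=
    ((hk.fderiv_right (m := ∞) (by simp)).differentiableAt (by simp)).hasFDerivAt
  have h4 := (h3.comp_hasDerivAt s h0).clm_apply hc'
  exact h4

end Calculus

/-! ### Jets of images of functions under a point transformation -/

namespace PointTransformation

/-- The `t`-component of a point transformation. -/
def T (φ : PointTransformation) (p : ℝ × ℝ × ℝ) : ℝ := (φ.map p).1

/-- The `x`-component of a point transformation. -/
def X (φ : PointTransformation) (p : ℝ × ℝ × ℝ) : ℝ := (φ.map p).2.1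

/-- The `v`-component of a point transformation. -/
def V (φ : PointTransformation) (p : ℝ × ℝ × ℝ) : ℝ := (φ.map p).2.2

theorem smooth_T (φ : PointTransformation) : ContDiffOn ℝ ∞ φ.T φ.dom := φ.smooth.fst
theorem smooth_X (φ : PointTransformation) : ContDiffOn ℝ ∞ φ.X φ.dom := φ.smooth.snd.fst
theorem smooth_V (φ : PointTransformation) : ContDiffOn ℝ ∞ φ.V φ.dom := φ.smooth.snd.snd

theorem map_differentiableAt (φ : PointTransformation) {p : ℝ × ℝ × ℝ} (hp : p ∈ φ.dom) :
    DifferentiableAt ℝ φ.map p :=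
  (φ.smooth.contDiffAt (φ.isOpen.mem_nhds hp)).differentiableAt (by simp)

end PointTransformation

theorem det_of_real_prod (A : ℝ × ℝ →L[ℝ] ℝ × ℝ) :
    A.det = (A (1, 0)).1 * (A (0, 1)).2 - (A (0, 1)).1 * (A (1, 0)).2 := by
  rw [ContinuousLinearMap.det, ← LinearMap.det_toMatrix (Module.Basis.finTwoProd ℝ),
    Matrix.det_fin_two]
  simp [LinearMap.toMatrix_apply]

theorem det_of_real_prod_prod (A : ℝ × ℝ × ℝ →L[ℝ] ℝ × ℝ × ℝ) :
    A.det =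
      (A (1, 0, 0)).1 * ((A (0, 1, 0)).2.1 * (A (0, 0, 1)).2.2
        - (A (0, 0, 1)).2.1 * (A (0, 1, 0)).2.2)
      - (A (0, 1, 0)).1 * ((A (1, 0, 0)).2.1 * (A (0, 0, 1)).2.2
        - (A (0, 0, 1)).2.1 * (A (1, 0, 0)).2.2)
      + (A (0, 0, 1)).1 * ((A (1, 0, 0)).2.1 * (A (0, 1, 0)).2.2
        - (A (0, 1, 0)).2.1 * (A (1, 0, 0)).2.2) := by
  let E : (ℝ × ℝ × ℝ) ≃ₗ[ℝ] (Fin 3 → ℝ) :=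
    { toFun := fun p => ![p.1, p.2.1, p.2.2]
      invFun := fun y => (y 0, y 1, y 2)
      map_add' := fun p q => by ext i; fin_cases i <;> simp
      map_smul' := fun c p => by ext i; fin_cases i <;> simp
      left_inv := fun p => by simp
      right_inv := fun y => by ext i; fin_cases i <;> simp }
  have hE : ∀ y, E.symm y = (y 0, y 1, y 2) := fun y => rfl
  have hE' : ∀ p, E p = ![p.1, p.2.1, p.2.2] := fun y => rfl
  rw [ContinuousLinearMap.det, ← LinearMap.det_toMatrix (Module.Basis.ofEquivFun E),
    Matrix.det_fin_three]
  simp [LinearMap.toMatrix_apply, hE, hE']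
  ring

namespace PointTransformation

theorem dirDeriv_T (φ : PointTransformation) {p : ℝ × ℝ × ℝ} (hp : p ∈ φ.dom) (e) :
    dirDeriv e φ.T p = (fderiv ℝ φ.map p e).1 := by
  have := (φ.map_differentiableAt hp).hasFDerivAt.fst
  rw [dirDeriv, show φ.T = fun p => (φ.map p).1 from rfl, this.fderiv]; rfl

theorem dirDeriv_X (φ : PointTransformation) {p : ℝ × ℝ × ℝ} (hp : p ∈ φ.dom) (e) :
    dirDeriv e φ.X p = (fderiv ℝ φ.map p e).2.1 := by
  have := (φ.map_differentiableAt hp).hasFDerivAt.snd.fst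
  rw [dirDeriv, show φ.X = fun p => (φ.map p).2.1 from rfl, this.fderiv]; rfl

theorem dirDeriv_V (φ : PointTransformation) {p : ℝ × ℝ × ℝ} (hp : p ∈ φ.dom) (e) :
    dirDeriv e φ.V p = (fderiv ℝ φ.map p e).2.2 := by
  have := (φ.map_differentiableAt hp).hasFDerivAt.snd.snd
  rw [dirDeriv, show φ.V = fun p => (φ.map p).2.2 from rfl, this.fderiv]; rfl

theorem jacobian_ne_zero (φ : PointTransformation) {p : ℝ × ℝ × ℝ} (hp : p ∈ φ.dom) :
    Dt φ.T p * (Dx φ.X p * Dv φ.V p - Dv φ.X p * Dx φ.V p)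
      - Dx φ.T p * (Dt φ.X p * Dv φ.V p - Dv φ.X p * Dt φ.V p)
      + Dv φ.T p * (Dt φ.X p * Dx φ.V p - Dx φ.X p * Dt φ.V p) ≠ 0 := by
  have := φ.jacobian p hp
  rw [det_of_real_prod_prod] at this
  simpa only [φ.dirDeriv_T hp, φ.dirDeriv_X hp, φ.dirDeriv_V hp] using this

end PointTransformation

/-- First and second derivatives of a function along a parabola with axis parallel to the
`v`-axis. -/
theorem hasDerivAt_parabola {U : Set (ℝ × ℝ × ℝ)} (hU : IsOpen U) {g : ℝ × ℝ × ℝ → ℝ}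
    (hg : ContDiffOn ℝ ∞ g U) {p : ℝ × ℝ × ℝ} (hp : p ∈ U) (e : ℝ × ℝ × ℝ) (n : ℝ) :
    (∀ᶠ h in 𝓝 (0 : ℝ), DifferentiableAt ℝ
      (fun h : ℝ => g (p.1 + h * e.1, p.2.1 + h * e.2.1, p.2.2 + h * e.2.2 + n * h ^ 2 / 2)) h) ∧
    HasDerivAt
      (fun h : ℝ => g (p.1 + h * e.1, p.2.1 + h * e.2.1, p.2.2 + h * e.2.2 + n * h ^ 2 / 2))
      (dirDeriv e g p) 0 ∧
    HasDerivAt (deriv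
      (fun h : ℝ => g (p.1 + h * e.1, p.2.1 + h * e.2.1, p.2.2 + h * e.2.2 + n * h ^ 2 / 2)))
      (dirDeriv e (dirDeriv e g) p + n * Dv g p) 0 := by
  set c : ℝ → ℝ × ℝ × ℝ :=
    fun h => (p.1 + h * e.1, p.2.1 + h * e.2.1, p.2.2 + h * e.2.2 + n * h ^ 2 / 2) with hc
  have hc1 : ∀ h, HasDerivAt c (e.1, e.2.1, e.2.2 + n * h) h := by
    intro h
    refine HasDerivAt.prodMk ?_ (HasDerivAt.prodMk ?_ ?_)
    · simpa using ((hasDerivAt_id h).mul_const e.1).const_add p.1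
    · simpa using ((hasDerivAt_id h).mul_const e.2.1).const_add p.2.1
    · have h1 := ((hasDerivAt_id h).mul_const e.2.2).const_add p.2.2
      have h2 := (((hasDerivAt_id h).pow 2).const_mul n).div_const 2
      convert! h1.add h2 using 1
      simp
      ring
  have hc2 : HasDerivAt (fun h : ℝ => (e.1, e.2.1, e.2.2 + n * h)) (0, 0, n) 0 := by
    refine HasDerivAt.prodMk (hasDerivAt_const _ _) (HasDerivAt.prodMk (hasDerivAt_const _ _) ?_)
    simpa using ((hasDerivAt_id (0 : ℝ)).const_mul n).const_add e.2.2
  have hc0 : c 0 = p := by simp [hc]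
  have hgc : ContDiffAt ℝ ∞ g (c 0) := by rw [hc0]; exact hg.contDiffAt (hU.mem_nhds hp)
  have hU' : ∀ᶠ h in 𝓝 (0 : ℝ), c h ∈ U :=
    (hc1 0).continuousAt.eventually (by rw [hc0]; exact hU.mem_nhds hp)
  refine ⟨?_, ?_, ?_⟩
  · filter_upwards [hU'] with h hh
    exact ((differentiableAt_of_smooth hU hg hh).hasFDerivAt.comp_hasDerivAt h
      (hc1 h)).differentiableAt
  · have := (hgc.differentiableAt (by simp)).hasFDerivAt.comp_hasDerivAt 0 (hc1 0)
    rw [hc0, mul_zero, add_zero] at this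
    exact this
  · have := hasDerivAt_deriv_comp hgc (Eventually.of_forall hc1) hc2
    rw [hc0] at this
    convert! this using 1
    rw [dirDeriv_dirDeriv hU hg hp]
    have h1 : ((0, 0, n) : ℝ × ℝ × ℝ) = n • ((0, 0, 1) : ℝ × ℝ × ℝ) := by simp
    rw [h1, map_smul]
    simp [dirDeriv]

/-- Partial derivatives of a smooth function of two variables in curried form. -/
theorem fderiv_uncurry {w : ℝ → ℝ → ℝ} {τ ξ : ℝ}
    (hw : ContDiffAt ℝ ∞ (fun q : ℝ × ℝ => w q.1 q.2) (τ, ξ)) (y : ℝ × ℝ) :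
    fderiv ℝ (fun q : ℝ × ℝ => w q.1 q.2) (τ, ξ) y
      = deriv (fun s => w s ξ) τ * y.1 + deriv (w τ) ξ * y.2 := by
  have h0 := (hw.differentiableAt (by simp)).hasFDerivAt
  have h1 : HasDerivAt (fun s : ℝ => (s, ξ)) (1, 0) τ :=
    (hasDerivAt_id τ).prodMk (hasDerivAt_const _ _)
  have h2 : HasDerivAt (fun s : ℝ => (τ, s)) (0, 1) ξ :=
    (hasDerivAt_const _ _).prodMk (hasDerivAt_id ξ)
  have h3 := (HasFDerivAt.comp_hasDerivAt (l := fun q : ℝ × ℝ => w q.1 q.2) τ h0 h1).deriv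
  have h4 := (HasFDerivAt.comp_hasDerivAt (l := fun q : ℝ × ℝ => w q.1 q.2) ξ h0 h2).deriv
  rw [show deriv (fun s => w s ξ) τ = _ from h3, show deriv (w τ) ξ = _ from h4]
  have : y = y.1 • ((1, 0) : ℝ × ℝ) + y.2 • ((0, 1) : ℝ × ℝ) := by ext <;> simp
  conv_lhs => rw [this]
  simp only [map_add, map_smul, smul_eq_mul]
  ring

theorem fderiv_fderiv_uncurry {w : ℝ → ℝ → ℝ} {τ ξ : ℝ}
    (hw : ContDiffAt ℝ ∞ (fun q : ℝ × ℝ => w q.1 q.2) (τ, ξ)) :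
    iteratedDeriv 2 (w τ) ξ
      = fderiv ℝ (fderiv ℝ (fun q : ℝ × ℝ => w q.1 q.2)) (τ, ξ) (0, 1) (0, 1) := by
  have h2 : ∀ r, HasDerivAt (fun s : ℝ => (τ, s)) (0, 1) r := fun r =>
    (hasDerivAt_const _ _).prodMk (hasDerivAt_id r)
  have := hasDerivAt_deriv_comp (s := ξ) hw (Eventually.of_forall h2) (hasDerivAt_const _ _)
  rw [iteratedDeriv_succ, iteratedDeriv_one]
  have h := this.deriv
  rw [map_zero, add_zero] at h
  exact h

/-- Transformation of the 2-jet of a function under a point transformation that maps one equation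
to another. The jet of the source function is `(a, b, k, s) = (v_t, v_x, v_xx, v_tt)` with
`v_tx = 0`; the numbers `Q`, `P`, `R` are `w_T`, `w_X`, `w_XX` for the image `w`, which exists
by the inverse function theorem, the Jacobian of `(t, x) ↦ (T, X)` on the graph being nonzero.
The second derivative `w_XX` is read off along the directions in which `T` is stationary. -/
theorem PointTransformation.MapsEquation.exists_jet {θ θ' : ArbitraryElement}
    {φ : PointTransformation} (hφ : φ.MapsEquation θ θ') {p : ℝ × ℝ × ℝ} (hp : p ∈ φ.dom)
    (a b k s : ℝ)
    (hJ : dirDeriv (1, 0, a) φ.T p * dirDeriv (0, 1, b) φ.X p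
      - dirDeriv (0, 1, b) φ.T p * dirDeriv (1, 0, a) φ.X p ≠ 0) :
    ∃ Q P R : ℝ,
      (∀ d₁ d₂ : ℝ, dirDeriv (d₁, d₂, a * d₁ + b * d₂) φ.V p
        = Q * dirDeriv (d₁, d₂, a * d₁ + b * d₂) φ.T p
          + P * dirDeriv (d₁, d₂, a * d₁ + b * d₂) φ.X p) ∧
      (∀ d₁ d₂ : ℝ, ∀ e : ℝ × ℝ × ℝ, e = (d₁, d₂, a * d₁ + b * d₂) →
        ∀ n : ℝ, n = k * d₂ ^ 2 + s * d₁ ^ 2 → dirDeriv e φ.T p = 0 →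
        R * dirDeriv e φ.X p ^ 2
          + Q * (dirDeriv e (dirDeriv e φ.T) p + n * Dv φ.T p)
          + P * (dirDeriv e (dirDeriv e φ.X) p + n * Dv φ.X p)
          = dirDeriv e (dirDeriv e φ.V) p + n * Dv φ.V p) ∧
      (a + 1 / (2 * θ.lam p.1) * b ^ 2 + θ.f p.1 p.2.1 * k - deriv (θ.f p.1) p.2.1 * b = 0 ↔
        Q + 1 / (2 * θ'.lam (φ.T p)) * P ^ 2 + θ'.f (φ.T p) (φ.X p) * R
          - deriv (θ'.f (φ.T p)) (φ.X p) * P = 0) := by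
  obtain ⟨t, x, u⟩ := p
  set v : ℝ → ℝ → ℝ := fun t' x' => u + a * (t' - t) + b * (x' - x)
    + k / 2 * (x' - x) ^ 2 + s / 2 * (t' - t) ^ 2 with hv
  have hv0 : v t x = u := by simp [hv]
  have hvs : ContDiff ℝ ∞ (fun q : ℝ × ℝ => v q.1 q.2) := by simp only [hv]; fun_prop
  set m : ℝ × ℝ → ℝ × ℝ × ℝ := fun q => (q.1, q.2, v q.1 q.2) with hm
  have hm0 : m (t, x) = (t, x, u) := by simp [hm, hv0]
  have hms : ContDiff ℝ ∞ m := contDiff_fst.prodMk (contDiff_snd.prodMk hvs)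
  -- along a line, the graph of `v` is a parabola
  have hmline : ∀ d₁ d₂ h : ℝ, m (t + h * d₁, x + h * d₂)
      = (t + h * d₁, x + h * d₂, u + h * (a * d₁ + b * d₂)
        + (k * d₂ ^ 2 + s * d₁ ^ 2) * h ^ 2 / 2) := by
    intro d₁ d₂ h
    simp only [hm, hv, Prod.mk.injEq, true_and]
    ring
  set G : ℝ × ℝ → ℝ × ℝ := fun q => (φ.T (m q), φ.X (m q)) with hG
  have hcomp : ∀ g : ℝ × ℝ × ℝ → ℝ, ContDiffOn ℝ ∞ g φ.dom →
      ContDiffAt ℝ ∞ (fun q => g (m q)) (t, x) := fun g hg =>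
    ContDiffAt.comp (t, x) (by rw [hm0]; exact hg.contDiffAt (φ.isOpen.mem_nhds hp))
      hms.contDiffAt
  have hGs : ContDiffAt ℝ ∞ G (t, x) := (hcomp _ φ.smooth_T).prodMk (hcomp _ φ.smooth_X)
  have hline : ∀ d₁ d₂ : ℝ, HasDerivAt (fun h : ℝ => (t + h * d₁, x + h * d₂)) (d₁, d₂) 0 := by
    intro d₁ d₂
    refine HasDerivAt.prodMk ?_ ?_
    · simpa using ((hasDerivAt_id (0 : ℝ)).mul_const d₁).const_add t
    · simpa using ((hasDerivAt_id (0 : ℝ)).mul_const d₂).const_add x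
  have hG' : ∀ d₁ d₂ : ℝ, fderiv ℝ G (t, x) (d₁, d₂)
      = (dirDeriv (d₁, d₂, a * d₁ + b * d₂) φ.T (t, x, u),
        dirDeriv (d₁, d₂, a * d₁ + b * d₂) φ.X (t, x, u)) := by
    intro d₁ d₂
    have h1 : HasFDerivAt G (fderiv ℝ G (t, x)) (t + (0 : ℝ) * d₁, x + (0 : ℝ) * d₂) := by
      simpa using (hGs.differentiableAt (by simp)).hasFDerivAt
    have h2 := h1.comp_hasDerivAt (0 : ℝ) (hline d₁ d₂)
    have h3 := (hasDerivAt_parabola φ.isOpen φ.smooth_T hp (d₁, d₂, a * d₁ + b * d₂)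
      (k * d₂ ^ 2 + s * d₁ ^ 2)).2.1.prodMk
      (hasDerivAt_parabola φ.isOpen φ.smooth_X hp (d₁, d₂, a * d₁ + b * d₂)
        (k * d₂ ^ 2 + s * d₁ ^ 2)).2.1
    refine h2.unique (h3.congr_of_eventuallyEq (Eventually.of_forall fun h => ?_))
    simp only [hG, Function.comp, hmline]
  have hdet : (fderiv ℝ G (t, x)).det ≠ 0 := by
    rw [det_of_real_prod, hG', hG']
    simpa using hJ
  have hGf : HasFDerivAt G (((fderiv ℝ G (t, x)).toContinuousLinearEquivOfDetNeZero hdet :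
      (ℝ × ℝ) ≃L[ℝ] (ℝ × ℝ)) : (ℝ × ℝ) →L[ℝ] (ℝ × ℝ)) (t, x) := by
    rw [ContinuousLinearMap.coe_toContinuousLinearEquivOfDetNeZero]
    exact (hGs.differentiableAt (by simp)).hasFDerivAt
  have hinf : (∞ : WithTop ℕ∞) ≠ 0 := by simp
  set Gi := hGs.localInverse hGf hinf
  have hGi0 : Gi (G (t, x)) = (t, x) := hGs.localInverse_apply_image hGf hinf
  have hGis : ContDiffAt ℝ ∞ Gi (G (t, x)) := hGs.to_localInverse hGf hinf
  have hleft : ∀ᶠ q in 𝓝 (t, x), Gi (G q) = q :=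
    (hGs.hasStrictFDerivAt' hGf hinf).eventually_left_inverse
  have hG0 : G (t, x) = (φ.T (t, x, u), φ.X (t, x, u)) := by simp only [hG, hm0]
  set w : ℝ → ℝ → ℝ := fun τ ξ => φ.V (m (Gi (τ, ξ)))
  have hws : ContDiffAt ℝ ∞ (fun q : ℝ × ℝ => w q.1 q.2)
      (φ.T (t, x, u), φ.X (t, x, u)) := by
    rw [← hG0]
    have h1 : ContDiffAt ℝ ∞ (fun q => φ.V (m q)) (Gi (G (t, x))) := by
      rw [hGi0]; exact hcomp _ φ.smooth_V
    exact ContDiffAt.comp (g := fun q => φ.V (m q)) (G (t, x)) h1 hGis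
  have hrel : ∀ᶠ q in 𝓝 (t, x), w (φ.T (m q)) (φ.X (m q)) = φ.V (m q) := by
    filter_upwards [hleft] with q hq
    show φ.V (m (Gi (G q))) = _
    rw [hq]
  have hiff := hφ.2 v w t x (by rw [hv0]; exact hp) hvs.contDiffAt
    (by rw [hv0]; exact hws) hrel
  rw [hv0] at hiff
  set Q := deriv (fun s => w s (φ.X (t, x, u))) (φ.T (t, x, u))
  set P := deriv (w (φ.T (t, x, u))) (φ.X (t, x, u))
  set R := iteratedDeriv 2 (w (φ.T (t, x, u))) (φ.X (t, x, u))
  have hlineEq : ∀ d₁ d₂ : ℝ, ∀ n : ℝ, n = k * d₂ ^ 2 + s * d₁ ^ 2 → ∀ᶠ h : ℝ in 𝓝 0,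
      w (φ.T (t + h * d₁, x + h * d₂, u + h * (a * d₁ + b * d₂) + n * h ^ 2 / 2))
        (φ.X (t + h * d₁, x + h * d₂, u + h * (a * d₁ + b * d₂) + n * h ^ 2 / 2))
        = φ.V (t + h * d₁, x + h * d₂, u + h * (a * d₁ + b * d₂) + n * h ^ 2 / 2) := by
    rintro d₁ d₂ n rfl
    have h1 : Tendsto (fun h : ℝ => (t + h * d₁, x + h * d₂)) (𝓝 0) (𝓝 (t, x)) := by
      have := (hline d₁ d₂).continuousAt.tendsto
      simpa using this
    filter_upwards [h1.eventually hrel] with h hh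
    rwa [hmline] at hh
  refine ⟨Q, P, R, ?_, ?_, ?_⟩
  · intro d₁ d₂
    have hT := hasDerivAt_parabola φ.isOpen φ.smooth_T hp (d₁, d₂, a * d₁ + b * d₂)
      (k * d₂ ^ 2 + s * d₁ ^ 2)
    have hX := hasDerivAt_parabola φ.isOpen φ.smooth_X hp (d₁, d₂, a * d₁ + b * d₂)
      (k * d₂ ^ 2 + s * d₁ ^ 2)
    have hV := hasDerivAt_parabola φ.isOpen φ.smooth_V hp (d₁, d₂, a * d₁ + b * d₂)
      (k * d₂ ^ 2 + s * d₁ ^ 2)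
    have h1 : HasFDerivAt (fun q : ℝ × ℝ => w q.1 q.2)
        (fderiv ℝ (fun q : ℝ × ℝ => w q.1 q.2) (φ.T (t, x, u), φ.X (t, x, u)))
        (φ.T (t + 0 * d₁, x + 0 * d₂, u + 0 * (a * d₁ + b * d₂)
          + (k * d₂ ^ 2 + s * d₁ ^ 2) * 0 ^ 2 / 2),
        φ.X (t + 0 * d₁, x + 0 * d₂, u + 0 * (a * d₁ + b * d₂)
          + (k * d₂ ^ 2 + s * d₁ ^ 2) * 0 ^ 2 / 2)) := by
      simpa using (hws.differentiableAt (by simp)).hasFDerivAt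
    have h2 := h1.comp_hasDerivAt (0 : ℝ) (hT.2.1.prodMk hX.2.1)
    have h3 := h2.unique (hV.2.1.congr_of_eventuallyEq (hlineEq d₁ d₂ _ rfl))
    rw [fderiv_uncurry hws] at h3
    exact h3.symm
  · rintro d₁ d₂ e rfl n hn hstat
    have hT := hasDerivAt_parabola φ.isOpen φ.smooth_T hp (d₁, d₂, a * d₁ + b * d₂) n
    have hX := hasDerivAt_parabola φ.isOpen φ.smooth_X hp (d₁, d₂, a * d₁ + b * d₂) n
    have hV := hasDerivAt_parabola φ.isOpen φ.smooth_V hp (d₁, d₂, a * d₁ + b * d₂) n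
    dsimp only at hT hX hV
    set Tc := fun h : ℝ =>
      φ.T (t + h * d₁, x + h * d₂, u + h * (a * d₁ + b * d₂) + n * h ^ 2 / 2) with hTc
    set Xc := fun h : ℝ =>
      φ.X (t + h * d₁, x + h * d₂, u + h * (a * d₁ + b * d₂) + n * h ^ 2 / 2) with hXc
    have h0 : (Tc 0, Xc 0) = (φ.T (t, x, u), φ.X (t, x, u)) := by simp [hTc, hXc]
    have h1 : ∀ᶠ h in 𝓝 (0 : ℝ),
        HasDerivAt (fun h => (Tc h, Xc h)) (deriv Tc h, deriv Xc h) h := by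
      filter_upwards [hT.1, hX.1] with h hh1 hh2
      exact hh1.hasDerivAt.prodMk hh2.hasDerivAt
    have h2 := hasDerivAt_deriv_comp (k := fun q : ℝ × ℝ => w q.1 q.2)
      (c := fun h => (Tc h, Xc h)) (by rw [h0]; exact hws) h1 (hT.2.2.prodMk hX.2.2)
    have h4 := h2.unique (hV.2.2.congr_of_eventuallyEq
      (Filter.EventuallyEq.deriv (hlineEq d₁ d₂ n hn)))
    rw [h0, hT.2.1.deriv, hX.2.1.deriv, hstat, fderiv_uncurry hws] at h4
    have h5 : ((0 : ℝ), dirDeriv (d₁, d₂, a * d₁ + b * d₂) φ.X (t, x, u))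
        = dirDeriv (d₁, d₂, a * d₁ + b * d₂) φ.X (t, x, u) • ((0, 1) : ℝ × ℝ) := by simp
    rw [h5] at h4
    simp only [map_smul, smul_apply, smul_eq_mul] at h4
    rw [← fderiv_fderiv_uncurry hws] at h4
    rw [← h4]
    ring
  · have hs1 : deriv (fun r => v r x) t = a := by
      have : HasDerivAt (fun r : ℝ => u + a * (r - t) + b * (x - x)
          + k / 2 * (x - x) ^ 2 + s / 2 * (r - t) ^ 2)
          (a * 1 + s / 2 * (2 * (t - t) ^ 1 * 1)) t := by
        have h1 := (hasDerivAt_id t).sub_const t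
        exact (((((h1.const_mul a).const_add u).add_const _).add_const _).add
          ((h1.pow 2).const_mul (s / 2)))
      exact this.deriv.trans (by simp)
    have hs2 : ∀ y, HasDerivAt (v t) (b + k * (y - x)) y := by
      intro y
      have : HasDerivAt (fun r : ℝ => u + a * (t - t) + b * (r - x)
          + k / 2 * (r - x) ^ 2 + s / 2 * (t - t) ^ 2)
          (b * 1 + k / 2 * ((2 : ℕ) * (y - x) ^ 1 * 1)) y := by
        have h1 := (hasDerivAt_id y).sub_const x
        exact (((h1.const_mul b).const_add _).add ((h1.pow 2).const_mul (k / 2))).add_const _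
      convert! this using 1
      push_cast; ring
    have hs3 : iteratedDeriv 2 (v t) x = k := by
      rw [iteratedDeriv_succ, iteratedDeriv_one, show deriv (v t) = fun y => b + k * (y - x) from
        funext fun y => (hs2 y).deriv]
      simp
    have hs4 : deriv (v t) x = b := by simpa using (hs2 x).deriv
    rw [ArbitraryElement.EquationAt, hs1, hs3, hs4] at hiff
    exact hiff

/-! ### Elementary properties of potential equations -/

theorem quadratic_coeffs_eq_zero {A B C x₀ : ℝ} (h : ∀ᶠ x in 𝓝 x₀, A * x ^ 2 + B * x + C = 0) :
    A = 0 ∧ B = 0 ∧ C = 0 := by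
  obtain ⟨ε, hε, hb⟩ := Metric.eventually_nhds_iff.1 h
  have h0 := hb (y := x₀) (by simpa using hε)
  have h1 := hb (y := x₀ + ε / 2) (by
    rw [Real.dist_eq]
    simp only [add_sub_cancel_left, abs_of_pos (half_pos hε)]
    linarith)
  have h2 := hb (y := x₀ - ε / 2) (by
    rw [Real.dist_eq]
    simp only [sub_sub_cancel_left, abs_neg, abs_of_pos (half_pos hε)]
    linarith)
  have hA : A = 0 := by
    have : A * (ε ^ 2 / 2) = 0 := by linear_combination h1 + h2 - 2 * h0
    have h3 : ε ^ 2 / 2 ≠ 0 := by positivity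
    exact (mul_eq_zero.1 this).resolve_right h3
  subst hA
  have hB : B = 0 := by
    have : B * ε = 0 := by linear_combination h1 - h2
    exact (mul_eq_zero.1 this).resolve_right hε.ne'
  subst hB
  exact ⟨rfl, rfl, by linarith⟩

namespace ArbitraryElement

theorem deriv_quadratic (A B C : ℝ) :
    deriv (fun x : ℝ => A * x ^ 2 + B * x + C) = fun x => 2 * A * x + B := by
  funext x
  have h := ((((hasDerivAt_id x).pow 2).const_mul A).add
    ((hasDerivAt_id x).const_mul B)).add_const C
  refine h.deriv.trans ?_
  simp; ring

theorem iteratedDeriv_two_quadratic (A B C : ℝ) :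
    iteratedDeriv 2 (fun x : ℝ => A * x ^ 2 + B * x + C) = fun _ => 2 * A := by
  rw [iteratedDeriv_succ, iteratedDeriv_one, deriv_quadratic]
  funext x
  simp

end ArbitraryElement

namespace IsPotential

variable {θ : ArbitraryElement} (hθ : IsPotential θ)
include hθ

theorem smooth_slice {t : ℝ} (ht : t ∈ θ.I) : ContDiff ℝ ∞ (θ.f t) := by
  have h : ContDiffOn ℝ ∞ (fun x : ℝ => θ.f t x) univ :=
    hθ.smooth_f.comp (contDiff_const.prodMk contDiff_id).contDiffOn
      (fun x _ => mk_mem_prod ht (mem_univ x))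
  exact contDiffOn_univ.1 h

/-- A function with vanishing third derivative is the quadratic polynomial with the
coefficients `f2`, `f1`, `f0`. -/
theorem f_eq {t : ℝ} (ht : t ∈ θ.I) :
    θ.f t = fun x => θ.f2 t * x ^ 2 + θ.f1 t * x + θ.f0 t := by
  have hs := hθ.smooth_slice ht
  have hs1 : ContDiff ℝ ∞ (deriv (θ.f t)) := (contDiff_infty_iff_deriv.1 hs).2
  have hs2 : ContDiff ℝ ∞ (deriv (deriv (θ.f t))) := (contDiff_infty_iff_deriv.1 hs1).2
  have e2 : iteratedDeriv 2 (θ.f t) = deriv (deriv (θ.f t)) := by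
    rw [iteratedDeriv_succ, iteratedDeriv_one]
  have h2 : ∀ x, deriv (deriv (θ.f t)) x = 2 * θ.f2 t := by
    intro x
    have := is_const_of_deriv_eq_zero (hs2.differentiable (by simp)) (fun y => by
      have := hθ.f_xxx t ht y
      rwa [iteratedDeriv_succ, e2] at this) x 0
    rw [this, ArbitraryElement.f2, e2]; ring
  have h1 : ∀ x, deriv (θ.f t) x = 2 * θ.f2 t * x + θ.f1 t := by
    intro x
    have hd : ∀ y, HasDerivAt (fun y => deriv (θ.f t) y - 2 * θ.f2 t * y) 0 y := fun y => by
      have := ((hs1.differentiable (by simp)) y).hasDerivAt.sub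
        ((hasDerivAt_id y).const_mul (2 * θ.f2 t))
      rw [h2, mul_one, sub_self] at this
      exact this
    have := is_const_of_deriv_eq_zero (fun y => (hd y).differentiableAt)
      (fun y => (hd y).deriv) x 0
    simp only [mul_zero, sub_zero] at this
    rw [ArbitraryElement.f1, ← this]; ring
  funext x
  have hd : ∀ y, HasDerivAt (fun y => θ.f t y - (θ.f2 t * y ^ 2 + θ.f1 t * y)) 0 y := fun y => by
    have := ((hs.differentiable (by simp)) y).hasDerivAt.sub
      ((((hasDerivAt_id y).pow 2).const_mul (θ.f2 t)).add ((hasDerivAt_id y).const_mul (θ.f1 t)))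
    rw [h1] at this
    convert! this using 1
    simp; ring
  have := is_const_of_deriv_eq_zero (fun y => (hd y).differentiableAt)
    (fun y => (hd y).deriv) x 0
  simp only [ArbitraryElement.f0]
  linear_combination this

theorem deriv_f {t : ℝ} (ht : t ∈ θ.I) (x : ℝ) :
    deriv (θ.f t) x = 2 * θ.f2 t * x + θ.f1 t := by
  rw [hθ.f_eq ht, ArbitraryElement.deriv_quadratic]

theorem iteratedDeriv_f {t : ℝ} (ht : t ∈ θ.I) (x : ℝ) :
    iteratedDeriv 2 (θ.f t) x = 2 * θ.f2 t := by
  rw [hθ.f_eq ht, ArbitraryElement.iteratedDeriv_two_quadratic]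

theorem hasDerivAt_lam {t : ℝ} (ht : t ∈ θ.I) :
    HasDerivAt θ.lam (2 * θ.f2 t * θ.lam t) t := by
  have := ((hθ.smooth_lam.contDiffAt (hθ.isOpen.mem_nhds ht)).differentiableAt
    (by simp)).hasDerivAt
  rwa [hθ.lam_t t ht 0, hθ.iteratedDeriv_f ht] at this

theorem smooth_f0 : ContDiffOn ℝ ∞ θ.f0 θ.I :=
  hθ.smooth_f.comp (contDiff_id.prodMk contDiff_const).contDiffOn
    (fun _ ht => mk_mem_prod ht (mem_univ (0 : ℝ)))

theorem smooth_f1 : ContDiffOn ℝ ∞ θ.f1 θ.I := by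
  have ho : IsOpen (θ.I ×ˢ (univ : Set ℝ)) := hθ.isOpen.prod isOpen_univ
  have h1 : ContDiffOn ℝ ∞ (fun t : ℝ =>
      fderiv ℝ (fun p : ℝ × ℝ => θ.f p.1 p.2) (t, 0) (0, 1)) θ.I :=
    ((hθ.smooth_f.fderiv_of_isOpen ho (by simp)).comp
      (contDiff_id.prodMk contDiff_const).contDiffOn
      (fun _ ht => mk_mem_prod ht (mem_univ (0 : ℝ)))).clm_apply contDiffOn_const
  refine h1.congr fun t ht => ?_
  rw [fderiv_uncurry (hθ.smooth_f.contDiffAt (ho.mem_nhds (mk_mem_prod ht (mem_univ 0))))]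
  simp [ArbitraryElement.f1]

/-- The coefficient `f2` is smooth, since `2 * f2 = λ_t / λ`. -/
theorem smooth_f2 : ContDiffOn ℝ ∞ θ.f2 θ.I := by
  have h1 : ContDiffOn ℝ ∞ (deriv θ.lam) θ.I :=
    hθ.smooth_lam.deriv_of_isOpen hθ.isOpen (by simp)
  have h2 : ContDiffOn ℝ ∞ (fun t => deriv θ.lam t / (2 * θ.lam t)) θ.I :=
    h1.div (contDiffOn_const.mul hθ.smooth_lam) fun t ht =>
      mul_ne_zero two_ne_zero (hθ.lam_ne_zero t ht)
  refine h2.congr fun t ht => ?_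
  have := hθ.lam_ne_zero t ht
  rw [(hθ.hasDerivAt_lam ht).deriv]
  field_simp

/-- The zeros of `f t` have empty interior. -/
theorem exists_f_ne_zero_near {t : ℝ} (ht : t ∈ θ.I) {x : ℝ} {N : Set ℝ} (hN : N ∈ 𝓝 x) :
    ∃ y ∈ N, θ.f t y ≠ 0 := by
  by_contra! hc
  obtain ⟨h2, h1, h0⟩ := quadratic_coeffs_eq_zero (A := θ.f2 t) (B := θ.f1 t) (C := θ.f0 t)
    (x₀ := x) (Filter.eventually_of_mem hN fun y hy => by
      rw [← hc y hy, hθ.f_eq ht])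
  obtain ⟨y, hy⟩ := hθ.f_ne_zero t ht
  apply hy
  rw [hθ.f_eq ht]
  simp [h2, h1, h0]

end IsPotential

section Density

variable {θ θ' : ArbitraryElement} {φ : PointTransformation} {p : ℝ × ℝ × ℝ}

theorem smooth_comp_time (hb : φ.Between θ θ') {k : ℝ → ℝ}
    (hk : ContDiffOn ℝ ∞ k θ.I) : ContDiffOn ℝ ∞ (fun q => k q.1) φ.dom :=
  hk.comp contDiff_fst.contDiffOn fun q hq => (hb q hq).1

theorem smooth_comp_T (hb : φ.Between θ θ') {k : ℝ → ℝ}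
    (hk : ContDiffOn ℝ ∞ k θ'.I) : ContDiffOn ℝ ∞ (fun q => k (φ.T q)) φ.dom :=
  hk.comp φ.smooth_T fun q hq => (hb q hq).2

theorem continuousOn_f (hθ : IsPotential θ) (hb : φ.Between θ θ') :
    ContinuousOn (fun q => θ.f q.1 q.2.1) φ.dom :=
  hθ.smooth_f.continuousOn.comp (by fun_prop) fun q hq => mk_mem_prod (hb q hq).1 (mem_univ _)

theorem continuousOn_f_image (hθ' : IsPotential θ') (hb : φ.Between θ θ') :
    ContinuousOn (fun q => θ'.f (φ.T q) (φ.X q)) φ.dom :=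
  hθ'.smooth_f.continuousOn.comp (φ.smooth_T.continuousOn.prodMk φ.smooth_X.continuousOn)
    fun q hq => mk_mem_prod (hb q hq).2 (mem_univ _)

/-- The points where neither the source nor the target coefficient of the second derivative
vanishes are dense: `φ` is an open map, and the zeros of quadratic polynomials are isolated. -/
theorem exists_both_ne_zero (hθ : IsPotential θ) (hθ' : IsPotential θ') (hb : φ.Between θ θ')
    (hp : p ∈ φ.dom) {N : Set (ℝ × ℝ × ℝ)} (hN : N ∈ 𝓝 p) :
    ∃ q ∈ N, q ∈ φ.dom ∧ θ.f q.1 q.2.1 ≠ 0 ∧ θ'.f (φ.T q) (φ.X q) ≠ 0 := by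
  obtain ⟨M, hMN, hMo, hpM⟩ := mem_nhds_iff.1 hN
  obtain ⟨t, x, u⟩ := p
  have hx : {y | (t, y, u) ∈ M ∩ φ.dom} ∈ 𝓝 x := by
    have : ContinuousAt (fun y : ℝ => ((t, y, u) : ℝ × ℝ × ℝ)) x := by fun_prop
    exact this ((hMo.inter φ.isOpen).mem_nhds ⟨hpM, hp⟩)
  obtain ⟨y, hy, hfy⟩ := hθ.exists_f_ne_zero_near (hb _ hp).1 hx
  set q₀ : ℝ × ℝ × ℝ := (t, y, u)
  have hS : {q | θ.f q.1 q.2.1 ≠ 0} ∩ (M ∩ φ.dom) ∈ 𝓝 q₀ :=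
    inter_mem (((continuousOn_f hθ hb).continuousAt (φ.isOpen.mem_nhds hy.2)).eventually_ne hfy)
      ((hMo.inter φ.isOpen).mem_nhds hy)
  have hstrict : HasStrictFDerivAt φ.map
      (((fderiv ℝ φ.map q₀).toContinuousLinearEquivOfDetNeZero (φ.jacobian q₀ hy.2) :
        (ℝ × ℝ × ℝ) ≃L[ℝ] (ℝ × ℝ × ℝ)) : (ℝ × ℝ × ℝ) →L[ℝ] (ℝ × ℝ × ℝ)) q₀ := by
    rw [ContinuousLinearMap.coe_toContinuousLinearEquivOfDetNeZero]
    exact (φ.smooth.contDiffAt (φ.isOpen.mem_nhds hy.2)).hasStrictFDerivAt (by simp)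
  have himg := hstrict.map_nhds_eq_of_equiv ▸ image_mem_map (m := φ.map) hS
  have hξ : {ξ | (φ.T q₀, ξ, φ.V q₀) ∈ φ.map '' ({q | θ.f q.1 q.2.1 ≠ 0} ∩ (M ∩ φ.dom))}
      ∈ 𝓝 (φ.X q₀) := by
    have : ContinuousAt (fun ξ : ℝ => ((φ.T q₀, ξ, φ.V q₀) : ℝ × ℝ × ℝ)) (φ.X q₀) := by
      fun_prop
    exact this himg
  obtain ⟨ξ, ⟨q, hq, hqξ⟩, hfξ⟩ := hθ'.exists_f_ne_zero_near (hb _ hy.2).2 hξ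
  refine ⟨q, hMN hq.2.1, hq.2.2, hq.1, ?_⟩
  rw [PointTransformation.T, PointTransformation.X, hqξ]
  exact hfξ

/-- A continuous function vanishing wherever `f` and the target `f` are nonzero vanishes
everywhere. -/
theorem eq_zero_of_eq_zero_of_ne_zero (hθ : IsPotential θ) (hθ' : IsPotential θ')
    (hb : φ.Between θ θ') {H : ℝ × ℝ × ℝ → ℝ} (hH : ContinuousOn H φ.dom)
    (h : ∀ q ∈ φ.dom, θ.f q.1 q.2.1 ≠ 0 → θ'.f (φ.T q) (φ.X q) ≠ 0 → H q = 0) :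
    ∀ q ∈ φ.dom, H q = 0 := by
  intro q hq
  by_contra hne
  obtain ⟨r, hr, hrd, h1, h2⟩ := exists_both_ne_zero hθ hθ' hb hq
    ((hH.continuousAt (φ.isOpen.mem_nhds hq)).eventually_ne hne)
  exact hr (h r hrd h1 h2)

end Density

/-! ### Point transformations between potential equations are projectable -/

section Projectability

variable {θ θ' : ArbitraryElement} {φ : PointTransformation} {p : ℝ × ℝ × ℝ}

theorem second_dirDeriv_space {U : Set (ℝ × ℝ × ℝ)} (hU : IsOpen U) {g : ℝ × ℝ × ℝ → ℝ}
    (hg : ContDiffOn ℝ ∞ g U) (hp : p ∈ U) (b : ℝ) :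
    dirDeriv (0, 1, b) (dirDeriv (0, 1, b) g) p
      = Dx (Dx g) p + 2 * b * Dx (Dv g) p + b ^ 2 * Dv (Dv g) p := by
  have hcomm : fderiv ℝ (fderiv ℝ g) p (0, 0, 1) (0, 1, 0)
      = fderiv ℝ (fderiv ℝ g) p (0, 1, 0) (0, 0, 1) := by
    rw [← dirDeriv_dirDeriv hU hg hp, ← dirDeriv_dirDeriv hU hg hp, dirDeriv_comm hU hg hp]
  simp only [dirDeriv_dirDeriv hU hg hp]
  have : ((0, 1, b) : ℝ × ℝ × ℝ) = (0, 1, 0) + b • (0, 0, 1) := by simp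
  rw [this]
  simp only [map_add, map_smul, add_apply, smul_apply, smul_eq_mul, hcomm]
  ring

/-- `T` is constant in the directions `∂_x + b ∂_v`: otherwise `w_XX` would depend on `v_tt`,
which is not constrained by the source equation. -/
theorem T_stationary (hφ : φ.MapsEquation θ θ') (hp : p ∈ φ.dom) (hf : θ.f p.1 p.2.1 ≠ 0)
    (hf' : θ'.f (φ.T p) (φ.X p) ≠ 0) (a b : ℝ)
    (hJ : (Dt φ.T p + a * Dv φ.T p) * (Dx φ.X p + b * Dv φ.X p)
      - (Dx φ.T p + b * Dv φ.T p) * (Dt φ.X p + a * Dv φ.X p) ≠ 0) :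
    Dx φ.T p + b * Dv φ.T p = 0 := by
  have et : ∀ g, dirDeriv (1, 0, a) g p = Dt g p + a * Dv g p := fun g => by
    rw [dirDeriv_eq]; ring
  have ex : ∀ g, dirDeriv (0, 1, b) g p = Dx g p + b * Dv g p := fun g => by
    rw [dirDeriv_eq]; ring
  have hJ' : dirDeriv (1, 0, a) φ.T p * dirDeriv (0, 1, b) φ.X p
      - dirDeriv (0, 1, b) φ.T p * dirDeriv (1, 0, a) φ.X p ≠ 0 := by
    simpa only [et, ex] using hJ
  have hjac := φ.jacobian_ne_zero hp
  -- the value of `v_xx` for which the source equation holds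
  set k : ℝ := -(a + 1 / (2 * θ.lam p.1) * b ^ 2 - deriv (θ.f p.1) p.2.1 * b) / θ.f p.1 p.2.1
    with hk
  have hsrc : a + 1 / (2 * θ.lam p.1) * b ^ 2 + θ.f p.1 p.2.1 * k
      - deriv (θ.f p.1) p.2.1 * b = 0 := by
    rw [hk]; field_simp; ring
  obtain ⟨Q, P, R, h1, h2, h3⟩ := hφ.exists_jet hp a b k 0 hJ'
  obtain ⟨Q', P', R', h1', h2', h3'⟩ := hφ.exists_jet hp a b k 1 hJ'
  have t1 := h1 1 0
  have t2 := h1 0 1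
  have t1' := h1' 1 0
  have t2' := h1' 0 1
  simp only [mul_zero, mul_one, add_zero, zero_add, et, ex] at t1 t2 t1' t2'
  have hQ : Q' = Q := by
    have : (Q' - Q) * ((Dt φ.T p + a * Dv φ.T p) * (Dx φ.X p + b * Dv φ.X p)
      - (Dx φ.T p + b * Dv φ.T p) * (Dt φ.X p + a * Dv φ.X p)) = 0 := by
      linear_combination (t1 - t1') * (Dx φ.X p + b * Dv φ.X p)
        - (t2 - t2') * (Dt φ.X p + a * Dv φ.X p)
    linarith [(mul_eq_zero.1 this).resolve_right hJ]
  have hP : P' = P := by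
    have : (P' - P) * ((Dt φ.T p + a * Dv φ.T p) * (Dx φ.X p + b * Dv φ.X p)
      - (Dx φ.T p + b * Dv φ.T p) * (Dt φ.X p + a * Dv φ.X p)) = 0 := by
      linear_combination (t2 - t2') * (Dt φ.T p + a * Dv φ.T p)
        - (t1 - t1') * (Dx φ.T p + b * Dv φ.T p)
    linarith [(mul_eq_zero.1 this).resolve_right hJ]
  subst hQ hP
  have e1 := h3.1 hsrc
  have e1' := h3'.1 hsrc
  have hR : R' = R := by
    have : θ'.f (φ.T p) (φ.X p) * (R' - R) = 0 := by linear_combination e1' - e1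
    linarith [(mul_eq_zero.1 this).resolve_left hf']
  subst hR
  set d₁ := -(Dx φ.T p + b * Dv φ.T p) with hd₁
  set d₂ := Dt φ.T p + a * Dv φ.T p with hd₂
  have hstat : dirDeriv (d₁, d₂, a * d₁ + b * d₂) φ.T p = 0 := by
    rw [dirDeriv_eq, hd₁, hd₂]; ring
  have q := h2 d₁ d₂ _ rfl _ rfl hstat
  have q' := h2' d₁ d₂ _ rfl _ rfl hstat
  have hLv : Dv φ.V p - Q' * Dv φ.T p - P' * Dv φ.X p ≠ 0 := by
    intro h0
    apply hjac
    -- the Jacobian is `(V_v - Q T_v - P X_v)` times the Jacobian of `(t, x) ↦ (T, X)`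
    linear_combination ((Dt φ.T p + a * Dv φ.T p) * (Dx φ.X p + b * Dv φ.X p)
      - (Dx φ.T p + b * Dv φ.T p) * (Dt φ.X p + a * Dv φ.X p)) * h0
      + (Dv φ.X p * Dx φ.T p - Dv φ.T p * Dx φ.X p) * t1
      + (Dv φ.T p * Dt φ.X p - Dv φ.X p * Dt φ.T p) * t2
  have hd : d₁ ^ 2 * (Dv φ.V p - Q' * Dv φ.T p - P' * Dv φ.X p) = 0 := by
    linear_combination q - q'
  have := (mul_eq_zero.1 hd).resolve_right hLv
  have := pow_eq_zero_iff (two_ne_zero) |>.1 this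
  linarith

/-- The transformed time depends on `t` only. -/
theorem Dx_T_Dv_T (hθ : IsPotential θ) (hθ' : IsPotential θ') (hφ : φ.MapsEquation θ θ') :
    (∀ q ∈ φ.dom, Dx φ.T q = 0) ∧ ∀ q ∈ φ.dom, Dv φ.T q = 0 := by
  have main : ∀ q ∈ φ.dom, θ.f q.1 q.2.1 ≠ 0 → θ'.f (φ.T q) (φ.X q) ≠ 0 →
      Dx φ.T q = 0 ∧ Dv φ.T q = 0 := by
    intro q hq hf hf'
    have hprod : ∀ a b : ℝ, (Dx φ.T q + b * Dv φ.T q) *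
        ((Dt φ.T q + a * Dv φ.T q) * (Dx φ.X q + b * Dv φ.X q)
          - (Dx φ.T q + b * Dv φ.T q) * (Dt φ.X q + a * Dv φ.X q)) = 0 := by
      intro a b
      by_cases hJ : (Dt φ.T q + a * Dv φ.T q) * (Dx φ.X q + b * Dv φ.X q)
          - (Dx φ.T q + b * Dv φ.T q) * (Dt φ.X q + a * Dv φ.X q) = 0
      · rw [hJ, mul_zero]
      · rw [T_stationary hφ hq hf hf' a b hJ, zero_mul]
    -- compare coefficients; `m₀`, `m₁`, `m₂` are the minors of the gradients of `T` and `X`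
    set m₀ := Dt φ.T q * Dx φ.X q - Dx φ.T q * Dt φ.X q
    set m₁ := Dv φ.T q * Dx φ.X q - Dx φ.T q * Dv φ.X q
    set m₂ := Dt φ.T q * Dv φ.X q - Dv φ.T q * Dt φ.X q
    have hjac : ¬ (m₀ = 0 ∧ m₁ = 0 ∧ m₂ = 0) := by
      rintro ⟨h0, h1, h2⟩
      apply φ.jacobian_ne_zero hq
      linear_combination Dv φ.V q * h0 - Dx φ.V q * h2 - Dt φ.V q * h1
    have h00 := hprod 0 0
    have h10 := hprod 1 0
    have h01 := hprod 0 1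
    have h0m := hprod 0 (-1)
    have h11 := hprod 1 1
    have c0 : Dx φ.T q * m₀ = 0 := by linear_combination h00
    have c1 : Dx φ.T q * m₁ = 0 := by linear_combination h10 - h00
    have c2 : Dv φ.T q * m₂ = 0 := by linear_combination (h01 + h0m) / 2 - c0
    have c3 : Dx φ.T q * m₂ + Dv φ.T q * m₀ = 0 := by linear_combination (h01 - h0m) / 2
    have c4 : Dv φ.T q * m₁ = 0 := by linear_combination h11 - h01 - c1
    have hx : Dx φ.T q = 0 := by
      by_contra hne
      have m0 := (mul_eq_zero.1 c0).resolve_left hne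
      have m1 := (mul_eq_zero.1 c1).resolve_left hne
      rw [m0, mul_zero, add_zero] at c3
      exact hjac ⟨m0, m1, (mul_eq_zero.1 c3).resolve_left hne⟩
    refine ⟨hx, ?_⟩
    by_contra hne
    rw [hx, zero_mul, zero_add] at c3
    exact hjac ⟨(mul_eq_zero.1 c3).resolve_left hne, (mul_eq_zero.1 c4).resolve_left hne,
      (mul_eq_zero.1 c2).resolve_left hne⟩
  exact ⟨eq_zero_of_eq_zero_of_ne_zero hθ hθ' hφ.1
      (smooth_dirDeriv φ.isOpen φ.smooth_T _).continuousOn fun q hq h1 h2 => (main q hq h1 h2).1,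
    eq_zero_of_eq_zero_of_ne_zero hθ hθ' hφ.1
      (smooth_dirDeriv φ.isOpen φ.smooth_T _).continuousOn fun q hq h1 h2 => (main q hq h1 h2).2⟩

/-- The transformation of 2-jets when `T` depends on `t` only; here `P = w_X` and `R = w_XX`. -/
theorem exists_jet_of_projectable (hφ : φ.MapsEquation θ θ')
    (hTx : ∀ q ∈ φ.dom, Dx φ.T q = 0) (hTv : ∀ q ∈ φ.dom, Dv φ.T q = 0) (hp : p ∈ φ.dom)
    (a b k : ℝ) (hc : Dx φ.X p + b * Dv φ.X p ≠ 0) :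
    ∃ P R : ℝ, P * (Dx φ.X p + b * Dv φ.X p) = Dx φ.V p + b * Dv φ.V p ∧
      R * (Dx φ.X p + b * Dv φ.X p) ^ 2
        + P * (Dx (Dx φ.X) p + 2 * b * Dx (Dv φ.X) p + b ^ 2 * Dv (Dv φ.X) p + k * Dv φ.X p)
        = Dx (Dx φ.V) p + 2 * b * Dx (Dv φ.V) p + b ^ 2 * Dv (Dv φ.V) p + k * Dv φ.V p ∧
      (a + 1 / (2 * θ.lam p.1) * b ^ 2 + θ.f p.1 p.2.1 * k - deriv (θ.f p.1) p.2.1 * b = 0 ↔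
        Dt φ.V p + a * Dv φ.V p - P * (Dt φ.X p + a * Dv φ.X p)
          + Dt φ.T p * (1 / (2 * θ'.lam (φ.T p)) * P ^ 2 + θ'.f (φ.T p) (φ.X p) * R
          - deriv (θ'.f (φ.T p)) (φ.X p) * P) = 0) := by
  have et : ∀ g, dirDeriv (1, 0, a) g p = Dt g p + a * Dv g p := fun g => by
    rw [dirDeriv_eq]; ring
  have ex : ∀ g, dirDeriv (0, 1, b) g p = Dx g p + b * Dv g p := fun g => by
    rw [dirDeriv_eq]; ring
  have hTt : Dt φ.T p ≠ 0 := by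
    intro h0
    have := φ.jacobian_ne_zero hp
    rw [h0, hTx p hp, hTv p hp] at this
    simp at this
  have hT0 : ∀ q ∈ φ.dom, dirDeriv (0, 1, b) φ.T q = 0 := fun q hq => by
    rw [dirDeriv_eq, hTx q hq, hTv q hq]; ring
  obtain ⟨Q, P, R, h1, h2, h3⟩ := hφ.exists_jet hp a b k 0 (by
    rw [et, ex, ex, hTx p hp, hTv p hp]
    simpa using ⟨hTt, hc⟩)
  have t1 := h1 1 0
  have t2 := h1 0 1
  have t3 := h2 0 1 (0, 1, b) (by simp) k (by simp) (hT0 p hp)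
  rw [dirDeriv_eq_zero_of_eq_const φ.isOpen hp hT0, second_dirDeriv_space φ.isOpen φ.smooth_X hp,
    second_dirDeriv_space φ.isOpen φ.smooth_V hp] at t3
  simp only [mul_zero, mul_one, add_zero, zero_add, et, ex, hTx p hp, hTv p hp] at t1 t2 t3
  refine ⟨P, R, t2.symm, t3, h3.trans ?_⟩
  have key : Dt φ.V p + a * Dv φ.V p - P * (Dt φ.X p + a * Dv φ.X p)
          + Dt φ.T p * (1 / (2 * θ'.lam (φ.T p)) * P ^ 2 + θ'.f (φ.T p) (φ.X p) * R
          - deriv (θ'.f (φ.T p)) (φ.X p) * P)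
      = Dt φ.T p * (Q + 1 / (2 * θ'.lam (φ.T p)) * P ^ 2 + θ'.f (φ.T p) (φ.X p) * R
          - deriv (θ'.f (φ.T p)) (φ.X p) * P) := by
    linear_combination t1
  rw [key, mul_eq_zero, or_iff_right hTt]

/-- Comparison of the terms with `v_t` and `v_xx`. -/
theorem f_mul_sq_eq (hφ : φ.MapsEquation θ θ')
    (hTx : ∀ q ∈ φ.dom, Dx φ.T q = 0) (hTv : ∀ q ∈ φ.dom, Dv φ.T q = 0) (hp : p ∈ φ.dom)
    (hf : θ.f p.1 p.2.1 ≠ 0) (b : ℝ) (hc : Dx φ.X p + b * Dv φ.X p ≠ 0) :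
    θ.f p.1 p.2.1 * (Dx φ.X p + b * Dv φ.X p) ^ 2 = θ'.f (φ.T p) (φ.X p) * Dt φ.T p := by
  set k : ℝ := -(1 / (2 * θ.lam p.1) * b ^ 2 - deriv (θ.f p.1) p.2.1 * b) / θ.f p.1 p.2.1
    with hk
  have hsrc : θ.f p.1 p.2.1 * k
      = -(1 / (2 * θ.lam p.1) * b ^ 2 - deriv (θ.f p.1) p.2.1 * b) := by
    rw [hk]; field_simp
  have hinv : θ.f p.1 p.2.1 * (θ.f p.1 p.2.1)⁻¹ = 1 := mul_inv_cancel₀ hf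
  obtain ⟨P, R, h1, h2, h3⟩ := exists_jet_of_projectable hφ hTx hTv hp 0 b k hc
  obtain ⟨P', R', h1', h2', h3'⟩ := exists_jet_of_projectable hφ hTx hTv hp 1 b
    (k - (θ.f p.1 p.2.1)⁻¹) hc
  have hP : P' = P := mul_right_cancel₀ hc (h1'.trans h1.symm)
  subst hP
  have e := h3.1 (by linear_combination hsrc)
  have e' := h3'.1 (by linear_combination hsrc - hinv)
  have hK : Dv φ.V p - P' * Dv φ.X p ≠ 0 := by
    intro h0
    apply φ.jacobian_ne_zero hp
    rw [hTx p hp, hTv p hp]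
    linear_combination Dt φ.T p * (Dx φ.X p + b * Dv φ.X p) * h0
      + Dt φ.T p * Dv φ.X p * h1
  refine mul_right_cancel₀ hK ?_
  linear_combination θ.f p.1 p.2.1 * (Dx φ.X p + b * Dv φ.X p) ^ 2 * (e' - e)
    - θ.f p.1 p.2.1 * Dt φ.T p * θ'.f (φ.T p) (φ.X p) * (h2' - h2)
    + Dt φ.T p * θ'.f (φ.T p) (φ.X p) * (Dv φ.V p - P' * Dv φ.X p) * hinv

/-- The transformed space variable depends on `(t, x)` only, and `f` is transformed by
`f̃ T_t = f X_x ^ 2`. -/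
theorem Dv_X_f_rel (hθ : IsPotential θ) (hθ' : IsPotential θ') (hφ : φ.MapsEquation θ θ')
    (hTx : ∀ q ∈ φ.dom, Dx φ.T q = 0) (hTv : ∀ q ∈ φ.dom, Dv φ.T q = 0) :
    (∀ q ∈ φ.dom, Dv φ.X q = 0) ∧
      ∀ q ∈ φ.dom, θ'.f (φ.T q) (φ.X q) * Dt φ.T q = θ.f q.1 q.2.1 * Dx φ.X q ^ 2 := by
  have sX := smooth_dirDeriv φ.isOpen φ.smooth_X
  have hXv : ∀ q ∈ φ.dom, Dv φ.X q = 0 := by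
    refine eq_zero_of_eq_zero_of_ne_zero hθ hθ' hφ.1 (sX _).continuousOn fun q hq hf _ => ?_
    by_contra hne
    have c1 : Dx φ.X q + (1 - Dx φ.X q) / Dv φ.X q * Dv φ.X q = 1 := by field_simp; ring
    have c2 : Dx φ.X q + (2 - Dx φ.X q) / Dv φ.X q * Dv φ.X q = 2 := by field_simp; ring
    have e1 := f_mul_sq_eq hφ hTx hTv hq hf _ (by rw [c1]; norm_num)
    have e2 := f_mul_sq_eq hφ hTx hTv hq hf _ (by rw [c2]; norm_num)
    rw [c1] at e1
    rw [c2] at e2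
    exact hf (by linarith)
  refine ⟨hXv, fun q hq => ?_⟩
  rw [← sub_eq_zero]
  refine eq_zero_of_eq_zero_of_ne_zero hθ hθ' hφ.1 (H := fun q =>
    θ'.f (φ.T q) (φ.X q) * Dt φ.T q - θ.f q.1 q.2.1 * Dx φ.X q ^ 2) ?_ ?_ q hq
  · exact ((continuousOn_f_image hθ' hφ.1).mul
      (smooth_dirDeriv φ.isOpen φ.smooth_T _).continuousOn).sub
      ((continuousOn_f hθ hφ.1).mul ((sX _).continuousOn.pow 2))
  · intro q hq hf _
    have hXx : Dx φ.X q ≠ 0 := by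
      intro h0
      have := φ.jacobian_ne_zero hq
      rw [h0, hXv q hq, hTx q hq, hTv q hq] at this
      simp at this
    have := f_mul_sq_eq hφ hTx hTv hq hf 0 (by simpa using hXx)
    rw [zero_mul, add_zero] at this
    rw [this, sub_self]

end Projectability

/-! ### The determining equations -/

section Determining

variable {θ θ' : ArbitraryElement} {φ : PointTransformation} {p : ℝ × ℝ × ℝ}

theorem lineDeriv_comp_time {I : Set ℝ} (hI : IsOpen I) {k : ℝ → ℝ} (hk : ContDiffOn ℝ ∞ k I)
    (hp : p.1 ∈ I) (e : ℝ × ℝ × ℝ) :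
    HasLineDerivAt ℝ (fun q => k q.1) (deriv k p.1 * e.1) p e :=
  lineDeriv_comp (g := fun q : ℝ × ℝ × ℝ => q.1)
    ((hk.contDiffAt (hI.mem_nhds hp)).differentiableAt (by simp)).hasDerivAt lineDeriv_time

theorem lineDeriv_comp_T {I : Set ℝ} (hI : IsOpen I) {k : ℝ → ℝ} (hk : ContDiffOn ℝ ∞ k I)
    (hp : p ∈ φ.dom) (hT : φ.T p ∈ I) (e : ℝ × ℝ × ℝ) :
    HasLineDerivAt ℝ (fun q => k (φ.T q)) (deriv k (φ.T p) * dirDeriv e φ.T p) p e :=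
  lineDeriv_comp ((hk.contDiffAt (hI.mem_nhds hT)).differentiableAt (by simp)).hasDerivAt
    (hasLineDerivAt_dirDeriv φ.isOpen φ.smooth_T hp e)

theorem smooth_f (hθ : IsPotential θ) (hb : φ.Between θ θ') :
    ContDiffOn ℝ ∞ (fun q => θ.f q.1 q.2.1) φ.dom :=
  hθ.smooth_f.comp (contDiff_fst.prodMk (contDiff_fst.comp contDiff_snd)).contDiffOn
    fun q hq => mk_mem_prod (hb q hq).1 (mem_univ _)

theorem Dx_f (hθ : IsPotential θ) (hb : φ.Between θ θ') (hp : p ∈ φ.dom) :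
    Dx (fun q => θ.f q.1 q.2.1) p = deriv (θ.f p.1) p.2.1 := by
  have h1 := hasLineDerivAt_dirDeriv φ.isOpen (smooth_f hθ hb) hp (0, 1, 0)
  have h2 : HasLineDerivAt ℝ (fun q : ℝ × ℝ × ℝ => θ.f p.1 q.2.1) (deriv (θ.f p.1) p.2.1 * 1)
      p (0, 1, 0) :=
    lineDeriv_comp (((hθ.smooth_slice (hb p hp).1).differentiable (by simp)) _).hasDerivAt
      lineDeriv_space
  rw [mul_one] at h2
  refine h1.unique ?_
  have h3 : (fun s : ℝ => θ.f (p + s • ((0, 1, 0) : ℝ × ℝ × ℝ)).1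
      (p + s • ((0, 1, 0) : ℝ × ℝ × ℝ)).2.1)
      = fun s : ℝ => θ.f p.1 (p + s • ((0, 1, 0) : ℝ × ℝ × ℝ)).2.1 := by
    funext s; simp
  rw [HasLineDerivAt, h3]
  exact h2

theorem Dv_f (hθ : IsPotential θ) (hb : φ.Between θ θ') (hp : p ∈ φ.dom) :
    Dv (fun q => θ.f q.1 q.2.1) p = 0 := by
  have h1 := hasLineDerivAt_dirDeriv φ.isOpen (smooth_f hθ hb) hp (0, 0, 1)
  refine h1.unique ?_
  have h3 : (fun s : ℝ => θ.f (p + s • ((0, 0, 1) : ℝ × ℝ × ℝ)).1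
      (p + s • ((0, 0, 1) : ℝ × ℝ × ℝ)).2.1) = fun _ => θ.f p.1 p.2.1 := by
    funext s; simp
  rw [HasLineDerivAt, h3]
  exact hasDerivAt_const _ _

theorem Dx_Dx_f (hθ : IsPotential θ) (hb : φ.Between θ θ') (hp : p ∈ φ.dom) :
    Dx (Dx (fun q => θ.f q.1 q.2.1)) p = 2 * θ.f2 p.1 := by
  have h2 : HasLineDerivAt ℝ (fun q : ℝ × ℝ × ℝ => 2 * θ.f2 q.1 * q.2.1 + θ.f1 q.1)
      ((0 * θ.f2 p.1 + 2 * (deriv θ.f2 p.1 * 0)) * p.2.1 + 2 * θ.f2 p.1 * 1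
        + deriv θ.f1 p.1 * 0) p (0, 1, 0) :=
    lineDeriv_add (lineDeriv_mul (lineDeriv_mul (lineDeriv_const 2)
      (lineDeriv_comp_time hθ.isOpen hθ.smooth_f2 (hb p hp).1 _)) lineDeriv_space)
      (lineDeriv_comp_time hθ.isOpen hθ.smooth_f1 (hb p hp).1 _)
  rw [eq_of_hasLineDerivAt φ.isOpen hp (hasLineDerivAt_dirDeriv φ.isOpen
    (smooth_dirDeriv φ.isOpen (smooth_f hθ hb) (0, 1, 0)) hp (0, 1, 0)) h2 fun q hq =>
    (Dx_f hθ hb hq).trans (hθ.deriv_f (hb q hq).1 _)]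
  ring

/-- The coefficient of the square of `V_x + v_x V_v` in the transformed equation, up to a
factor. -/
noncomputable def sqCoeff (θ' : ArbitraryElement) (φ : PointTransformation) (q : ℝ × ℝ × ℝ) : ℝ :=
  Dt φ.T q / (θ'.lam (φ.T q) * Dx φ.X q ^ 2)

/-- The part of the coefficient of `V_x + v_x V_v` in the transformed equation coming from the
transformation of `x`. -/
noncomputable def drift (θ : ArbitraryElement) (φ : PointTransformation) (q : ℝ × ℝ × ℝ) : ℝ :=
  (Dt φ.X q + 3 * θ.f q.1 q.2.1 * Dx (Dx φ.X) q) / Dx φ.X q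

/-- The determining equations for a point transformation between potential equations. -/
structure DeterminingSystem (θ θ' : ArbitraryElement) (φ : PointTransformation) : Prop where
  between : φ.Between θ θ'
  Tx : ∀ q ∈ φ.dom, Dx φ.T q = 0
  Tv : ∀ q ∈ φ.dom, Dv φ.T q = 0
  Xv : ∀ q ∈ φ.dom, Dv φ.X q = 0
  f_rel : ∀ q ∈ φ.dom, θ'.f (φ.T q) (φ.X q) * Dt φ.T q = θ.f q.1 q.2.1 * Dx φ.X q ^ 2
  eq_vv : ∀ q ∈ φ.dom, 2 * θ.f q.1 q.2.1 * Dv (Dv φ.V) q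
    = Dv φ.V q * ((θ.lam q.1)⁻¹ - sqCoeff θ' φ q * Dv φ.V q)
  eq_xv : ∀ q ∈ φ.dom, 2 * θ.f q.1 q.2.1 * Dx (Dv φ.V) q
    = Dv φ.V q * (drift θ φ q - sqCoeff θ' φ q * Dx φ.V q)
  eq_t : ∀ q ∈ φ.dom, Dt φ.V q = Dx φ.V q * (drift θ φ q + Dx (fun q => θ.f q.1 q.2.1) q)
    - sqCoeff θ' φ q * (Dx φ.V q * Dx φ.V q) * (1 / 2) - θ.f q.1 q.2.1 * Dx (Dx φ.V) q

theorem jacobian_factors (hTx : Dx φ.T p = 0) (hTv : Dv φ.T p = 0) (hXv : Dv φ.X p = 0)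
    (hp : p ∈ φ.dom) : Dt φ.T p ≠ 0 ∧ Dx φ.X p ≠ 0 ∧ Dv φ.V p ≠ 0 := by
  have := φ.jacobian_ne_zero hp
  rw [hTx, hTv, hXv] at this
  simp only [zero_mul, sub_zero, add_zero] at this
  exact ⟨fun h => this (by rw [h, zero_mul]), fun h => this (by rw [h, zero_mul, mul_zero]),
    fun h => this (by rw [h, mul_zero, mul_zero])⟩

/-- The `x`-derivative of the relation between `f` and the target `f`. -/
theorem f_X_rel (hθ : IsPotential θ) (hθ' : IsPotential θ') (hb : φ.Between θ θ')
    (hTx : ∀ q ∈ φ.dom, Dx φ.T q = 0) (hTv : ∀ q ∈ φ.dom, Dv φ.T q = 0)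
    (hXv : ∀ q ∈ φ.dom, Dv φ.X q = 0)
    (hf : ∀ q ∈ φ.dom, θ'.f (φ.T q) (φ.X q) * Dt φ.T q = θ.f q.1 q.2.1 * Dx φ.X q ^ 2) :
    ∀ q ∈ φ.dom, deriv (θ'.f (φ.T q)) (φ.X q) * Dt φ.T q
      = Dx (fun q => θ.f q.1 q.2.1) q * Dx φ.X q + 2 * θ.f q.1 q.2.1 * Dx (Dx φ.X) q := by
  intro q hq
  have hU := φ.isOpen
  have hXx := (jacobian_factors (hTx q hq) (hTv q hq) (hXv q hq) hq).2.1
  have D := fun {g : ℝ × ℝ × ℝ → ℝ} (hg : ContDiffOn ℝ ∞ g φ.dom) =>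
    hasLineDerivAt_dirDeriv hU hg hq (0, 1, 0)
  have sT := smooth_dirDeriv hU φ.smooth_T (1, 0, 0)
  have sX := smooth_dirDeriv hU φ.smooth_X (0, 1, 0)
  have hTtx : Dx (Dt φ.T) q = 0 := by
    rw [dirDeriv_comm hU φ.smooth_T hq]
    exact dirDeriv_eq_zero_of_eq_const hU hq hTx
  have c := fun {k : ℝ → ℝ} (hk : ContDiffOn ℝ ∞ k θ'.I) =>
    lineDeriv_comp_T hθ'.isOpen hk hq (hb q hq).2 (0, 1, 0)
  have h := eq_of_hasLineDerivAt hU hq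
    (lineDeriv_mul (lineDeriv_add (lineDeriv_add (lineDeriv_mul (c hθ'.smooth_f2)
      (lineDeriv_mul (D φ.smooth_X) (D φ.smooth_X))) (lineDeriv_mul (c hθ'.smooth_f1)
      (D φ.smooth_X))) (c hθ'.smooth_f0)) (D sT))
    (lineDeriv_mul (D (smooth_f hθ hb)) (lineDeriv_mul (D sX) (D sX)))
    (fun r hr => by
      have := hf r hr
      rw [hθ'.f_eq (t := φ.T r) (hb r hr).2] at this
      linear_combination this)
  rw [hTx q hq, hTtx] at h
  rw [hθ'.deriv_f (t := φ.T q) (hb q hq).2]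
  refine mul_right_cancel₀ hXx ?_
  linear_combination h

theorem determiningSystem (hθ : IsPotential θ) (hθ' : IsPotential θ')
    (hφ : φ.MapsEquation θ θ') : DeterminingSystem θ θ' φ := by
  have hb := hφ.1
  obtain ⟨hTx, hTv⟩ := Dx_T_Dv_T hθ hθ' hφ
  obtain ⟨hXv, hf⟩ := Dv_X_f_rel hθ hθ' hφ hTx hTv
  have hfX := f_X_rel hθ hθ' hb hTx hTv hXv hf
  -- the transformed equation, with `v_xx = 0` and `v_t` expressed through `v_x = b`
  have main : ∀ q ∈ φ.dom, ∀ b : ℝ,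
      Dt φ.V q - (1 / 2 * (θ.lam q.1)⁻¹ * b ^ 2 - Dx (fun q => θ.f q.1 q.2.1) q * b) * Dv φ.V q
        - (Dx φ.V q + b * Dv φ.V q) * (drift θ φ q + Dx (fun q => θ.f q.1 q.2.1) q)
        + sqCoeff θ' φ q * (Dx φ.V q + b * Dv φ.V q) ^ 2 / 2
        + θ.f q.1 q.2.1 * (Dx (Dx φ.V) q + 2 * b * Dx (Dv φ.V) q + b ^ 2 * Dv (Dv φ.V) q)
        = 0 := by
    intro q hq b
    obtain ⟨hTt, hXx, -⟩ := jacobian_factors (hTx q hq) (hTv q hq) (hXv q hq) hq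
    have hl : θ.lam q.1 ≠ 0 := hθ.lam_ne_zero _ (hb q hq).1
    have hl' : θ'.lam (φ.T q) ≠ 0 := hθ'.lam_ne_zero _ (hb q hq).2
    obtain ⟨P, R, h1, h2, h3⟩ := exists_jet_of_projectable hφ hTx hTv hq
      (-(1 / (2 * θ.lam q.1) * b ^ 2 - deriv (θ.f q.1) q.2.1 * b)) b 0
      (by rw [hXv q hq]; simpa using hXx)
    have h4 := h3.1 (by ring)
    rw [show Dx (Dv φ.X) q = 0 from dirDeriv_eq_zero_of_eq_const φ.isOpen hq hXv,
      show Dv (Dv φ.X) q = 0 from dirDeriv_eq_zero_of_eq_const φ.isOpen hq hXv, hXv q hq] at h2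
    rw [hXv q hq] at h1 h4
    rw [← Dx_f hθ hb hq] at h4
    have e1 := hf q hq
    have e2 := hfX q hq
    have e3 : drift θ φ q * Dx φ.X q = Dt φ.X q + 3 * θ.f q.1 q.2.1 * Dx (Dx φ.X) q := by
      rw [drift]; field_simp
    have e4 : sqCoeff θ' φ q * Dx φ.X q ^ 2 = Dt φ.T q * (θ'.lam (φ.T q))⁻¹ := by
      rw [sqCoeff]; field_simp
    rw [one_div, one_div, mul_inv, mul_inv] at h4
    have hP : P * Dx φ.X q = Dx φ.V q + b * Dv φ.V q := by linear_combination h1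
    rw [← hP]
    linear_combination h4 - P * e3 + P ^ 2 / 2 * e4 - θ.f q.1 q.2.1 * h2 - R * e1 + P * e2
  refine ⟨hb, hTx, hTv, hXv, hf, fun q hq => ?_, fun q hq => ?_, fun q hq => ?_⟩
  · linear_combination main q hq 1 + main q hq (-1) - 2 * main q hq 0
  · linear_combination (main q hq 1 - main q hq (-1)) / 2
  · linear_combination main q hq 0

end Determining

/-! ### Properties of the coefficients of the determining equations -/

namespace DeterminingSystem

variable {θ θ' : ArbitraryElement} {φ : PointTransformation} {p : ℝ × ℝ × ℝ}
variable (hD : DeterminingSystem θ θ' φ)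
include hD

theorem ne_zero {q : ℝ × ℝ × ℝ} (hq : q ∈ φ.dom) :
    Dt φ.T q ≠ 0 ∧ Dx φ.X q ≠ 0 ∧ Dv φ.V q ≠ 0 :=
  jacobian_factors (hD.Tx q hq) (hD.Tv q hq) (hD.Xv q hq) hq

theorem smooth_sqCoeff (hθ' : IsPotential θ') : ContDiffOn ℝ ∞ (sqCoeff θ' φ) φ.dom :=
  (smooth_dirDeriv φ.isOpen φ.smooth_T _).div
    ((smooth_comp_T hD.between hθ'.smooth_lam).mul
      ((smooth_dirDeriv φ.isOpen φ.smooth_X _).pow 2)) fun q hq =>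
    mul_ne_zero (hθ'.lam_ne_zero _ (hD.between q hq).2) (pow_ne_zero 2 (hD.ne_zero hq).2.1)

theorem sqCoeff_mul (hθ' : IsPotential θ') {q : ℝ × ℝ × ℝ} (hq : q ∈ φ.dom) :
    sqCoeff θ' φ q * (θ'.lam (φ.T q) * (Dx φ.X q * Dx φ.X q)) = Dt φ.T q := by
  have h1 : θ'.lam (φ.T q) ≠ 0 := hθ'.lam_ne_zero _ (hD.between q hq).2
  have h2 := (hD.ne_zero hq).2.1
  rw [sqCoeff]; field_simp

theorem sqCoeff_ne_zero (hθ' : IsPotential θ') {q : ℝ × ℝ × ℝ} (hq : q ∈ φ.dom) :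
    sqCoeff θ' φ q ≠ 0 := fun h0 => (hD.ne_zero hq).1 (by
  rw [← hD.sqCoeff_mul hθ' hq, h0, zero_mul])

theorem lineDeriv_sqCoeff_mul (hθ' : IsPotential θ') (hp : p ∈ φ.dom) (e : ℝ × ℝ × ℝ)
    (he : dirDeriv e φ.T p = 0) :
    dirDeriv e (sqCoeff θ' φ) p * (θ'.lam (φ.T p) * (Dx φ.X p * Dx φ.X p))
      + sqCoeff θ' φ p * (θ'.lam (φ.T p) * (2 * Dx φ.X p * dirDeriv e (Dx φ.X) p))
      = dirDeriv e (Dt φ.T) p := by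
  have hU := φ.isOpen
  have D := fun {g : ℝ × ℝ × ℝ → ℝ} (hg : ContDiffOn ℝ ∞ g φ.dom) =>
    hasLineDerivAt_dirDeriv hU hg hp e
  have sX := smooth_dirDeriv hU φ.smooth_X (0, 1, 0)
  have h := eq_of_hasLineDerivAt hU hp
    (lineDeriv_mul (D (hD.smooth_sqCoeff hθ')) (lineDeriv_mul
      (lineDeriv_comp_T hθ'.isOpen hθ'.smooth_lam hp (hD.between p hp).2 e)
      (lineDeriv_mul (D sX) (D sX))))
    (D (smooth_dirDeriv hU φ.smooth_T (1, 0, 0))) fun r hr => hD.sqCoeff_mul hθ' hr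
  rw [he] at h
  linear_combination h

theorem Dv_sqCoeff (hθ' : IsPotential θ') : ∀ q ∈ φ.dom, Dv (sqCoeff θ' φ) q = 0 := by
  intro q hq
  have hU := φ.isOpen
  have h := hD.lineDeriv_sqCoeff_mul hθ' hq (0, 0, 1) (hD.Tv q hq)
  rw [dirDeriv_comm hU φ.smooth_X hq, dirDeriv_eq_zero_of_eq_const hU hq hD.Xv,
    dirDeriv_comm hU φ.smooth_T hq, dirDeriv_eq_zero_of_eq_const hU hq hD.Tv] at h
  simp only [mul_zero, add_zero] at h
  have h1 : θ'.lam (φ.T q) ≠ 0 := hθ'.lam_ne_zero _ (hD.between q hq).2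
  have h2 := (hD.ne_zero hq).2.1
  exact (mul_eq_zero.1 h).resolve_right (mul_ne_zero h1 (mul_ne_zero h2 h2))

theorem Dx_Dx_X (hθ' : IsPotential θ') (hp : p ∈ φ.dom) (h0 : Dx (sqCoeff θ' φ) p = 0) :
    Dx (Dx φ.X) p = 0 := by
  have hU := φ.isOpen
  have h := hD.lineDeriv_sqCoeff_mul hθ' hp (0, 1, 0) (hD.Tx p hp)
  rw [h0, dirDeriv_comm hU φ.smooth_T hp, dirDeriv_eq_zero_of_eq_const hU hp hD.Tx,
    zero_mul, zero_add] at h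
  have h1 : θ'.lam (φ.T p) ≠ 0 := hθ'.lam_ne_zero _ (hD.between p hp).2
  have h2 := (hD.ne_zero hp).2.1
  have h3 := (mul_eq_zero.1 h).resolve_left (hD.sqCoeff_ne_zero hθ' hp)
  exact (mul_eq_zero.1 ((mul_eq_zero.1 h3).resolve_left h1)).resolve_left
    (mul_ne_zero two_ne_zero h2)

theorem smooth_drift (hθ : IsPotential θ) : ContDiffOn ℝ ∞ (drift θ φ) φ.dom := by
  have sX := smooth_dirDeriv φ.isOpen φ.smooth_X
  exact ((sX _).add ((contDiffOn_const.mul (smooth_f hθ hD.between)).mul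
    (smooth_dirDeriv φ.isOpen (sX (0, 1, 0)) (0, 1, 0)))).div (sX _)
    fun q hq => (hD.ne_zero hq).2.1

theorem drift_mul {q : ℝ × ℝ × ℝ} (hq : q ∈ φ.dom) :
    drift θ φ q * Dx φ.X q = Dt φ.X q + 3 * θ.f q.1 q.2.1 * Dx (Dx φ.X) q := by
  have h2 := (hD.ne_zero hq).2.1
  rw [drift]; field_simp

theorem Dv_drift (hθ : IsPotential θ) : ∀ q ∈ φ.dom, Dv (drift θ φ) q = 0 := by
  intro q hq
  have hU := φ.isOpen
  have D := fun {g : ℝ × ℝ × ℝ → ℝ} (hg : ContDiffOn ℝ ∞ g φ.dom) =>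
    hasLineDerivAt_dirDeriv hU hg hq (0, 0, 1)
  have sX := smooth_dirDeriv hU φ.smooth_X
  have sXx := sX (0, 1, 0)
  have hXxv : ∀ q ∈ φ.dom, Dv (Dx φ.X) q = 0 := fun r hr => by
    rw [dirDeriv_comm hU φ.smooth_X hr, dirDeriv_eq_zero_of_eq_const hU hr hD.Xv]
  have h := eq_of_hasLineDerivAt hU hq
    (lineDeriv_mul (D (hD.smooth_drift hθ)) (D sXx))
    (lineDeriv_add (D (sX (1, 0, 0))) (lineDeriv_mul (lineDeriv_mul (lineDeriv_const 3)
      (D (smooth_f hθ hD.between))) (D (smooth_dirDeriv hU sXx (0, 1, 0)))))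
    fun r hr => hD.drift_mul hr
  rw [hXxv q hq, dirDeriv_comm hU sXx hq, dirDeriv_eq_zero_of_eq_const hU hq hXxv,
    dirDeriv_comm hU φ.smooth_X hq, dirDeriv_eq_zero_of_eq_const hU hq hD.Xv,
    Dv_f hθ hD.between hq] at h
  simp only [mul_zero, zero_mul, add_zero] at h
  exact (mul_eq_zero.1 h).resolve_right (hD.ne_zero hq).2.1

omit hD in
theorem smooth_inv_lam (hθ : IsPotential θ) (hb : φ.Between θ θ') :
    ContDiffOn ℝ ∞ (fun q => (θ.lam q.1)⁻¹) φ.dom :=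
  (smooth_comp_time hb hθ.smooth_lam).inv fun q hq => hθ.lam_ne_zero _ (hb q hq).1

omit hD in
theorem lineDeriv_inv_lam (hθ : IsPotential θ) (hb : φ.Between θ θ') (hp : p ∈ φ.dom)
    (e : ℝ × ℝ × ℝ) : HasLineDerivAt ℝ (fun q => (θ.lam q.1)⁻¹)
      (-(2 * θ.f2 p.1 * (θ.lam p.1)⁻¹) * e.1) p e := by
  have h := (hb p hp).1
  have h0 := hθ.lam_ne_zero _ h
  have h1 := (hθ.hasDerivAt_lam h).inv h0
  have h2 : -(2 * θ.f2 p.1 * θ.lam p.1) / θ.lam p.1 ^ 2 = -(2 * θ.f2 p.1 * (θ.lam p.1)⁻¹) := by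
    field_simp
  rw [h2] at h1
  exact lineDeriv_comp (g := fun q : ℝ × ℝ × ℝ => q.1) h1 lineDeriv_time

/-- The compatibility condition obtained by cross-differentiating the equations for `V_vv` and
`V_xv`. -/
theorem compat_x (hθ : IsPotential θ) (hθ' : IsPotential θ') (hp : p ∈ φ.dom)
    (hf : θ.f p.1 p.2.1 ≠ 0) :
    2 * Dx (fun q => θ.f q.1 q.2.1) p * Dv (Dv φ.V) p
      = -Dx (sqCoeff θ' φ) p * Dv φ.V p ^ 2 := by
  have hU := φ.isOpen
  have hb := hD.between
  have sV := smooth_dirDeriv hU φ.smooth_V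
  have sa := sV (0, 0, 1)
  have sF := smooth_f hθ hb
  have sβ := hD.smooth_sqCoeff hθ'
  have D := fun {g : ℝ × ℝ × ℝ → ℝ} (hg : ContDiffOn ℝ ∞ g φ.dom) e =>
    hasLineDerivAt_dirDeriv hU hg hp e
  have h1 := eq_of_hasLineDerivAt hU hp
    (lineDeriv_mul (lineDeriv_mul (lineDeriv_const 2) (D sF (0, 1, 0)))
      (D (smooth_dirDeriv hU sa (0, 0, 1)) (0, 1, 0)))
    (lineDeriv_mul (D sa (0, 1, 0)) (lineDeriv_sub (lineDeriv_inv_lam hθ hb hp (0, 1, 0))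
      (lineDeriv_mul (D sβ (0, 1, 0)) (D sa (0, 1, 0))))) hD.eq_vv
  have h2 := eq_of_hasLineDerivAt hU hp
    (lineDeriv_mul (lineDeriv_mul (lineDeriv_const 2) (D sF (0, 0, 1)))
      (D (smooth_dirDeriv hU sa (0, 1, 0)) (0, 0, 1)))
    (lineDeriv_mul (D sa (0, 0, 1)) (lineDeriv_sub (D (hD.smooth_drift hθ) (0, 0, 1))
      (lineDeriv_mul (D sβ (0, 0, 1)) (D (sV (0, 1, 0)) (0, 0, 1))))) hD.eq_xv
  rw [Dv_f hθ hb hp, hD.Dv_sqCoeff hθ' p hp, hD.Dv_drift hθ p hp, dirDeriv_comm hU sa hp,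
    dirDeriv_comm hU φ.smooth_V hp (0, 0, 1) (0, 1, 0)] at h2
  have e1 := hD.eq_vv p hp
  have e2 := hD.eq_xv p hp
  refine mul_left_cancel₀ (mul_ne_zero two_ne_zero hf) ?_
  linear_combination 2 * θ.f p.1 p.2.1 * (h1 - h2)
    + ((θ.lam p.1)⁻¹ - sqCoeff θ' φ p * Dv φ.V p) * e2
    - (drift θ φ p - sqCoeff θ' φ p * Dx φ.V p) * e1

end DeterminingSystem

/-! ### Affinity in `v` when `f` is not constant -/

namespace DeterminingSystem

variable {θ θ' : ArbitraryElement} {φ : PointTransformation} {p : ℝ × ℝ × ℝ}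
variable (hD : DeterminingSystem θ θ' φ)
include hD

/-- A compatibility condition of the form `2 f_e V_vv = -β_e V_v ^ 2`, for `e` the variable `t`
or `x` and `β` the coefficient `sqCoeff`, forces `f_e = 0` where `f V_vv ≠ 0`: elimination of
`V_vv` gives an equation that is linear in `V_v`, with coefficients independent of `v`. -/
theorem gradient_eq_zero_of_compat (hθ : IsPotential θ) (hθ' : IsPotential θ')
    {W : Set (ℝ × ℝ × ℝ)} (hW : IsOpen W) (hWU : W ⊆ φ.dom)
    (hf : ∀ q ∈ W, θ.f q.1 q.2.1 ≠ 0) (ha : ∀ q ∈ W, Dv (Dv φ.V) q ≠ 0) (e : ℝ × ℝ × ℝ)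
    (hc : ∀ q ∈ W, 2 * dirDeriv e (fun q => θ.f q.1 q.2.1) q * Dv (Dv φ.V) q
      = -dirDeriv e (sqCoeff θ' φ) q * Dv φ.V q ^ 2) :
    ∀ q ∈ W, dirDeriv e (fun q => θ.f q.1 q.2.1) q = 0 ∧ dirDeriv e (sqCoeff θ' φ) q = 0 := by
  have hU := φ.isOpen
  have hb := hD.between
  have sF := smooth_f hθ hb
  have sβ := hD.smooth_sqCoeff hθ'
  have sa := smooth_dirDeriv hU φ.smooth_V (0, 0, 1)
  have lin : ∀ q ∈ W, dirDeriv e (fun q => θ.f q.1 q.2.1) q * (θ.lam q.1)⁻¹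
      = (dirDeriv e (fun q => θ.f q.1 q.2.1) q * sqCoeff θ' φ q
        - θ.f q.1 q.2.1 * dirDeriv e (sqCoeff θ' φ) q) * Dv φ.V q := by
    intro q hq
    refine mul_left_cancel₀ (hD.ne_zero (hWU hq)).2.2 ?_
    linear_combination θ.f q.1 q.2.1 * hc q hq
      - dirDeriv e (fun q => θ.f q.1 q.2.1) q * hD.eq_vv q (hWU hq)
  intro q hq
  have hqU := hWU hq
  have D := fun {g : ℝ × ℝ × ℝ → ℝ} (hg : ContDiffOn ℝ ∞ g φ.dom) =>
    hasLineDerivAt_dirDeriv hU hg hqU (0, 0, 1)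
  have h := eq_of_hasLineDerivAt hW hq
    (lineDeriv_mul (D (smooth_dirDeriv hU sF e)) (lineDeriv_inv_lam hθ hb hqU (0, 0, 1)))
    (lineDeriv_mul (lineDeriv_sub (lineDeriv_mul (D (smooth_dirDeriv hU sF e)) (D sβ))
      (lineDeriv_mul (D sF) (D (smooth_dirDeriv hU sβ e)))) (D sa)) lin
  rw [dirDeriv_comm hU sF hqU, dirDeriv_comm hU sβ hqU,
    dirDeriv_eq_zero_of_eq_const hU hqU fun r hr => Dv_f hθ hb hr,
    dirDeriv_eq_zero_of_eq_const hU hqU (hD.Dv_sqCoeff hθ'), Dv_f hθ hb hqU,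
    hD.Dv_sqCoeff hθ' q hqU] at h
  have h0 : (dirDeriv e (fun q => θ.f q.1 q.2.1) q * sqCoeff θ' φ q
        - θ.f q.1 q.2.1 * dirDeriv e (sqCoeff θ' φ) q) = 0 := by
    refine (mul_eq_zero.1 ?_).resolve_right (ha q hq)
    linear_combination -h
  have h1 := lin q hq
  rw [h0, zero_mul] at h1
  have h2 := (mul_eq_zero.1 h1).resolve_right (inv_ne_zero (hθ.lam_ne_zero _ (hb q hqU).1))
  refine ⟨h2, ?_⟩
  rw [h2, zero_mul, zero_sub, neg_eq_zero] at h0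
  exact (mul_eq_zero.1 h0).resolve_left (hf q hq)

/-- The compatibility condition obtained by differentiating the equation for `V_vv` in `t` and the
one for `V_t` in `v`, in the case where `f` does not depend on `x`. -/
theorem compat_t (hθ : IsPotential θ) (hθ' : IsPotential θ')
    {W : Set (ℝ × ℝ × ℝ)} (hW : IsOpen W) (hWU : W ⊆ φ.dom)
    (hf : ∀ q ∈ W, θ.f q.1 q.2.1 ≠ 0)
    (hFx : ∀ q ∈ W, Dx (fun q => θ.f q.1 q.2.1) q = 0)
    (hβx : ∀ q ∈ W, Dx (sqCoeff θ' φ) q = 0) (hp : p ∈ W) :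
    2 * Dt (fun q => θ.f q.1 q.2.1) p * Dv (Dv φ.V) p
      = -Dt (sqCoeff θ' φ) p * Dv φ.V p ^ 2 := by
  have hU := φ.isOpen
  have hb := hD.between
  have hpU := hWU hp
  have sV := smooth_dirDeriv hU φ.smooth_V
  have sF := smooth_f hθ hb
  have sβ := hD.smooth_sqCoeff hθ'
  have sG := hD.smooth_drift hθ
  set F : ℝ × ℝ × ℝ → ℝ := fun q => θ.f q.1 q.2.1
  set β := sqCoeff θ' φ
  set G := drift θ φ
  set a := Dv φ.V
  have sa : ContDiffOn ℝ ∞ a φ.dom := sV (0, 0, 1)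
  set s : ℝ × ℝ × ℝ → ℝ := fun q => G q - β q * Dx φ.V q
  have ss : ContDiffOn ℝ ∞ s φ.dom := sG.sub (sβ.mul (sV (0, 1, 0)))
  have D := fun {q : ℝ × ℝ × ℝ} (hq : q ∈ W) {g : ℝ × ℝ × ℝ → ℝ} (hg : ContDiffOn ℝ ∞ g φ.dom)
    e => hasLineDerivAt_dirDeriv hU hg (hWU hq) e
  have hf2 : θ.f2 p.1 = 0 := by
    have h1 := Dx_Dx_f hθ hb hpU
    rw [dirDeriv_eq_zero_of_eq_const hW hp hFx] at h1
    linarith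
  have hVvx : ∀ q ∈ φ.dom, Dv (Dx φ.V) q = Dx a q := fun q hq => dirDeriv_comm hU φ.smooth_V hq _ _
  have hVvt : ∀ q ∈ φ.dom, Dv (Dt φ.V) q = Dt a q := fun q hq => dirDeriv_comm hU φ.smooth_V hq _ _
  have hVvxx : ∀ q ∈ φ.dom, Dv (Dx (Dx φ.V)) q = Dx (Dx a) q := fun q hq => by
    rw [dirDeriv_comm hU (sV _) hq, dirDeriv_congr hU hq hVvx]
  have eqv : ∀ q ∈ W, 2 * F q * Dv a q = a q * ((θ.lam q.1)⁻¹ - β q * a q) := fun q hq =>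
    hD.eq_vv q (hWU hq)
  have eqx : ∀ q ∈ W, 2 * F q * Dx a q = a q * s q := fun q hq => hD.eq_xv q (hWU hq)
  have eqt : ∀ q ∈ W, Dt φ.V q = Dx φ.V q * G q - β q * (Dx φ.V q * Dx φ.V q) * (1 / 2)
      - F q * Dx (Dx φ.V) q := fun q hq => by
    have := hD.eq_t q (hWU hq)
    rwa [hFx q hq, add_zero] at this
  have hsv : ∀ q ∈ W, Dv s q = -(β q * Dx a q) := fun q hq => by
    have h := eq_of_hasLineDerivAt hW hq (D hq ss (0, 0, 1))
      (lineDeriv_sub (D hq sG (0, 0, 1)) (lineDeriv_mul (D hq sβ (0, 0, 1))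
        (D hq (sV (0, 1, 0)) (0, 0, 1)))) fun r _ => rfl
    rw [hD.Dv_drift hθ q (hWU hq), hD.Dv_sqCoeff hθ' q (hWU hq), hVvx q (hWU hq)] at h
    linear_combination h
  have hsvx : Dv (Dx s) p = -(β p * Dx (Dx a) p) := by
    have h := eq_of_hasLineDerivAt hW hp (D hp (smooth_dirDeriv hU ss (0, 0, 1)) (0, 1, 0))
      (lineDeriv_mul (lineDeriv_mul (lineDeriv_const (-1)) (D hp sβ (0, 1, 0)))
        (D hp (smooth_dirDeriv hU sa (0, 1, 0)) (0, 1, 0)))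
      fun r hr => by rw [hsv r hr]; ring
    rw [hβx p hp] at h
    rw [dirDeriv_comm hU ss hpU]
    linear_combination h
  have eqtv : ∀ q ∈ W, Dt a q = Dx a q * s q - F q * Dx (Dx a) q := fun q hq => by
    have h := eq_of_hasLineDerivAt hW hq (D hq (sV (1, 0, 0)) (0, 0, 1))
      (lineDeriv_sub (lineDeriv_sub (lineDeriv_mul (D hq (sV (0, 1, 0)) (0, 0, 1))
        (D hq sG (0, 0, 1)))
        (lineDeriv_mul (lineDeriv_mul (D hq sβ (0, 0, 1)) (lineDeriv_mul
          (D hq (sV (0, 1, 0)) (0, 0, 1)) (D hq (sV (0, 1, 0)) (0, 0, 1))))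
          (lineDeriv_const (1 / 2))))
        (lineDeriv_mul (D hq sF (0, 0, 1))
          (D hq (smooth_dirDeriv hU (sV (0, 1, 0)) (0, 1, 0)) (0, 0, 1)))) eqt
    rw [hD.Dv_drift hθ q (hWU hq), hD.Dv_sqCoeff hθ' q (hWU hq), hVvx q (hWU hq),
      hVvt q (hWU hq), hVvxx q (hWU hq), Dv_f hθ hb (hWU hq)] at h
    linear_combination h
  have eqxx : ∀ q ∈ W, 2 * F q * Dx (Dx a) q = Dx a q * s q + a q * Dx s q := fun q hq => by
    have h := eq_of_hasLineDerivAt hW hq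
      (lineDeriv_mul (lineDeriv_mul (lineDeriv_const 2) (D hq sF (0, 1, 0)))
        (D hq (smooth_dirDeriv hU sa (0, 1, 0)) (0, 1, 0)))
      (lineDeriv_mul (D hq sa (0, 1, 0)) (D hq ss (0, 1, 0))) eqx
    rw [hFx q hq] at h
    linear_combination h
  have eqxv : 2 * F p * Dv (Dx a) p = Dv a p * s p - β p * a p * Dx a p := by
    have h := eq_of_hasLineDerivAt hW hp
      (lineDeriv_mul (lineDeriv_mul (lineDeriv_const 2) (D hp sF (0, 0, 1)))
        (D hp (smooth_dirDeriv hU sa (0, 1, 0)) (0, 0, 1)))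
      (lineDeriv_mul (D hp sa (0, 0, 1)) (D hp ss (0, 0, 1))) eqx
    rw [Dv_f hθ hb hpU, hsv p hp] at h
    linear_combination h
  have eqt' : ∀ q ∈ W, 2 * Dt a q = Dx a q * s q - a q * Dx s q := fun q hq => by
    linear_combination 2 * eqtv q hq - eqxx q hq
  -- `A` and `B` are two expressions for `V_vvt`, from the equations for `V_t` and for `V_vv`
  have A : 2 * Dv (Dt a) p = Dv (Dx a) p * s p - β p * Dx a p * Dx a p - Dv a p * Dx s p
      + β p * a p * Dx (Dx a) p := by
    have h := eq_of_hasLineDerivAt hW hp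
      (lineDeriv_mul (lineDeriv_const 2) (D hp (smooth_dirDeriv hU sa (1, 0, 0)) (0, 0, 1)))
      (lineDeriv_sub (lineDeriv_mul (D hp (smooth_dirDeriv hU sa (0, 1, 0)) (0, 0, 1))
        (D hp ss (0, 0, 1))) (lineDeriv_mul (D hp sa (0, 0, 1))
        (D hp (smooth_dirDeriv hU ss (0, 1, 0)) (0, 0, 1)))) eqt'
    rw [hsv p hp, hsvx] at h
    linear_combination h
  have B := eq_of_hasLineDerivAt hW hp
    (lineDeriv_mul (lineDeriv_mul (lineDeriv_const 2) (D hp sF (1, 0, 0)))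
      (D hp (smooth_dirDeriv hU sa (0, 0, 1)) (1, 0, 0)))
    (lineDeriv_mul (D hp sa (1, 0, 0)) (lineDeriv_sub (lineDeriv_inv_lam hθ hb hpU (1, 0, 0))
      (lineDeriv_mul (D hp sβ (1, 0, 0)) (D hp sa (1, 0, 0))))) eqv
  rw [hf2, dirDeriv_comm hU sa hpU (1, 0, 0) (0, 0, 1)] at B
  have e1 := eqv p hp
  have e2 := eqx p hp
  refine mul_left_cancel₀ (mul_ne_zero two_ne_zero (hf p hp)) ?_
  set g := (θ.lam p.1)⁻¹ with hg
  show 2 * F p * (2 * Dt F p * Dv a p) = 2 * F p * (-Dt β p * a p ^ 2)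
  linear_combination 2 * F p * B - 2 * F p ^ 2 * A - F p * s p * eqxv
    + F p * β p * Dx a p * e2 + F p * Dx s p * e1 - F p * β p * a p * eqxx p hp
    + F p * (g - 2 * β p * a p) * eqt' p hp - s p ^ 2 / 2 * e1
    + s p * (g - β p * a p) / 2 * e2

/-- For `f ≠ const`, the transformation is affine in `v`. -/
theorem Dv_Dv_V (hθ2 : θ ∈ P2) (hθ' : IsPotential θ') : ∀ q ∈ φ.dom, Dv (Dv φ.V) q = 0 := by
  have hθ := hθ2.1
  have hU := φ.isOpen
  have hb := hD.between
  have sa := smooth_dirDeriv hU (smooth_dirDeriv hU φ.smooth_V (0, 0, 1)) (0, 0, 1)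
  refine eq_zero_of_eq_zero_of_ne_zero hθ hθ' hb sa.continuousOn fun p hp hfp _ => ?_
  by_contra hap
  set W := φ.dom ∩ {q | θ.f q.1 q.2.1 * Dv (Dv φ.V) q ≠ 0}
  have hW : IsOpen W :=
    ((continuousOn_f hθ hb).mul sa.continuousOn).isOpen_inter_preimage hU isOpen_ne
  have hpW : p ∈ W := ⟨hp, mul_ne_zero hfp hap⟩
  have hWU : W ⊆ φ.dom := inter_subset_left
  have hf : ∀ q ∈ W, θ.f q.1 q.2.1 ≠ 0 := fun q hq => left_ne_zero_of_mul hq.2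
  have ha : ∀ q ∈ W, Dv (Dv φ.V) q ≠ 0 := fun q hq => right_ne_zero_of_mul hq.2
  have hx := hD.gradient_eq_zero_of_compat hθ hθ' hW hWU hf ha (0, 1, 0)
    fun q hq => hD.compat_x hθ hθ' (hWU hq) (hf q hq)
  have ht := hD.gradient_eq_zero_of_compat hθ hθ' hW hWU hf ha (1, 0, 0)
    fun q hq => hD.compat_t hθ hθ' hW hWU hf (fun q hq => (hx q hq).1)
      (fun q hq => (hx q hq).2) hq
  -- hence `f` is constant on a ball, which is excluded
  obtain ⟨ε, hε, hball⟩ := Metric.isOpen_iff.1 hW p hpW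
  obtain ⟨c, hc⟩ := eq_const_of_gradient_eq_zero Metric.isOpen_ball
    ((convex_ball p ε).isConnected ⟨p, Metric.mem_ball_self hε⟩)
    ((smooth_f hθ hb).mono (hball.trans hWU)) (fun q hq => (ht q (hball hq)).1)
    (fun q hq => (hx q (hball hq)).1) (fun q hq => Dv_f hθ hb (hWU (hball hq)))
  refine hθ2.2 {t | (t, p.2.1, p.2.2) ∈ Metric.ball p ε} (fun t ht => (hb _ (hWU (hball ht))).1)
    (Metric.isOpen_ball.preimage (by fun_prop)) ⟨p.1, Metric.mem_ball_self hε⟩ ⟨c, ?_⟩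
  intro t ht x
  have hnear : ∀ᶠ y in 𝓝 p.2.1, θ.f2 t * y ^ 2 + θ.f1 t * y + (θ.f0 t - c) = 0 := by
    have hcont : ContinuousAt (fun y : ℝ => ((t, y, p.2.2) : ℝ × ℝ × ℝ)) p.2.1 := by fun_prop
    filter_upwards [hcont.eventually (Metric.isOpen_ball.mem_nhds ht)] with y hy
    have h1 : θ.f t y = c := hc _ hy
    rw [hθ.f_eq (hb _ (hWU (hball ht))).1] at h1
    linear_combination h1
  obtain ⟨h2, h1, h0⟩ := quadratic_coeffs_eq_zero hnear
  rw [hθ.f_eq (hb _ (hWU (hball ht))).1, h2, h1]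
  linear_combination h0

end DeterminingSystem

/-! ### Solution of the determining equations: affine dependence on `t` -/

theorem lineDeriv_lam {θ : ArbitraryElement} (hθ : IsPotential θ) {p : ℝ × ℝ × ℝ}
    (hp : p.1 ∈ θ.I) (e : ℝ × ℝ × ℝ) :
    HasLineDerivAt ℝ (fun q : ℝ × ℝ × ℝ => θ.lam q.1) (2 * θ.f2 p.1 * θ.lam p.1 * e.1) p e :=
  lineDeriv_comp (g := fun q : ℝ × ℝ × ℝ => q.1) (hθ.hasDerivAt_lam hp) lineDeriv_time

namespace DeterminingSystem

variable {θ θ' : ArbitraryElement} {φ : PointTransformation}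

/-- The consequences of the determining equations once `V` is known to be affine in `v`. -/
theorem exists_Dv_V_eq (hD : DeterminingSystem θ θ' φ) (hθ : IsPotential θ)
    (hθ' : IsPotential θ') (hvv : ∀ q ∈ φ.dom, Dv (Dv φ.V) q = 0) :
    ∃ c₀ : ℝ, c₀ ≠ 0 ∧ (∀ q ∈ φ.dom, Dv φ.V q = c₀) ∧ (∀ q ∈ φ.dom, Dx (Dx φ.X) q = 0) ∧
      (∀ q ∈ φ.dom, sqCoeff θ' φ q * c₀ = (θ.lam q.1)⁻¹) := by
  have hU := φ.isOpen
  have hb := hD.between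
  have sV := smooth_dirDeriv hU φ.smooth_V
  have sa := sV (0, 0, 1)
  have sβ := hD.smooth_sqCoeff hθ'
  have D := fun {q : ℝ × ℝ × ℝ} (hq : q ∈ φ.dom) {g : ℝ × ℝ × ℝ → ℝ}
    (hg : ContDiffOn ℝ ∞ g φ.dom) e => hasLineDerivAt_dirDeriv hU hg hq e
  have h1 : ∀ q ∈ φ.dom, sqCoeff θ' φ q * Dv φ.V q = (θ.lam q.1)⁻¹ := fun q hq => by
    have h := hD.eq_vv q hq
    rw [hvv q hq, mul_zero] at h
    linarith [(mul_eq_zero.1 h.symm).resolve_left (hD.ne_zero hq).2.2]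
  have hax : ∀ q ∈ φ.dom, Dx (Dv φ.V) q = 0 := fun q hq => by
    have h := eq_of_hasLineDerivAt hU hq
      (lineDeriv_mul (lineDeriv_mul (lineDeriv_const 2) (D hq (smooth_f hθ hb) (0, 0, 1)))
        (D hq (smooth_dirDeriv hU sa (0, 1, 0)) (0, 0, 1)))
      (lineDeriv_mul (D hq sa (0, 0, 1)) (lineDeriv_sub (D hq (hD.smooth_drift hθ) (0, 0, 1))
        (lineDeriv_mul (D hq sβ (0, 0, 1)) (D hq (sV (0, 1, 0)) (0, 0, 1))))) hD.eq_xv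
    rw [dirDeriv_comm hU sa hq, dirDeriv_eq_zero_of_eq_const hU hq hvv, hvv q hq,
      hD.Dv_drift hθ q hq, hD.Dv_sqCoeff hθ' q hq, Dv_f hθ hb hq,
      dirDeriv_comm hU φ.smooth_V hq (0, 0, 1) (0, 1, 0)] at h
    have h2 : Dv φ.V q * (sqCoeff θ' φ q * Dx (Dv φ.V) q) = 0 := by linear_combination h
    exact (mul_eq_zero.1 ((mul_eq_zero.1 h2).resolve_left (hD.ne_zero hq).2.2)).resolve_left
      (hD.sqCoeff_ne_zero hθ' hq)
  have hβx : ∀ q ∈ φ.dom, Dx (sqCoeff θ' φ) q = 0 := fun q hq => by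
    have h := eq_of_hasLineDerivAt hU hq (lineDeriv_mul (D hq sβ (0, 1, 0)) (D hq sa (0, 1, 0)))
      (lineDeriv_inv_lam hθ hb hq (0, 1, 0)) h1
    rw [hax q hq] at h
    refine (mul_eq_zero.1 ?_).resolve_right (hD.ne_zero hq).2.2
    linear_combination h
  have hat : ∀ q ∈ φ.dom, Dt (Dv φ.V) q = 0 := fun q hq => by
    have sF := smooth_f hθ hb
    have h := eq_of_hasLineDerivAt hU hq (D hq (sV (1, 0, 0)) (0, 0, 1))
      (lineDeriv_sub (lineDeriv_sub (lineDeriv_mul (D hq (sV (0, 1, 0)) (0, 0, 1))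
        (lineDeriv_add (D hq (hD.smooth_drift hθ) (0, 0, 1))
          (D hq (smooth_dirDeriv hU sF (0, 1, 0)) (0, 0, 1))))
        (lineDeriv_mul (lineDeriv_mul (D hq sβ (0, 0, 1)) (lineDeriv_mul
          (D hq (sV (0, 1, 0)) (0, 0, 1)) (D hq (sV (0, 1, 0)) (0, 0, 1))))
          (lineDeriv_const (1 / 2))))
        (lineDeriv_mul (D hq sF (0, 0, 1))
          (D hq (smooth_dirDeriv hU (sV (0, 1, 0)) (0, 1, 0)) (0, 0, 1)))) hD.eq_t
    have hVvx : ∀ q ∈ φ.dom, Dv (Dx φ.V) q = 0 := fun q hq => by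
      rw [dirDeriv_comm hU φ.smooth_V hq, hax q hq]
    rw [hD.Dv_drift hθ q hq, hD.Dv_sqCoeff hθ' q hq, dirDeriv_comm hU (sV (0, 1, 0)) hq,
      dirDeriv_eq_zero_of_eq_const hU hq hVvx, hVvx q hq, Dv_f hθ hb hq,
      dirDeriv_comm hU sF hq, dirDeriv_eq_zero_of_eq_const hU hq fun r hr => Dv_f hθ hb hr,
      dirDeriv_comm hU φ.smooth_V hq] at h
    rw [h]; ring
  obtain ⟨c₀, hc⟩ := eq_const_of_gradient_eq_zero hU φ.isConnected sa hat hax hvv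
  obtain ⟨q₀, hq₀⟩ := φ.isConnected.nonempty
  exact ⟨c₀, hc q₀ hq₀ ▸ (hD.ne_zero hq₀).2.2, hc, fun q hq => hD.Dx_Dx_X hθ' hq (hβx q hq),
    fun q hq => hc q hq ▸ h1 q hq⟩

/-- The equations for `T` and `X`, for `V` affine in `v`: `q = X_t / X_x` (that is, `drift`)
satisfies `q_t = q q_x`, `q_xx = 0`, which means that `1 / X_x` is affine in `t`. -/
theorem drift_equations (hD : DeterminingSystem θ θ' φ) (hθ : IsPotential θ) {c₀ : ℝ}
    (hc₀ : c₀ ≠ 0) (hVv : ∀ q ∈ φ.dom, Dv φ.V q = c₀)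
    (hXxx : ∀ q ∈ φ.dom, Dx (Dx φ.X) q = 0)
    (hβ : ∀ q ∈ φ.dom, sqCoeff θ' φ q * c₀ = (θ.lam q.1)⁻¹) :
    (∀ q ∈ φ.dom, drift θ φ q * Dx φ.X q = Dt φ.X q) ∧
    (∀ q ∈ φ.dom, Dx (drift θ φ) q * Dx φ.X q = Dt (Dx φ.X) q) ∧
    (∀ q ∈ φ.dom, Dt (drift θ φ) q = drift θ φ q * Dx (drift θ φ) q) ∧
    (∀ q ∈ φ.dom, Dx (Dx (drift θ φ)) q = 0) ∧
    (∀ q ∈ φ.dom, Dx φ.V q = c₀ * θ.lam q.1 * drift θ φ q) ∧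
    (∀ q ∈ φ.dom, Dt φ.V q = c₀ * θ.lam q.1 * (drift θ φ q * (drift θ φ q * (1 / 2)
      + Dx (fun q => θ.f q.1 q.2.1) q) - θ.f q.1 q.2.1 * Dx (drift θ φ) q)) := by
  have hU := φ.isOpen
  have hb := hD.between
  have sV := smooth_dirDeriv hU φ.smooth_V
  have sX := smooth_dirDeriv hU φ.smooth_X
  have sF := smooth_f hθ hb
  have sG := hD.smooth_drift hθ
  have D := fun {q : ℝ × ℝ × ℝ} (hq : q ∈ φ.dom) {g : ℝ × ℝ × ℝ → ℝ}
    (hg : ContDiffOn ℝ ∞ g φ.dom) e => hasLineDerivAt_dirDeriv hU hg hq e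
  have hl := fun q (hq : q ∈ φ.dom) => hθ.lam_ne_zero _ (hb q hq).1
  have e1 : ∀ q ∈ φ.dom, drift θ φ q * Dx φ.X q = Dt φ.X q := fun q hq => by
    rw [hD.drift_mul hq, hXxx q hq]; ring
  have e2 : ∀ q ∈ φ.dom, Dx (drift θ φ) q * Dx φ.X q = Dt (Dx φ.X) q := fun q hq => by
    have h := eq_of_hasLineDerivAt hU hq (lineDeriv_mul (D hq sG (0, 1, 0))
      (D hq (sX (0, 1, 0)) (0, 1, 0))) (D hq (sX (1, 0, 0)) (0, 1, 0)) e1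
    rw [hXxx q hq, dirDeriv_comm hU φ.smooth_X hq] at h
    linear_combination h
  have e3 : ∀ q ∈ φ.dom, Dx (Dx (drift θ φ)) q = 0 := fun q hq => by
    have h := eq_of_hasLineDerivAt hU hq
      (lineDeriv_mul (D hq (smooth_dirDeriv hU sG (0, 1, 0)) (0, 1, 0))
      (D hq (sX (0, 1, 0)) (0, 1, 0)))
      (D hq (smooth_dirDeriv hU (sX (0, 1, 0)) (1, 0, 0)) (0, 1, 0)) e2
    rw [hXxx q hq, dirDeriv_comm hU (sX _) hq, dirDeriv_eq_zero_of_eq_const hU hq hXxx] at h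
    refine (mul_eq_zero.1 ?_).resolve_right (hD.ne_zero hq).2.1
    linear_combination h
  have e4 : ∀ q ∈ φ.dom, Dx φ.V q = c₀ * θ.lam q.1 * drift θ φ q := fun q hq => by
    have h := hD.eq_xv q hq
    rw [dirDeriv_eq_zero_of_eq_const hU hq hVv, mul_zero, hVv q hq] at h
    have h1 := (mul_eq_zero.1 h.symm).resolve_left hc₀
    have h2 := hβ q hq
    have h3 : θ.lam q.1 * (θ.lam q.1)⁻¹ = 1 := mul_inv_cancel₀ (hl q hq)
    linear_combination -c₀ * θ.lam q.1 * h1 - θ.lam q.1 * Dx φ.V q * h2 - Dx φ.V q * h3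
  have e5 : ∀ q ∈ φ.dom, Dt φ.V q = c₀ * θ.lam q.1 * (drift θ φ q * (drift θ φ q * (1 / 2)
      + Dx (fun q => θ.f q.1 q.2.1) q) - θ.f q.1 q.2.1 * Dx (drift θ φ) q) := fun q hq => by
    have h1 := eq_of_hasLineDerivAt hU hq (D hq (sV (0, 1, 0)) (0, 1, 0))
      (lineDeriv_mul (lineDeriv_mul (lineDeriv_const c₀)
        (lineDeriv_lam hθ (hb q hq).1 (0, 1, 0))) (D hq sG (0, 1, 0))) e4
    have h2 := hβ q hq
    have h3 : θ.lam q.1 * (θ.lam q.1)⁻¹ = 1 := mul_inv_cancel₀ (hl q hq)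
    rw [hD.eq_t q hq, h1, e4 q hq]
    linear_combination (-c₀ * θ.lam q.1 ^ 2 * drift θ φ q ^ 2 / 2) * h2
      - c₀ * θ.lam q.1 * drift θ φ q ^ 2 / 2 * h3
  refine ⟨e1, e2, fun q hq => ?_, e3, e4, e5⟩
  have h1 := eq_of_hasLineDerivAt hU hq (D hq (sV (1, 0, 0)) (0, 1, 0))
    (lineDeriv_mul (lineDeriv_mul (lineDeriv_const c₀) (lineDeriv_lam hθ (hb q hq).1 (0, 1, 0)))
      (lineDeriv_sub (lineDeriv_mul (D hq sG (0, 1, 0)) (lineDeriv_add (lineDeriv_mul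
        (D hq sG (0, 1, 0)) (lineDeriv_const (1 / 2)))
        (D hq (smooth_dirDeriv hU sF (0, 1, 0)) (0, 1, 0))))
        (lineDeriv_mul (D hq sF (0, 1, 0)) (D hq (smooth_dirDeriv hU sG (0, 1, 0)) (0, 1, 0)))))
    e5
  have h2 := eq_of_hasLineDerivAt hU hq (D hq (sV (0, 1, 0)) (1, 0, 0))
    (lineDeriv_mul (lineDeriv_mul (lineDeriv_const c₀) (lineDeriv_lam hθ (hb q hq).1 (1, 0, 0)))
      (D hq sG (1, 0, 0))) e4
  rw [dirDeriv_comm hU φ.smooth_V hq, h2, e3 q hq, Dx_Dx_f hθ hb hq] at h1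
  refine mul_left_cancel₀ (mul_ne_zero hc₀ (hl q hq)) ?_
  linear_combination h1

/-- `1 / X_x` is affine in `t`. -/
theorem exists_Dx_X_mul_eq_one (hD : DeterminingSystem θ θ' φ) (hθ : IsPotential θ)
    (hXxx : ∀ q ∈ φ.dom, Dx (Dx φ.X) q = 0)
    (h1 : ∀ q ∈ φ.dom, Dx (drift θ φ) q * Dx φ.X q = Dt (Dx φ.X) q)
    (h2 : ∀ q ∈ φ.dom, Dt (drift θ φ) q = drift θ φ q * Dx (drift θ φ) q)
    (h3 : ∀ q ∈ φ.dom, Dx (Dx (drift θ φ)) q = 0) :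
    ∃ γ δ : ℝ, ∀ q ∈ φ.dom, Dx φ.X q * (γ * q.1 + δ) = 1 := by
  have hU := φ.isOpen
  have sX := smooth_dirDeriv hU φ.smooth_X
  have sG := hD.smooth_drift hθ
  have D := fun {q : ℝ × ℝ × ℝ} (hq : q ∈ φ.dom) {g : ℝ × ℝ × ℝ → ℝ}
    (hg : ContDiffOn ℝ ∞ g φ.dom) e => hasLineDerivAt_dirDeriv hU hg hq e
  set r : ℝ × ℝ × ℝ → ℝ := fun q => (Dx φ.X q)⁻¹
  have sr : ContDiffOn ℝ ∞ r φ.dom := (sX _).inv fun q hq => (hD.ne_zero hq).2.1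
  have hrX : ∀ q ∈ φ.dom, r q * Dx φ.X q = 1 := fun q hq => inv_mul_cancel₀ (hD.ne_zero hq).2.1
  have hrd : ∀ q ∈ φ.dom, ∀ e, dirDeriv e r q * Dx φ.X q + r q * dirDeriv e (Dx φ.X) q = 0 :=
    fun q hq e => eq_of_hasLineDerivAt hU hq
      (lineDeriv_mul (D hq sr e) (D hq (sX (0, 1, 0)) e)) (lineDeriv_const 1) hrX
  have hrx : ∀ q ∈ φ.dom, Dx r q = 0 := fun q hq => by
    have h := hrd q hq (0, 1, 0)
    rw [hXxx q hq, mul_zero, add_zero] at h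
    exact (mul_eq_zero.1 h).resolve_right (hD.ne_zero hq).2.1
  have hrv : ∀ q ∈ φ.dom, Dv r q = 0 := fun q hq => by
    have h := hrd q hq (0, 0, 1)
    rw [dirDeriv_comm hU φ.smooth_X hq, dirDeriv_eq_zero_of_eq_const hU hq hD.Xv, mul_zero,
      add_zero] at h
    exact (mul_eq_zero.1 h).resolve_right (hD.ne_zero hq).2.1
  have hrt : ∀ q ∈ φ.dom, Dt r q = (-1) * (r q * Dx (drift θ φ) q) := fun q hq => by
    refine mul_right_cancel₀ (hD.ne_zero hq).2.1 ?_
    linear_combination hrd q hq (1, 0, 0) + r q * h1 q hq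
  have hGtx : ∀ q ∈ φ.dom, Dt (Dx (drift θ φ)) q = Dx (drift θ φ) q * Dx (drift θ φ) q :=
    fun q hq => by
    have h := eq_of_hasLineDerivAt hU hq (D hq (smooth_dirDeriv hU sG (1, 0, 0)) (0, 1, 0))
      (lineDeriv_mul (D hq sG (0, 1, 0)) (D hq (smooth_dirDeriv hU sG (0, 1, 0)) (0, 1, 0))) h2
    rw [h3 q hq] at h
    rw [dirDeriv_comm hU sG hq, h]; ring
  have hrtt : ∀ q ∈ φ.dom, Dt (Dt r) q = 0 := fun q hq => by
    have h := eq_of_hasLineDerivAt hU hq (D hq (smooth_dirDeriv hU sr (1, 0, 0)) (1, 0, 0))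
      (lineDeriv_mul (lineDeriv_const (-1)) (lineDeriv_mul (D hq sr (1, 0, 0))
        (D hq (smooth_dirDeriv hU sG (0, 1, 0)) (1, 0, 0)))) hrt
    rw [h, hGtx q hq, hrt q hq]; ring
  obtain ⟨γ, hγ⟩ := eq_const_of_gradient_eq_zero hU φ.isConnected
    (smooth_dirDeriv hU sr (1, 0, 0)) hrtt
    (fun q hq => by rw [dirDeriv_comm hU sr hq, dirDeriv_eq_zero_of_eq_const hU hq hrx])
    (fun q hq => by rw [dirDeriv_comm hU sr hq, dirDeriv_eq_zero_of_eq_const hU hq hrv])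
  have sm : ContDiffOn ℝ ∞ (fun q => r q - γ * q.1) φ.dom :=
    sr.sub (contDiffOn_const.mul contDiff_fst.contDiffOn)
  have hd : ∀ q ∈ φ.dom, ∀ e, dirDeriv e (fun q => r q - γ * q.1) q = dirDeriv e r q - γ * e.1 :=
    fun q hq e => by
    have h := eq_of_hasLineDerivAt hU hq (D hq sm e)
      (lineDeriv_sub (D hq sr e) (lineDeriv_mul (lineDeriv_const γ) lineDeriv_time))
      fun _ _ => rfl
    rw [h]; ring
  obtain ⟨δ, hδ⟩ := eq_const_of_gradient_eq_zero hU φ.isConnected sm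
    (fun q hq => by rw [hd q hq, hγ q hq]; ring)
    (fun q hq => by rw [hd q hq, hrx q hq]; ring)
    (fun q hq => by rw [hd q hq, hrv q hq]; ring)
  refine ⟨γ, δ, fun q hq => ?_⟩
  linear_combination hrX q hq - Dx φ.X q * hδ q hq

/-- The quotient of the target `λ` by the source `λ` is constant. -/
theorem exists_lam_eq (hD : DeterminingSystem θ θ' φ) (hθ : IsPotential θ)
    (hθ' : IsPotential θ') (hXxx : ∀ q ∈ φ.dom, Dx (Dx φ.X) q = 0) :
    ∃ ρ : ℝ, ρ ≠ 0 ∧ ∀ q ∈ φ.dom, θ'.lam (φ.T q) = ρ * θ.lam q.1 := by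
  have hU := φ.isOpen
  have hb := hD.between
  have D := fun {q : ℝ × ℝ × ℝ} (hq : q ∈ φ.dom) {g : ℝ × ℝ × ℝ → ℝ}
    (hg : ContDiffOn ℝ ∞ g φ.dom) e => hasLineDerivAt_dirDeriv hU hg hq e
  have sT := smooth_dirDeriv hU φ.smooth_T
  have sX := smooth_dirDeriv hU φ.smooth_X
  have hl := fun q (hq : q ∈ φ.dom) => hθ.lam_ne_zero _ (hb q hq).1
  have hl' := fun q (hq : q ∈ φ.dom) => hθ'.lam_ne_zero (φ.T q) (hb q hq).2
  have hfX : ∀ q ∈ φ.dom, (2 * θ'.f2 (φ.T q) * φ.X q + θ'.f1 (φ.T q)) * Dt φ.T q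
      = Dx (fun q => θ.f q.1 q.2.1) q * Dx φ.X q := fun q hq => by
    have h := f_X_rel hθ hθ' hb hD.Tx hD.Tv hD.Xv hD.f_rel q hq
    rw [hθ'.deriv_f (t := φ.T q) (hb q hq).2, hXxx q hq] at h
    linear_combination h
  have hf2 : ∀ q ∈ φ.dom, θ'.f2 (φ.T q) * Dt φ.T q = θ.f2 q.1 := fun q hq => by
    have h := eq_of_hasLineDerivAt hU hq
      (lineDeriv_mul (lineDeriv_add (lineDeriv_mul (lineDeriv_mul (lineDeriv_const 2)
        (lineDeriv_comp_T hθ'.isOpen hθ'.smooth_f2 hq (hb q hq).2 (0, 1, 0)))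
        (D hq φ.smooth_X (0, 1, 0)))
        (lineDeriv_comp_T hθ'.isOpen hθ'.smooth_f1 hq (hb q hq).2 (0, 1, 0)))
        (D hq (sT (1, 0, 0)) (0, 1, 0)))
      (lineDeriv_mul (D hq (smooth_dirDeriv hU (smooth_f hθ hb) (0, 1, 0)) (0, 1, 0))
        (D hq (sX (0, 1, 0)) (0, 1, 0))) hfX
    rw [hD.Tx q hq, dirDeriv_comm hU φ.smooth_T hq, dirDeriv_eq_zero_of_eq_const hU hq hD.Tx,
      hXxx q hq, Dx_Dx_f hθ hb hq] at h
    refine mul_right_cancel₀ (hD.ne_zero hq).2.1 ?_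
    linear_combination h / 2
  set k : ℝ × ℝ × ℝ → ℝ := fun q => θ'.lam (φ.T q) * (θ.lam q.1)⁻¹ with hk
  have sk : ContDiffOn ℝ ∞ k φ.dom :=
    (smooth_comp_T hb hθ'.smooth_lam).mul (smooth_inv_lam hθ hb)
  have hkd : ∀ q ∈ φ.dom, ∀ e, dirDeriv e k q
      = 2 * θ'.f2 (φ.T q) * θ'.lam (φ.T q) * dirDeriv e φ.T q * (θ.lam q.1)⁻¹
        + θ'.lam (φ.T q) * (-(2 * θ.f2 q.1 * (θ.lam q.1)⁻¹) * e.1) := fun q hq e =>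
    eq_of_hasLineDerivAt hU hq (D hq sk e)
      (lineDeriv_mul (lineDeriv_comp (g := φ.T) (hθ'.hasDerivAt_lam (hb q hq).2)
        (D hq φ.smooth_T e))
        (lineDeriv_inv_lam hθ hb hq e)) fun _ _ => rfl
  obtain ⟨ρ, hρ⟩ := eq_const_of_gradient_eq_zero hU φ.isConnected sk
    (fun q hq => by
      rw [hkd q hq]
      linear_combination 2 * θ'.lam (φ.T q) * (θ.lam q.1)⁻¹ * hf2 q hq)
    (fun q hq => by rw [hkd q hq, hD.Tx q hq]; ring)
    (fun q hq => by rw [hkd q hq, hD.Tv q hq]; ring)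
  have hmul : ∀ q ∈ φ.dom, θ'.lam (φ.T q) = ρ * θ.lam q.1 := fun q hq => by
    rw [← hρ q hq, hk]
    field_simp [hl q hq]
  obtain ⟨q₀, hq₀⟩ := φ.isConnected.nonempty
  exact ⟨ρ, fun h0 => hl' q₀ hq₀ (by rw [hmul q₀ hq₀, h0, zero_mul]), hmul⟩

end DeterminingSystem

/-! ### The function `V⁰` and the transformed coefficients of `f` -/

namespace Params

/-- The integrand in the definition of `V⁰`. -/
noncomputable def density (p : Params) (θ : ArbitraryElement) (s : ℝ) : ℝ :=
  ((p.δ * p.μ1 - p.γ * p.μ0) ^ 2 / (2 * p.κ ^ 2 * (p.γ * s + p.δ) ^ 2)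
      + (p.δ * p.μ1 - p.γ * p.μ0) / (p.κ * (p.γ * s + p.δ)) * θ.f1 s
      + p.γ / (p.γ * s + p.δ) * θ.f0 s) * θ.lam s

variable {p : Params} {θ : ArbitraryElement} {S : Set ℝ} {t₀ t : ℝ}

theorem smooth_density (hθ : IsPotential θ) (hκ : p.κ ≠ 0) (hSI : S ⊆ θ.I)
    (hd : ∀ s ∈ S, p.γ * s + p.δ ≠ 0) : ContDiffOn ℝ ∞ (p.density θ) S := by
  have h : ContDiffOn ℝ ∞ (fun s : ℝ => p.γ * s + p.δ) S := by fun_prop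
  refine ContDiffOn.mul (ContDiffOn.add (ContDiffOn.add ?_ (ContDiffOn.mul ?_ ?_))
    (ContDiffOn.mul ?_ ?_)) (hθ.smooth_lam.mono hSI)
  · exact contDiffOn_const.div (contDiffOn_const.mul (h.pow 2)) fun s hs => by
      have := hd s hs
      positivity
  · exact contDiffOn_const.div (contDiffOn_const.mul h) fun s hs => mul_ne_zero hκ (hd s hs)
  · exact hθ.smooth_f1.mono hSI
  · exact contDiffOn_const.div h hd
  · exact hθ.smooth_f0.mono hSI

theorem hasDerivAt_V0 (hθ : IsPotential θ) (hκ : p.κ ≠ 0) (hSI : S ⊆ θ.I) (hS : IsOpen S)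
    (hSc : IsPreconnected S) (hd : ∀ s ∈ S, p.γ * s + p.δ ≠ 0) (ht₀ : t₀ ∈ S) (ht : t ∈ S) :
    HasDerivAt (p.V0 θ t₀) (p.density θ t) t := by
  have hc := (smooth_density hθ hκ hSI hd).continuousOn
  have h1 : IntervalIntegrable (p.density θ) MeasureTheory.volume t₀ t :=
    (hc.mono (hSc.ordConnected.uIcc_subset ht₀ ht)).intervalIntegrable
  exact (intervalIntegral.integral_hasDerivAt_right h1
    (hc.stronglyMeasurableAtFilter hS t ht) (hc.continuousAt (hS.mem_nhds ht))).add_const p.σ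

theorem smooth_V0 (hθ : IsPotential θ) (hκ : p.κ ≠ 0) (hSI : S ⊆ θ.I) (hS : IsOpen S)
    (hSc : IsPreconnected S) (hd : ∀ s ∈ S, p.γ * s + p.δ ≠ 0) (ht₀ : t₀ ∈ S) :
    ContDiffOn ℝ ∞ (p.V0 θ t₀) S := by
  have h := fun t (ht : t ∈ S) => hasDerivAt_V0 hθ hκ hSI hS hSc hd ht₀ ht
  exact (contDiffOn_infty_iff_deriv_of_isOpen hS).2
    ⟨fun t ht => (h t ht).differentiableAt.differentiableWithinAt,
      (smooth_density hθ hκ hSI hd).congr fun t ht => (h t ht).deriv⟩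

theorem V0_self : p.V0 θ t₀ t₀ = p.σ := by simp [V0]

end Params

/-- The relations between the coefficients that are equivalent to the relation
`f̃ = κ ^ 2 / Δ * f` at corresponding points. -/
theorem coeff_rels {A₂ A₁ A₀ F₂ F₁ F₀ r m κ Δ x₀ : ℝ} (hr : r ≠ 0) (hκ : κ ≠ 0)
    (h : ∀ᶠ x in 𝓝 x₀, A₂ * ((κ * x + m) / r) ^ 2 + A₁ * ((κ * x + m) / r) + A₀
      = κ ^ 2 / Δ * (F₂ * x ^ 2 + F₁ * x + F₀)) :
    A₂ = r ^ 2 / Δ * F₂ ∧ A₁ = r / Δ * (κ * F₁ - 2 * m * F₂) ∧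
      A₀ = 1 / Δ * (κ ^ 2 * F₀ - κ * m * F₁ + m ^ 2 * F₂) := by
  obtain ⟨h2, h1, h0⟩ := quadratic_coeffs_eq_zero
    (A := A₂ * κ ^ 2 / r ^ 2 - κ ^ 2 * Δ⁻¹ * F₂)
    (B := 2 * A₂ * κ * m / r ^ 2 + A₁ * κ / r - κ ^ 2 * Δ⁻¹ * F₁)
    (C := A₂ * m ^ 2 / r ^ 2 + A₁ * m / r + A₀ - κ ^ 2 * Δ⁻¹ * F₀) (x₀ := x₀) <| by
    filter_upwards [h] with x hx
    linear_combination hx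
  have e2 : A₂ = r ^ 2 * Δ⁻¹ * F₂ := by
    field_simp at h2
    have : κ ^ 2 * (A₂ - r ^ 2 * Δ⁻¹ * F₂) = 0 := by linear_combination h2
    linarith [(mul_eq_zero.1 this).resolve_left (pow_ne_zero 2 hκ)]
  have e1 : A₁ = r * Δ⁻¹ * (κ * F₁ - 2 * m * F₂) := by
    rw [e2] at h1
    field_simp at h1
    have : κ * (A₁ - r * Δ⁻¹ * (κ * F₁ - 2 * m * F₂)) = 0 := by linear_combination h1
    linarith [(mul_eq_zero.1 this).resolve_left hκ]
  have e0 : A₀ = Δ⁻¹ * (κ ^ 2 * F₀ - κ * m * F₁ + m ^ 2 * F₂) := by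
    rw [e2, e1] at h0
    field_simp at h0
    linear_combination h0
  exact ⟨by rw [e2]; ring, by rw [e1]; ring, by rw [e0]; ring⟩

namespace PointTransformation

theorem isOpen_times (φ : PointTransformation) : IsOpen φ.times :=
  isOpenMap_fst _ φ.isOpen

theorem isPreconnected_times (φ : PointTransformation) : IsPreconnected φ.times :=
  φ.isConnected.isPreconnected.image _ continuous_fst.continuousOn

end PointTransformation

/-! ### Every admissible transformation has the explicit form -/

section Integration

variable {U : Set (ℝ × ℝ × ℝ)} {g : ℝ × ℝ × ℝ → ℝ}

/-- A function on a domain with constant `t`-derivative and vanishing other derivatives is affine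
in `t`. -/
theorem eq_affine_of_gradient (hU : IsOpen U) (hc : IsConnected U) (hg : ContDiffOn ℝ ∞ g U)
    {a : ℝ} (ht : ∀ q ∈ U, Dt g q = a) (hx : ∀ q ∈ U, Dx g q = 0) (hv : ∀ q ∈ U, Dv g q = 0) :
    ∃ b, ∀ q ∈ U, g q = a * q.1 + b := by
  have sm : ContDiffOn ℝ ∞ (fun q => g q - a * q.1) U :=
    hg.sub (contDiffOn_const.mul contDiff_fst.contDiffOn)
  have hd : ∀ q ∈ U, ∀ e, dirDeriv e (fun q => g q - a * q.1) q = dirDeriv e g q - a * e.1 :=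
    fun q hq e => by
    have h := eq_of_hasLineDerivAt hU hq (hasLineDerivAt_dirDeriv hU sm hq e)
      (lineDeriv_sub (hasLineDerivAt_dirDeriv hU hg hq e)
        (lineDeriv_mul (lineDeriv_const a) lineDeriv_time)) fun _ _ => rfl
    rw [h]; ring
  obtain ⟨b, hb⟩ := eq_const_of_gradient_eq_zero hU hc sm
    (fun q hq => by rw [hd q hq, ht q hq]; ring)
    (fun q hq => by rw [hd q hq, hx q hq]; ring)
    (fun q hq => by rw [hd q hq, hv q hq]; ring)
  exact ⟨b, fun q hq => by linarith [hb q hq]⟩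

end Integration

variable {θ θ' : ArbitraryElement} {φ : PointTransformation}

/-- If `T_t = Δ / (γ t + δ) ^ 2`, then `T` is a linear fractional function. -/
theorem exists_T_eq {γ δ Δ : ℝ} (hTx : ∀ q ∈ φ.dom, Dx φ.T q = 0)
    (hTv : ∀ q ∈ φ.dom, Dv φ.T q = 0) (hr : ∀ q ∈ φ.dom, γ * q.1 + δ ≠ 0)
    (hTt : ∀ q ∈ φ.dom, Dt φ.T q * (γ * q.1 + δ) ^ 2 = Δ) :
    ∃ α β : ℝ, α * δ - β * γ = Δ ∧ ∀ q ∈ φ.dom, φ.T q = (α * q.1 + β) / (γ * q.1 + δ) := by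
  have hU := φ.isOpen
  have D := fun {q : ℝ × ℝ × ℝ} (hq : q ∈ φ.dom) {g : ℝ × ℝ × ℝ → ℝ}
    (hg : ContDiffOn ℝ ∞ g φ.dom) e => hasLineDerivAt_dirDeriv hU hg hq e
  have sT := φ.smooth_T
  have sT' := smooth_dirDeriv hU sT
  have sr : ContDiffOn ℝ ∞ (fun q : ℝ × ℝ × ℝ => γ * q.1 + δ) φ.dom := by fun_prop
  have dr : ∀ q e, HasLineDerivAt ℝ (fun q : ℝ × ℝ × ℝ => γ * q.1 + δ)
      (0 * q.1 + γ * e.1 + 0) q e := fun q e =>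
    lineDeriv_add (lineDeriv_mul (lineDeriv_const γ) lineDeriv_time) (lineDeriv_const δ)
  set N : ℝ × ℝ × ℝ → ℝ := fun q => φ.T q * (γ * q.1 + δ) with hN
  have sN : ContDiffOn ℝ ∞ N φ.dom := sT.mul sr
  have dN : ∀ q ∈ φ.dom, ∀ e, dirDeriv e N q
      = dirDeriv e φ.T q * (γ * q.1 + δ) + φ.T q * (γ * e.1) := fun q hq e => by
    rw [eq_of_hasLineDerivAt hU hq (D hq sN e) (lineDeriv_mul (D hq sT e) (dr q e))
      fun _ _ => rfl]; ring
  have hNx : ∀ q ∈ φ.dom, Dx N q = 0 := fun q hq => by rw [dN q hq, hTx q hq]; ring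
  have hNv : ∀ q ∈ φ.dom, Dv N q = 0 := fun q hq => by rw [dN q hq, hTv q hq]; ring
  have hNtt : ∀ q ∈ φ.dom, Dt (Dt N) q = 0 := fun q hq => by
    have h1 := eq_of_hasLineDerivAt hU hq (D hq (smooth_dirDeriv hU sN (1, 0, 0)) (1, 0, 0))
      (lineDeriv_add (lineDeriv_mul (D hq (sT' (1, 0, 0)) (1, 0, 0)) (dr q (1, 0, 0)))
        (lineDeriv_mul (D hq sT (1, 0, 0)) (lineDeriv_const γ)))
      fun r hr => by rw [dN r hr, mul_one]
    have h2 := eq_of_hasLineDerivAt hU hq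
      (lineDeriv_mul (D hq (sT' (1, 0, 0)) (1, 0, 0))
        (lineDeriv_mul (dr q (1, 0, 0)) (dr q (1, 0, 0)))) (lineDeriv_const Δ)
      fun r hr => by rw [← hTt r hr, sq]
    refine mul_right_cancel₀ (hr q hq) ?_
    rw [h1]
    linear_combination h2
  obtain ⟨α, hα⟩ := eq_const_of_gradient_eq_zero hU φ.isConnected
    (smooth_dirDeriv hU sN (1, 0, 0)) hNtt
    (fun q hq => by rw [dirDeriv_comm hU sN hq, dirDeriv_eq_zero_of_eq_const hU hq hNx])
    (fun q hq => by rw [dirDeriv_comm hU sN hq, dirDeriv_eq_zero_of_eq_const hU hq hNv])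
  obtain ⟨β, hβ⟩ := eq_affine_of_gradient hU φ.isConnected sN hα hNx hNv
  refine ⟨α, β, ?_, fun q hq => by
    rw [← hβ q hq, hN]; exact (mul_div_cancel_right₀ _ (hr q hq)).symm⟩
  obtain ⟨q, hq⟩ := φ.isConnected.nonempty
  have h1 := dN q hq (1, 0, 0)
  rw [hα q hq] at h1
  have h2 := hβ q hq
  simp only [hN] at h2
  linear_combination (γ * q.1 + δ) * h1 + hTt q hq + γ * h2

/-- If `q = X_t / X_x` satisfies `q_t = q q_x` and `X_x = 1 / (γ t + δ)`, then `q + γ X` is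
constant. -/
theorem exists_X_eq (hD : DeterminingSystem θ θ' φ) (hθ : IsPotential θ) {γ δ : ℝ}
    (hr : ∀ q ∈ φ.dom, Dx φ.X q * (γ * q.1 + δ) = 1)
    (h0 : ∀ q ∈ φ.dom, drift θ φ q * Dx φ.X q = Dt φ.X q)
    (h1 : ∀ q ∈ φ.dom, Dx (drift θ φ) q * Dx φ.X q = Dt (Dx φ.X) q)
    (h2 : ∀ q ∈ φ.dom, Dt (drift θ φ) q = drift θ φ q * Dx (drift θ φ) q) :
    ∃ μ₁ μ₀ : ℝ, (∀ q ∈ φ.dom, φ.X q * (γ * q.1 + δ) = q.2.1 + μ₁ * q.1 + μ₀) ∧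
      ∀ q ∈ φ.dom, drift θ φ q + γ * φ.X q = μ₁ := by
  have hU := φ.isOpen
  have D := fun {q : ℝ × ℝ × ℝ} (hq : q ∈ φ.dom) {g : ℝ × ℝ × ℝ → ℝ}
    (hg : ContDiffOn ℝ ∞ g φ.dom) e => hasLineDerivAt_dirDeriv hU hg hq e
  have sX := φ.smooth_X
  have sX' := smooth_dirDeriv hU sX
  have sG := hD.smooth_drift hθ
  have sr : ContDiffOn ℝ ∞ (fun q : ℝ × ℝ × ℝ => γ * q.1 + δ) φ.dom := by fun_prop
  have dr : ∀ q e, HasLineDerivAt ℝ (fun q : ℝ × ℝ × ℝ => γ * q.1 + δ)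
      (0 * q.1 + γ * e.1 + 0) q e := fun q e =>
    lineDeriv_add (lineDeriv_mul (lineDeriv_const γ) lineDeriv_time) (lineDeriv_const δ)
  -- `q_x = -γ X_x`, by differentiation of `X_x (γ t + δ) = 1` in `t`
  have hGx : ∀ q ∈ φ.dom, Dx (drift θ φ) q = -γ * Dx φ.X q := fun q hq => by
    have h := eq_of_hasLineDerivAt hU hq
      (lineDeriv_mul (D hq (sX' (0, 1, 0)) (1, 0, 0)) (dr q (1, 0, 0))) (lineDeriv_const 1) hr
    rw [← h1 q hq] at h
    linear_combination h - Dx (drift θ φ) q * hr q hq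
  set K : ℝ × ℝ × ℝ → ℝ := fun q => drift θ φ q + γ * φ.X q with hK
  have sK : ContDiffOn ℝ ∞ K φ.dom := sG.add (contDiffOn_const.mul sX)
  have dK : ∀ q ∈ φ.dom, ∀ e, dirDeriv e K q = dirDeriv e (drift θ φ) q + γ * dirDeriv e φ.X q :=
    fun q hq e => by
    rw [eq_of_hasLineDerivAt hU hq (D hq sK e) (lineDeriv_add (D hq sG e)
      (lineDeriv_mul (lineDeriv_const γ) (D hq sX e))) fun _ _ => rfl]; ring
  obtain ⟨μ₁, hμ₁⟩ := eq_const_of_gradient_eq_zero hU φ.isConnected sK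
    (fun q hq => by rw [dK q hq, h2 q hq, hGx q hq, ← h0 q hq]; ring)
    (fun q hq => by rw [dK q hq, hGx q hq]; ring)
    (fun q hq => by rw [dK q hq, hD.Dv_drift hθ q hq, hD.Xv q hq]; ring)
  set M : ℝ × ℝ × ℝ → ℝ := fun q => φ.X q * (γ * q.1 + δ) - q.2.1 with hM
  have sM : ContDiffOn ℝ ∞ M φ.dom := (sX.mul sr).sub (by fun_prop)
  have dM : ∀ q ∈ φ.dom, ∀ e, dirDeriv e M q
      = dirDeriv e φ.X q * (γ * q.1 + δ) + φ.X q * (γ * e.1) - e.2.1 := fun q hq e => by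
    rw [eq_of_hasLineDerivAt hU hq (D hq sM e) (lineDeriv_sub
      (lineDeriv_mul (D hq sX e) (dr q e)) lineDeriv_space) fun _ _ => rfl]; ring
  obtain ⟨μ₀, hμ₀⟩ := eq_affine_of_gradient hU φ.isConnected sM (a := μ₁)
    (fun q hq => by
      rw [dM q hq, ← h0 q hq, ← hμ₁ q hq, hK]
      linear_combination drift θ φ q * hr q hq)
    (fun q hq => by rw [dM q hq]; linear_combination hr q hq)
    (fun q hq => by rw [dM q hq, hD.Xv q hq]; ring)
  exact ⟨μ₁, μ₀, fun q hq => by have := hμ₀ q hq; simp only [hM] at this; linarith, hμ₁⟩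

/-- Pointwise relations on the domain of the transformation extend to all `x`, since `f` is
quadratic in `x`. -/
theorem hasForm_of_relations {t₀ : ℝ} {p : Params} (hθ : IsPotential θ) (hθ' : IsPotential θ')
    (hb : φ.Between θ θ') (hp : p.Valid) (hd : ∀ t ∈ φ.times, p.γ * t + p.δ ≠ 0)
    (hφ : ∀ t x v, (t, x, v) ∈ φ.dom → φ.map (t, x, v) = (p.T t, p.X t x, p.V θ t₀ t x v))
    (hf : ∀ q ∈ φ.dom, θ'.f (φ.T q) (φ.X q) = p.κ ^ 2 / p.Δ * θ.f q.1 q.2.1)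
    (hl : ∀ q ∈ φ.dom, θ'.lam (φ.T q) = p.c0 * (p.Δ / p.κ ^ 2) * θ.lam q.1) :
    HasForm θ φ θ' t₀ p := by
  have hT : ∀ q ∈ φ.dom, φ.T q = p.T q.1 := fun q hq => congrArg Prod.fst (hφ _ _ _ hq)
  have hX : ∀ q ∈ φ.dom, φ.X q = p.X q.1 q.2.1 := fun q hq =>
    congrArg (fun r => r.2.1) (hφ _ _ _ hq)
  have hI : ∀ t ∈ φ.times, t ∈ θ.I ∧ p.T t ∈ θ'.I := by
    rintro t ⟨q, hq, rfl⟩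
    exact ⟨(hb q hq).1, hT q hq ▸ (hb q hq).2⟩
  have hcoeff : ∀ t ∈ φ.times,
      θ'.f2 (p.T t) = (p.γ * t + p.δ) ^ 2 / p.Δ * θ.f2 t ∧
      θ'.f1 (p.T t) = (p.γ * t + p.δ) / p.Δ * (p.κ * θ.f1 t - 2 * (p.μ1 * t + p.μ0) * θ.f2 t) ∧
      θ'.f0 (p.T t) = 1 / p.Δ * (p.κ ^ 2 * θ.f0 t - p.κ * (p.μ1 * t + p.μ0) * θ.f1 t
        + (p.μ1 * t + p.μ0) ^ 2 * θ.f2 t) := by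
    intro t ht
    obtain ⟨⟨t, x, u⟩, hq, rfl⟩ := id ht
    have hcont : ContinuousAt (fun y : ℝ => ((t, y, u) : ℝ × ℝ × ℝ)) x := by fun_prop
    refine coeff_rels (x₀ := x) (hd _ ht) hp.2.1 ?_
    filter_upwards [hcont.eventually (φ.isOpen.mem_nhds hq)] with y hy
    have e1 := hf _ hy
    rw [hT _ hy, hX _ hy, hθ'.f_eq (hI _ ht).2, hθ.f_eq (hI _ ht).1] at e1
    simp only [Params.X] at e1
    rw [← e1]
    ring
  refine ⟨hp, hd, hφ, fun t ht => (hcoeff t ht).1, fun t ht => (hcoeff t ht).2.1,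
    fun t ht => (hcoeff t ht).2.2, fun t ht x => ?_, fun t ht => ?_⟩
  · have hr := hd t ht
    obtain ⟨e2, e1, e0⟩ := hcoeff t ht
    rw [hθ'.f_eq (hI t ht).2, hθ.f_eq (hI t ht).1]
    simp only [e2, e1, e0, Params.X]
    have := hp.1
    field_simp
    ring
  · obtain ⟨q, hq, rfl⟩ := ht
    rw [← hT q hq, hl q hq]

/-- Every point transformation between potential equations with `f ≠ const` in the source has the
explicit form, with `κ = 1`. -/
theorem exists_hasForm (hθ2 : θ ∈ P2) (hθ' : IsPotential θ') (hφ : φ.MapsEquation θ θ')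
    {t₀ : ℝ} (ht₀ : t₀ ∈ φ.times) : ∃ p : Params, HasForm θ φ θ' t₀ p := by
  have hθ := hθ2.1
  have hU := φ.isOpen
  have hD := determiningSystem hθ hθ' hφ
  have hb := hD.between
  have hl := fun q (hq : q ∈ φ.dom) => hθ.lam_ne_zero _ (hb q hq).1
  obtain ⟨c₀, hc₀, hVv, hXxx, hβ⟩ := hD.exists_Dv_V_eq hθ hθ' (hD.Dv_Dv_V hθ2 hθ')
  obtain ⟨h1, h2, h3, h4, hVx, hVt⟩ := hD.drift_equations hθ hc₀ hVv hXxx hβ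
  obtain ⟨γ, δ, hr⟩ := hD.exists_Dx_X_mul_eq_one hθ hXxx h2 h3 h4
  obtain ⟨ρ, hρ, hlam⟩ := hD.exists_lam_eq hθ hθ' hXxx
  obtain ⟨μ₁, μ₀, hX, hG⟩ := exists_X_eq hD hθ hr h1 h2 h3
  have hr0 : ∀ q ∈ φ.dom, γ * q.1 + δ ≠ 0 := fun q hq => right_ne_zero_of_mul_eq_one (hr q hq)
  have hTt : ∀ q ∈ φ.dom, Dt φ.T q * (γ * q.1 + δ) ^ 2 = ρ / c₀ := fun q hq => by
    have e1 := hD.sqCoeff_mul hθ' hq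
    have e2 := hβ q hq
    have e3 : θ.lam q.1 * (θ.lam q.1)⁻¹ = 1 := mul_inv_cancel₀ (hl q hq)
    rw [hlam q hq] at e1
    rw [eq_div_iff hc₀, ← e1]
    linear_combination (ρ * θ.lam q.1 * (Dx φ.X q * (γ * q.1 + δ)) ^ 2) * e2
      + ρ * (Dx φ.X q * (γ * q.1 + δ)) ^ 2 * e3
      + ρ * (Dx φ.X q * (γ * q.1 + δ) + 1) * hr q hq
  obtain ⟨α, β, hΔ, hT⟩ := exists_T_eq hD.Tx hD.Tv hr0 hTt
  have hΔ0 : ρ / c₀ ≠ 0 := div_ne_zero hρ hc₀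
  -- the additive constant in `V`, here `0`, is found by integration below
  set p : Params := ⟨α, β, γ, δ, μ₁, μ₀, 1, c₀, 0⟩ with hp
  have hSI : φ.times ⊆ θ.I := by rintro t ⟨q, hq, rfl⟩; exact (hb q hq).1
  have hd : ∀ t ∈ φ.times, p.γ * t + p.δ ≠ 0 := by rintro t ⟨q, hq, rfl⟩; exact hr0 q hq
  have hκ : p.κ ≠ 0 := one_ne_zero
  have sV0 := Params.smooth_V0 hθ hκ hSI φ.isOpen_times φ.isPreconnected_times hd ht₀
  set C := δ * μ₁ - γ * μ₀ with hC
  have hGC : ∀ q ∈ φ.dom, drift θ φ q * (γ * q.1 + δ) = C - γ * q.2.1 := fun q hq => by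
    rw [hC]
    linear_combination (γ * q.1 + δ) * hG q hq - γ * hX q hq
  set Z : ℝ × ℝ × ℝ → ℝ := fun q => φ.V q - (c₀ * q.2.2
    + c₀ * (θ.lam q.1 * (γ * q.1 + δ)⁻¹) * (C * q.2.1 - γ * (1 / 2) * (q.2.1 * q.2.1))
    + c₀ * p.V0 θ t₀ q.1) with hZ
  have slam := smooth_comp_time hb hθ.smooth_lam
  have sr : ContDiffOn ℝ ∞ (fun q : ℝ × ℝ × ℝ => γ * q.1 + δ) φ.dom := by fun_prop
  have sri : ContDiffOn ℝ ∞ (fun q : ℝ × ℝ × ℝ => (γ * q.1 + δ)⁻¹) φ.dom := sr.inv hr0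
  have sV0' : ContDiffOn ℝ ∞ (fun q : ℝ × ℝ × ℝ => p.V0 θ t₀ q.1) φ.dom :=
    sV0.comp contDiff_fst.contDiffOn fun q hq => ⟨q, hq, rfl⟩
  have sZ : ContDiffOn ℝ ∞ Z φ.dom := by
    refine φ.smooth_V.sub (ContDiffOn.add (ContDiffOn.add (by fun_prop) ?_)
      (contDiffOn_const.mul sV0'))
    exact (contDiffOn_const.mul (slam.mul sri)).mul (by fun_prop)
  have D := fun {q : ℝ × ℝ × ℝ} (hq : q ∈ φ.dom) {g : ℝ × ℝ × ℝ → ℝ}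
    (hg : ContDiffOn ℝ ∞ g φ.dom) e => hasLineDerivAt_dirDeriv hU hg hq e
  have dri : ∀ q ∈ φ.dom, ∀ e, HasLineDerivAt ℝ (fun q : ℝ × ℝ × ℝ => (γ * q.1 + δ)⁻¹)
      (-γ * ((γ * q.1 + δ)⁻¹) ^ 2 * e.1) q e := fun q hq e => by
    refine lineDeriv_comp (g := fun q : ℝ × ℝ × ℝ => q.1) (k := fun t => (γ * t + δ)⁻¹) ?_
      lineDeriv_time
    have := (((hasDerivAt_id q.1).const_mul γ).add_const δ).inv (hr0 q hq)
    convert! this using 1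
    simp only [id, mul_one]
    field_simp
  have dV0 : ∀ q ∈ φ.dom, ∀ e, HasLineDerivAt ℝ (fun q : ℝ × ℝ × ℝ => p.V0 θ t₀ q.1)
      (p.density θ q.1 * e.1) q e := fun q hq e =>
    lineDeriv_comp (g := fun q : ℝ × ℝ × ℝ => q.1) (Params.hasDerivAt_V0 hθ hκ hSI
      φ.isOpen_times φ.isPreconnected_times hd ht₀ ⟨q, hq, rfl⟩) lineDeriv_time
  have dZ := fun q (hq : q ∈ φ.dom) e => eq_of_hasLineDerivAt hU hq (D hq sZ e)
    (lineDeriv_sub (D hq φ.smooth_V e) (lineDeriv_add (lineDeriv_add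
      (lineDeriv_mul (lineDeriv_const c₀) lineDeriv_value)
      (lineDeriv_mul (lineDeriv_mul (lineDeriv_const c₀)
        (lineDeriv_mul (lineDeriv_lam hθ (hb q hq).1 e) (dri q hq e)))
        (lineDeriv_sub (lineDeriv_mul (lineDeriv_const C) lineDeriv_space)
          (lineDeriv_mul (lineDeriv_const (γ * (1 / 2)))
            (lineDeriv_mul lineDeriv_space lineDeriv_space)))))
      (lineDeriv_mul (lineDeriv_const c₀) (dV0 q hq e)))) fun _ _ => rfl
  have hri : ∀ q ∈ φ.dom, (γ * q.1 + δ) * (γ * q.1 + δ)⁻¹ = 1 := fun q hq =>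
    mul_inv_cancel₀ (hr0 q hq)
  have hGr : ∀ q ∈ φ.dom, drift θ φ q = (C - γ * q.2.1) * (γ * q.1 + δ)⁻¹ := fun q hq => by
    rw [← hGC q hq, mul_assoc, hri q hq, mul_one]
  have hGx : ∀ q ∈ φ.dom, Dx (drift θ φ) q = -γ * (γ * q.1 + δ)⁻¹ := fun q hq => by
    rw [eq_of_hasLineDerivAt hU hq (D hq (hD.smooth_drift hθ) (0, 1, 0))
      (lineDeriv_mul (lineDeriv_sub (lineDeriv_const C)
        (lineDeriv_mul (lineDeriv_const γ) lineDeriv_space)) (dri q hq (0, 1, 0))) hGr]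
    ring
  have hdens : ∀ q ∈ φ.dom, p.density θ q.1 = (C ^ 2 * (1 / 2) * ((γ * q.1 + δ)⁻¹) ^ 2
      + C * (γ * q.1 + δ)⁻¹ * θ.f1 q.1 + γ * (γ * q.1 + δ)⁻¹ * θ.f0 q.1) * θ.lam q.1 := by
    intro q hq
    have := hr0 q hq
    simp only [Params.density, hp, hC]
    field_simp
  obtain ⟨z, hz⟩ := eq_const_of_gradient_eq_zero hU φ.isConnected sZ
    (fun q hq => by
      rw [dZ q hq, hVt q hq, Dx_f hθ hb hq, hθ.deriv_f (hb q hq).1, hθ.f_eq (hb q hq).1,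
        hGx q hq, hGr q hq, hdens q hq]
      ring)
    (fun q hq => by
      rw [dZ q hq, hVx q hq, hGr q hq]
      ring)
    (fun q hq => by
      rw [dZ q hq, hVv q hq]
      ring)
  have hfrel : ∀ q ∈ φ.dom, θ'.f (φ.T q) (φ.X q) = 1 / (ρ / c₀) * θ.f q.1 q.2.1 := fun q hq => by
    have e1 := hD.f_rel q hq
    have e2 := hTt q hq
    rw [one_div, ← div_eq_inv_mul, eq_div_iff hΔ0, ← e2]
    rw [← mul_assoc, e1]
    linear_combination θ.f q.1 q.2.1 * (Dx φ.X q * (γ * q.1 + δ) + 1) * hr q hq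
  set p' : Params := ⟨α, β, γ, δ, μ₁, μ₀, 1, c₀, z / c₀⟩ with hp'
  have hΔ' : p'.Δ = ρ / c₀ := hΔ
  have hV0 : ∀ t, p'.V0 θ t₀ t = p.V0 θ t₀ t + z / c₀ := fun t => by
    simp only [Params.V0, hp, hp', add_zero]
  refine ⟨p', hasForm_of_relations hθ hθ' hb ⟨hΔ' ▸ hΔ0, one_ne_zero, hc₀⟩ hd ?_ ?_ ?_⟩
  · intro t x v hq
    have e1 : φ.T (t, x, v) = p'.T t := hT _ hq
    have e2 : φ.X (t, x, v) = p'.X t x := by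
      rw [Params.X, eq_div_iff (hr0 _ hq), hX _ hq]; simp [hp']
    have e3 : φ.V (t, x, v) = p'.V θ t₀ t x v := by
      have h := hz _ hq
      simp only [hZ] at h
      have := hr0 _ hq
      rw [Params.V, hV0]
      simp only [hp', one_mul, ← hC]
      field_simp
      field_simp at h
      linear_combination h
    rw [← e1, ← e2, ← e3]; rfl
  · intro q hq
    rw [hΔ', hfrel q hq]; simp [hp']
  · intro q hq
    rw [hΔ', hlam q hq]
    simp only [hp']
    field_simp

/-! ### The explicit transformations map equations to equations -/

theorem hasDerivAt_deriv_of_contDiffAt {k : ℝ → ℝ} {x : ℝ} (hk : ContDiffAt ℝ ∞ k x) :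
    (∀ᶠ y in 𝓝 x, DifferentiableAt ℝ k y) ∧ HasDerivAt (deriv k) (iteratedDeriv 2 k x) x := by
  have h1 : ∀ᶠ y in 𝓝 x, DifferentiableAt ℝ k y :=
    ((hk.of_le (m := 1) (by simp)).eventually (by simp)).mono
      fun y hy => hy.differentiableAt (by simp)
  refine ⟨h1, ?_⟩
  have h2 := hasDerivAt_deriv_comp (c := fun y : ℝ => y) (s := x) hk
    (Eventually.of_forall fun r => hasDerivAt_id r) (hasDerivAt_const x (1 : ℝ))
  have h3 : DifferentiableAt ℝ (deriv k) x := h2.differentiableAt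
  rw [iteratedDeriv_succ, iteratedDeriv_one]
  exact h3.hasDerivAt

/-- The target equation, with the derivatives of the image function expressed through those of
the original function, is a nonzero multiple of the source equation. -/
theorem transformed_equation_eq {a b k x l F₂ F₁ F₀ γ r κ Δ C c₀ m ξ wT wX wXX : ℝ} (hr : r ≠ 0)
    (hκ : κ ≠ 0) (hΔ : Δ ≠ 0) (hc₀ : c₀ ≠ 0) (hl : l ≠ 0) (hξ : ξ = (κ * x + m) / r)
    (hX : wX * (κ / r) = c₀ * (b - γ * l / r * x + C / (κ * r) * l))
    (hXX : wXX * (κ / r) * (κ / r) = c₀ * (k - γ * l / r))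
    (hT : wT * (Δ / r ^ 2) + wX * ((C - γ * κ * x) / r ^ 2)
      = c₀ * (a - (γ * (2 * F₂ * l) / (2 * r) - γ ^ 2 * l / (2 * r ^ 2)) * x ^ 2
        + (C / κ) * (2 * F₂ * l / r - γ * l / r ^ 2) * x
        + (C ^ 2 / (2 * κ ^ 2 * r ^ 2) + C / (κ * r) * F₁ + γ / r * F₀) * l)) :
    wT + 1 / (2 * (c₀ * (Δ / κ ^ 2) * l)) * wX ^ 2
        + κ ^ 2 / Δ * (F₂ * x ^ 2 + F₁ * x + F₀) * wXX
        - (2 * (r ^ 2 / Δ * F₂) * ξ + r / Δ * (κ * F₁ - 2 * m * F₂)) * wX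
      = c₀ * r ^ 2 / Δ * (a + 1 / (2 * l) * b ^ 2 + (F₂ * x ^ 2 + F₁ * x + F₀) * k
        - (2 * F₂ * x + F₁) * b) := by
  have eX : wX = c₀ * (b - γ * l / r * x + C / (κ * r) * l) * r / κ := by
    rw [← hX]; field_simp
  have eXX : wXX = c₀ * (k - γ * l / r) * r ^ 2 / κ ^ 2 := by
    rw [← hXX]; field_simp
  have eT : wT = (c₀ * (a - (γ * (2 * F₂ * l) / (2 * r) - γ ^ 2 * l / (2 * r ^ 2)) * x ^ 2
        + (C / κ) * (2 * F₂ * l / r - γ * l / r ^ 2) * x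
        + (C ^ 2 / (2 * κ ^ 2 * r ^ 2) + C / (κ * r) * F₁ + γ / r * F₀) * l)
        - wX * ((C - γ * κ * x) / r ^ 2)) * r ^ 2 / Δ := by
    rw [← hT]; field_simp; ring
  rw [eT, eXX, eX, hξ]
  field_simp
  ring

theorem Params.hasDerivAt_T (p : Params) {t : ℝ} (hr : p.γ * t + p.δ ≠ 0) :
    HasDerivAt p.T (p.Δ / (p.γ * t + p.δ) ^ 2) t := by
  have dr : HasDerivAt (fun s => p.γ * s + p.δ) p.γ t := by
    simpa using ((hasDerivAt_id t).const_mul p.γ).add_const p.δ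
  have := (((hasDerivAt_id t).const_mul p.α).add_const p.β).div dr hr
  convert! this using 1
  simp only [id, Params.Δ]
  ring

theorem Params.hasDerivAt_X (p : Params) (t x : ℝ) :
    HasDerivAt (p.X t) (p.κ / (p.γ * t + p.δ)) x := by
  have := ((((hasDerivAt_id x).const_mul p.κ).add_const (p.μ1 * t)).add_const p.μ0).div_const
    (p.γ * t + p.δ)
  rw [mul_one] at this
  exact this

/-- The explicit transformations map the source equation to the target equation. -/
theorem HasForm.mapsEquation {θ θ' : ArbitraryElement} {φ : PointTransformation} {t₀ : ℝ}
    {p : Params} (h : HasForm θ φ θ' t₀ p) (hθ : IsPotential θ) (hθ' : IsPotential θ')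
    (hb : φ.Between θ θ') (ht₀ : t₀ ∈ φ.times) : φ.MapsEquation θ θ' := by
  refine ⟨hb, fun v w t x hp hv hw hrel => ?_⟩
  have ht : t ∈ φ.times := ⟨_, hp, rfl⟩
  have htI : t ∈ θ.I := (hb _ hp).1
  have hTI : p.T t ∈ θ'.I := by
    have := (hb _ hp).2
    rwa [h.transformation _ _ _ hp] at this
  have hr := h.denom t ht
  obtain ⟨hΔ, hκ, hc₀⟩ := h.valid
  have hl := hθ.lam_ne_zero t htI
  simp only [h.transformation _ _ _ hp] at hw ⊢
  -- the relation between `v` and `w`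
  have hmem : ∀ᶠ q : ℝ × ℝ in 𝓝 (t, x), (q.1, q.2, v q.1 q.2) ∈ φ.dom := by
    have hc : ContinuousAt (fun q : ℝ × ℝ => (q.1, q.2, v q.1 q.2)) (t, x) :=
      continuousAt_fst.prodMk (continuousAt_snd.prodMk hv.continuousAt)
    exact hc.eventually (φ.isOpen.mem_nhds hp)
  have hrel' : ∀ᶠ q : ℝ × ℝ in 𝓝 (t, x),
      w (p.T q.1) (p.X q.1 q.2) = p.V θ t₀ q.1 q.2 (v q.1 q.2) := by
    filter_upwards [hmem, hrel] with q hq1 hq2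
    simpa only [h.transformation _ _ _ hq1] using hq2
  set C := p.δ * p.μ1 - p.γ * p.μ0 with hC
  set r := p.γ * t + p.δ with hrdef
  have hsp : Tendsto (fun y : ℝ => (t, y)) (𝓝 x) (𝓝 (t, x)) :=
    (Continuous.prodMk_right t).tendsto x
  have hti : Tendsto (fun s : ℝ => (s, x)) (𝓝 t) (𝓝 (t, x)) :=
    (Continuous.prodMk_left x).tendsto t
  have hvx : ContDiffAt ℝ ∞ (v t) x :=
    ContDiffAt.comp (g := fun q : ℝ × ℝ => v q.1 q.2) x hv (by fun_prop)
  have hwx : ContDiffAt ℝ ∞ (w (p.T t)) (p.X t x) :=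
    ContDiffAt.comp (g := fun q : ℝ × ℝ => w q.1 q.2) (p.X t x) hw (by fun_prop)
  obtain ⟨hv1, hv2⟩ := hasDerivAt_deriv_of_contDiffAt hvx
  obtain ⟨hw1, hw2⟩ := hasDerivAt_deriv_of_contDiffAt hwx
  have hXd := p.hasDerivAt_X t
  rw [← hrdef] at hXd
  -- derivatives in `x`
  have hx1 : ∀ᶠ y in 𝓝 x, deriv (w (p.T t)) (p.X t y) * (p.κ / r)
      = p.c0 * (deriv (v t) y - p.γ * θ.lam t / r * y + C / (p.κ * r) * θ.lam t) := by
    have hev : (fun y => w (p.T t) (p.X t y)) =ᶠ[𝓝 x] fun y => p.V θ t₀ t y (v t y) :=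
      hsp.eventually hrel'
    filter_upwards [hev.eventuallyEq_nhds, hv1, (hXd x).continuousAt.eventually hw1]
      with y hy1 hy2 hy3
    have d1 : HasDerivAt (fun y => w (p.T t) (p.X t y)) _ y := hy3.hasDerivAt.comp y (hXd y)
    have d2 := ((((hy2.hasDerivAt.sub (((hasDerivAt_id y).pow 2).const_mul
      (p.γ * θ.lam t / (2 * r)))).add ((hasDerivAt_id y).const_mul
      (C / (p.κ * r) * θ.lam t))).add_const (p.V0 θ t₀ t))).const_mul p.c0
    have e := d1.unique (d2.congr_of_eventuallyEq hy1)
    rw [e]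
    simp only [id, mul_one]
    field_simp
    ring
  have hx2 : iteratedDeriv 2 (w (p.T t)) (p.X t x) * (p.κ / r) * (p.κ / r)
      = p.c0 * (iteratedDeriv 2 (v t) x - p.γ * θ.lam t / r) := by
    have d1 := (hw2.comp x (hXd x)).mul_const (p.κ / r)
    have d2 := ((hv2.sub ((hasDerivAt_id x).const_mul (p.γ * θ.lam t / r))).add_const
      (C / (p.κ * r) * θ.lam t)).const_mul p.c0
    have e := d1.unique (d2.congr_of_eventuallyEq hx1)
    rw [e, mul_one]
  -- derivative in `t`
  have ht1 : deriv (fun s => w s (p.X t x)) (p.T t) * (p.Δ / r ^ 2)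
      + deriv (w (p.T t)) (p.X t x) * ((C - p.γ * p.κ * x) / r ^ 2)
      = p.c0 * (deriv (fun s => v s x) t
        - (p.γ * (2 * θ.f2 t * θ.lam t) / (2 * r) - p.γ ^ 2 * θ.lam t / (2 * r ^ 2)) * x ^ 2
        + (C / p.κ) * (2 * θ.f2 t * θ.lam t / r - p.γ * θ.lam t / r ^ 2) * x
        + (C ^ 2 / (2 * p.κ ^ 2 * r ^ 2) + C / (p.κ * r) * θ.f1 t + p.γ / r * θ.f0 t)
          * θ.lam t) := by
    have dr : HasDerivAt (fun s => p.γ * s + p.δ) p.γ t := by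
      simpa using ((hasDerivAt_id t).const_mul p.γ).add_const p.δ
    have dT := p.hasDerivAt_T hr
    have dX : HasDerivAt (fun s => p.X s x) ((C - p.γ * p.κ * x) / r ^ 2) t := by
      have := ((((hasDerivAt_id t).const_mul p.μ1).const_add (p.κ * x)).add_const p.μ0).div dr hr
      convert! this using 1
      simp only [id, hC, ← hrdef]
      rw [hrdef]; ring
    have dw := (HasFDerivAt.comp_hasDerivAt (l := fun q : ℝ × ℝ => w q.1 q.2) t
      (hw.differentiableAt (by simp)).hasFDerivAt (dT.prodMk dX))
    rw [fderiv_uncurry hw] at dw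
    have hvt : ContDiffAt ℝ ∞ (fun s => v s x) t :=
      ContDiffAt.comp (g := fun q : ℝ × ℝ => v q.1 q.2) (f := fun s : ℝ => (s, x)) t hv
        (by fun_prop)
    have dv := (hvt.differentiableAt (by simp)).hasDerivAt
    have dl := hθ.hasDerivAt_lam htI
    have dV0 := Params.hasDerivAt_V0 hθ hκ (S := φ.times)
      (by rintro s ⟨q, hq, rfl⟩; exact (hb q hq).1) φ.isOpen_times φ.isPreconnected_times h.denom
      ht₀ ht
    have dV := (((dv.sub (((dl.const_mul p.γ).div (dr.const_mul 2)
      (mul_ne_zero two_ne_zero hr)).mul_const (x ^ 2))).add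
      ((((hasDerivAt_const t C).div (dr.const_mul p.κ) (mul_ne_zero hκ hr)).mul dl).mul_const
        x)).add dV0).const_mul p.c0
    have e := dw.unique (dV.congr_of_eventuallyEq (hti.eventually hrel'))
    simp only [Pi.div_apply] at e
    rw [e, Params.density, ← hC, ← hrdef]
    field_simp
    ring
  have key := transformed_equation_eq (F₂ := θ.f2 t) (F₁ := θ.f1 t) (F₀ := θ.f0 t)
    (m := p.μ1 * t + p.μ0) (ξ := p.X t x) hr hκ hΔ hc₀ hl (by rw [Params.X, add_assoc])
    hx1.self_of_nhds hx2 ht1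
  simp only [ArbitraryElement.EquationAt]
  rw [hθ.deriv_f htI, hθ'.deriv_f hTI, h.f_rel t ht x, h.lam_rel t ht, h.f2_rel t ht,
    h.f1_rel t ht, hθ.f_eq htI]
  have hne : p.c0 * r ^ 2 / p.Δ ≠ 0 := div_ne_zero (mul_ne_zero hc₀ (pow_ne_zero 2 hr)) hΔ
  dsimp only
  rw [key, mul_eq_zero, or_iff_right hne]

/-! ### Uniqueness of the constants -/

namespace Params

variable {p : Params} {m : ℝ}

theorem scale_Δ : (p.scale m).Δ = m ^ 2 * p.Δ := by simp only [scale, Δ]; ring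

theorem scale_denom (t : ℝ) :
    (p.scale m).γ * t + (p.scale m).δ = m * (p.γ * t + p.δ) := by simp only [scale]; ring

theorem scale_T (hm : m ≠ 0) : (p.scale m).T = p.T := by
  funext t
  rw [T, scale_denom, T, ← mul_div_mul_left (p.α * t + p.β) _ hm]
  simp only [scale]; ring

theorem scale_X (hm : m ≠ 0) : (p.scale m).X = p.X := by
  funext t x
  rw [X, scale_denom, X, ← mul_div_mul_left (p.κ * x + p.μ1 * t + p.μ0) _ hm]
  simp only [scale]; ring

theorem scale_γ_div (hm : m ≠ 0) (t : ℝ) :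
    (p.scale m).γ / ((p.scale m).γ * t + (p.scale m).δ) = p.γ / (p.γ * t + p.δ) := by
  rw [scale_denom, ← mul_div_mul_left p.γ _ hm]
  simp only [scale]

theorem scale_μ_div (hm : m ≠ 0) (t : ℝ) :
    ((p.scale m).δ * (p.scale m).μ1 - (p.scale m).γ * (p.scale m).μ0)
        / ((p.scale m).κ * ((p.scale m).γ * t + (p.scale m).δ))
      = (p.δ * p.μ1 - p.γ * p.μ0) / (p.κ * (p.γ * t + p.δ)) := by
  rw [scale_denom, ← mul_div_mul_left (p.δ * p.μ1 - p.γ * p.μ0) _ (pow_ne_zero 2 hm)]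
  simp only [scale]
  congr 1 <;> ring

/-- The integrand of `V⁰` through quotients that are invariant under scaling of the constants. -/
theorem density_eq (p : Params) (θ : ArbitraryElement) (s : ℝ) :
    p.density θ s = (((p.δ * p.μ1 - p.γ * p.μ0) / (p.κ * (p.γ * s + p.δ))) ^ 2 / 2
      + (p.δ * p.μ1 - p.γ * p.μ0) / (p.κ * (p.γ * s + p.δ)) * θ.f1 s
      + p.γ / (p.γ * s + p.δ) * θ.f0 s) * θ.lam s := by
  rw [density, div_pow, div_div, mul_pow, mul_comm (_ * _) (2 : ℝ), mul_assoc]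

theorem scale_V0 (hm : m ≠ 0) (θ : ArbitraryElement) (t₀ : ℝ) :
    (p.scale m).V0 θ t₀ = p.V0 θ t₀ := by
  have h : (p.scale m).density θ = p.density θ := by
    funext s
    rw [density_eq, density_eq, scale_γ_div hm, scale_μ_div hm]
  funext t
  have e : ∀ q : Params, q.V0 θ t₀ t = (∫ s in t₀..t, q.density θ s) + q.σ := fun q => rfl
  rw [e, e, h]; rfl

theorem scale_V (hm : m ≠ 0) (θ : ArbitraryElement) (t₀ : ℝ) :
    (p.scale m).V θ t₀ = p.V θ t₀ := by
  have e : ∀ (q : Params) (t x v : ℝ), q.V θ t₀ t x v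
      = q.c0 * (v - q.γ / (q.γ * t + q.δ) * (θ.lam t / 2) * x ^ 2
        + (q.δ * q.μ1 - q.γ * q.μ0) / (q.κ * (q.γ * t + q.δ)) * θ.lam t * x
        + q.V0 θ t₀ t) := fun q t x v => by
    rw [V, div_mul_div_comm, mul_comm 2 (q.γ * t + q.δ)]
  funext t x v
  rw [e, e, scale_γ_div hm, scale_μ_div hm, scale_V0 hm]; rfl

/-- Two linear fractional functions that agree on a neighbourhood have proportional
coefficients. -/
theorem exists_multiplier {p q : Params} (hΔ : p.Δ ≠ 0) (hΔ' : q.Δ ≠ 0) {t₀ : ℝ}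
    (h : ∀ᶠ t in 𝓝 t₀, (p.α * t + p.β) * (q.γ * t + q.δ) = (q.α * t + q.β) * (p.γ * t + p.δ)) :
    ∃ m ≠ 0, q.α = m * p.α ∧ q.β = m * p.β ∧ q.γ = m * p.γ ∧ q.δ = m * p.δ := by
  obtain ⟨h2, h1, h0⟩ := quadratic_coeffs_eq_zero (A := p.α * q.γ - q.α * p.γ)
    (B := p.α * q.δ + p.β * q.γ - q.α * p.δ - q.β * p.γ) (C := p.β * q.δ - q.β * p.δ)
    (x₀ := t₀) (h.mono fun t ht => by linear_combination ht)
  -- the product of the adjugate of the matrix `(α, β; γ, δ)` of `p` with that of `q` is scalar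
  set n := p.δ * q.α - p.β * q.γ
  have e1 : q.α = n / p.Δ * p.α := by
    rw [div_mul_eq_mul_div, eq_div_iff hΔ, Δ]; linear_combination p.β * h2
  have e2 : q.β = n / p.Δ * p.β := by
    rw [div_mul_eq_mul_div, eq_div_iff hΔ, Δ]
    linear_combination p.β * h1 - p.α * h0
  have e3 : q.γ = n / p.Δ * p.γ := by
    rw [div_mul_eq_mul_div, eq_div_iff hΔ, Δ]; linear_combination p.δ * h2
  have e4 : q.δ = n / p.Δ * p.δ := by
    rw [div_mul_eq_mul_div, eq_div_iff hΔ, Δ]; linear_combination p.δ * h1 - p.γ * h0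
  refine ⟨n / p.Δ, fun h0 => hΔ' ?_, e1, e2, e3, e4⟩
  rw [Δ, e1, e2, h0]; ring

end Params

variable {θ θ' : ArbitraryElement} {φ : PointTransformation} {t₀ : ℝ} {p q : Params}

theorem HasForm.scale (h : HasForm θ φ θ' t₀ p) {m : ℝ} (hm : m ≠ 0) :
    HasForm θ φ θ' t₀ (p.scale m) := by
  have hΔ := h.valid.1
  have hm2 := pow_ne_zero 2 hm
  have hcancel : ∀ a : ℝ, m ^ 2 * a / (p.scale m).Δ = a / p.Δ := fun a => by
    rw [Params.scale_Δ, mul_div_mul_left _ _ hm2]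
  refine ⟨⟨?_, mul_ne_zero hm h.valid.2.1, h.valid.2.2⟩, fun t ht => ?_, fun t x v hq => ?_,
    fun t ht => ?_, fun t ht => ?_, fun t ht => ?_, fun t ht x => ?_, fun t ht => ?_⟩
  · rw [Params.scale_Δ]; exact mul_ne_zero hm2 hΔ
  · rw [Params.scale_denom]; exact mul_ne_zero hm (h.denom t ht)
  · rw [Params.scale_T hm, Params.scale_X hm, Params.scale_V hm, h.transformation _ _ _ hq]
  · rw [Params.scale_T hm, h.f2_rel t ht, Params.scale_denom, mul_pow, hcancel]
  · rw [Params.scale_T hm, h.f1_rel t ht, Params.scale_denom, Params.scale_Δ]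
    simp only [Params.scale]
    field_simp
  · rw [Params.scale_T hm, h.f0_rel t ht, Params.scale_Δ]
    simp only [Params.scale]
    field_simp
  · rw [Params.scale_T hm, Params.scale_X hm, h.f_rel t ht, ← hcancel, ← mul_pow]
    rfl
  · rw [Params.scale_T hm, h.lam_rel t ht, Params.scale_Δ]
    simp only [Params.scale]
    rw [mul_pow, mul_div_mul_left _ _ hm2]

/-- The constants are determined by the transformation up to a common multiplier. -/
theorem HasForm.exists_scale (h : HasForm θ φ θ' t₀ p) (h' : HasForm θ φ θ' t₀ q)
    (ht₀ : t₀ ∈ φ.times) : ∃ m : ℝ, m ≠ 0 ∧ q = p.scale m := by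
  have hT : ∀ᶠ t in 𝓝 t₀, (p.α * t + p.β) * (q.γ * t + q.δ)
      = (q.α * t + q.β) * (p.γ * t + p.δ) := by
    filter_upwards [φ.isOpen_times.mem_nhds ht₀] with t ht
    obtain ⟨r, hr, rfl⟩ := id ht
    have e := (h.transformation _ _ _ hr).symm.trans (h'.transformation _ _ _ hr)
    exact (div_eq_div_iff (h.denom _ ht) (h'.denom _ ht)).1 (congrArg Prod.fst e)
  obtain ⟨m, hm, e1, e2, e3, e4⟩ := Params.exists_multiplier h.valid.1 h'.valid.1 hT
  have hs := h.scale hm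
  refine ⟨m, hm, ?_⟩
  obtain ⟨⟨t, x₀, u₀⟩, hq, rfl⟩ := id ht₀
  have hrq : ∀ s, q.γ * s + q.δ = m * (p.γ * s + p.δ) := fun s => by rw [e3, e4]; ring
  have hX : ∀ r ∈ φ.dom, m * (p.κ * r.2.1 + p.μ1 * r.1 + p.μ0)
      = q.κ * r.2.1 + q.μ1 * r.1 + q.μ0 := fun r hr => by
    have e := congrArg (fun y => y.2.1)
      ((hs.transformation _ _ _ hr).symm.trans (h'.transformation _ _ _ hr))
    simp only [Params.X, Params.scale_denom, ← hrq] at e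
    rw [div_left_inj' (h'.denom _ ⟨r, hr, rfl⟩)] at e
    rw [← e]; simp only [Params.scale]; ring
  have hdom := φ.isOpen.mem_nhds hq
  obtain ⟨-, hκ, h0⟩ := quadratic_coeffs_eq_zero (A := 0) (B := m * p.κ - q.κ)
    (C := m * (p.μ1 * t + p.μ0) - (q.μ1 * t + q.μ0)) (x₀ := x₀) <| by
    have hc : ContinuousAt (fun y : ℝ => ((t, y, u₀) : ℝ × ℝ × ℝ)) x₀ := by fun_prop
    filter_upwards [hc.eventually hdom] with y hy
    linear_combination hX _ hy
  obtain ⟨-, hμ1, -⟩ := quadratic_coeffs_eq_zero (A := 0) (B := m * p.μ1 - q.μ1)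
    (C := m * (p.κ * x₀ + p.μ0) - (q.κ * x₀ + q.μ0)) (x₀ := t) <| by
    have hc : ContinuousAt (fun s : ℝ => ((s, x₀, u₀) : ℝ × ℝ × ℝ)) t := by fun_prop
    filter_upwards [hc.eventually hdom] with s hs
    linear_combination hX _ hs
  have eκ : q.κ = m * p.κ := by linear_combination -hκ
  have e5 : q.μ1 = m * p.μ1 := by linear_combination -hμ1
  have e6 : q.μ0 = m * p.μ0 := by linear_combination -h0 + t * hμ1
  -- at the initial time of the antiderivative `V⁰ = σ`
  set b := -(q.γ * θ.lam t / (2 * (q.γ * t + q.δ)) * x₀ ^ 2)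
    + (q.δ * q.μ1 - q.γ * q.μ0) / (q.κ * (q.γ * t + q.δ)) * θ.lam t * x₀ with hb
  obtain ⟨-, hc0, hσ⟩ := quadratic_coeffs_eq_zero (A := 0) (B := p.c0 - q.c0)
    (C := p.c0 * (b + p.σ) - q.c0 * (b + q.σ)) (x₀ := u₀) <| by
    have hc : ContinuousAt (fun u : ℝ => ((t, x₀, u) : ℝ × ℝ × ℝ)) u₀ := by fun_prop
    filter_upwards [hc.eventually hdom] with u hu
    have e := congrArg (fun y => y.2.2)
      ((hs.transformation _ _ _ hu).symm.trans (h'.transformation _ _ _ hu))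
    simp only [Params.V, Params.V0_self] at e
    simp only [Params.scale, ← e1, ← e2, ← e3, ← e4, ← e5, ← e6, ← eκ] at e
    rw [hb]
    linear_combination e
  have ec : q.c0 = p.c0 := by linear_combination -hc0
  have eσ : q.σ = p.σ := by
    rw [ec] at hσ
    have : p.c0 * (q.σ - p.σ) = 0 := by linear_combination -hσ
    linarith [(mul_eq_zero.1 this).resolve_left h.valid.2.2]
  obtain ⟨α, β, γ, δ, μ1, μ0, κ, c0, σ⟩ := q
  simp only [Params.scale, Params.mk.injEq]
  exact ⟨e1, e2, e3, e4, e5, e6, eκ, ec, eσ⟩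

theorem hasForm_iff_exists_scale (h : HasForm θ φ θ' t₀ p) (ht₀ : t₀ ∈ φ.times) :
    HasForm θ φ θ' t₀ q ↔ ∃ m : ℝ, m ≠ 0 ∧ q = p.scale m :=
  ⟨fun h' => h.exists_scale h' ht₀, fun ⟨_, hm, e⟩ => e ▸ h.scale hm⟩

/-! ### Existence of the target equation -/

namespace Params

/-- The inverse of the linear fractional function `T`. -/
noncomputable def Tinv (p : Params) (τ : ℝ) : ℝ := (p.δ * τ - p.β) / (p.α - p.γ * τ)

/-- The inverse of the function `X t`. -/
noncomputable def Xinv (p : Params) (t ξ : ℝ) : ℝ :=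
  (ξ * (p.γ * t + p.δ) - p.μ1 * t - p.μ0) / p.κ

variable {p : Params} {t : ℝ}

theorem sub_γ_mul_T (hr : p.γ * t + p.δ ≠ 0) : p.α - p.γ * p.T t = p.Δ / (p.γ * t + p.δ) := by
  rw [T, Δ]; field_simp; ring

theorem Tinv_T (hΔ : p.Δ ≠ 0) (hr : p.γ * t + p.δ ≠ 0) : p.Tinv (p.T t) = t := by
  rw [Tinv, sub_γ_mul_T hr, T, div_eq_iff (div_ne_zero hΔ hr), Δ, mul_div_assoc', mul_div_assoc',
    div_sub' hr, div_left_inj' hr]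
  ring

theorem T_Tinv (hΔ : p.Δ ≠ 0) {τ : ℝ} (hτ : p.α - p.γ * τ ≠ 0) : p.T (p.Tinv τ) = τ := by
  have h : p.γ * p.Tinv τ + p.δ = p.Δ / (p.α - p.γ * τ) := by
    rw [Tinv, Δ]; field_simp; ring
  rw [T, h, div_eq_iff (div_ne_zero hΔ hτ), Tinv, Δ, mul_div_assoc', mul_div_assoc',
    div_add' _ _ _ hτ, div_left_inj' hτ]
  ring

theorem Xinv_X (hκ : p.κ ≠ 0) (hr : p.γ * t + p.δ ≠ 0) (x : ℝ) : p.Xinv t (p.X t x) = x := by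
  rw [Xinv, X, div_mul_cancel₀ _ hr, div_eq_iff hκ]; ring

theorem hasDerivAt_Tinv (hΔ : p.Δ ≠ 0) (hr : p.γ * t + p.δ ≠ 0) :
    HasDerivAt p.Tinv ((p.γ * t + p.δ) ^ 2 / p.Δ) (p.T t) := by
  have hne : p.α - p.γ * p.T t ≠ 0 := by rw [sub_γ_mul_T hr]; exact div_ne_zero hΔ hr
  have h := (((hasDerivAt_id (p.T t)).const_mul p.δ).sub_const p.β).div
    (((hasDerivAt_id (p.T t)).const_mul p.γ).const_sub p.α) hne
  convert! h using 1
  simp only [id]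
  rw [sub_γ_mul_T hr]
  have : p.δ * 1 * (p.Δ / (p.γ * t + p.δ)) - (p.δ * p.T t - p.β) * -(p.γ * 1) = p.Δ := by
    rw [← sub_γ_mul_T hr, Δ]; ring
  rw [this]
  field_simp

/-- The target equation over the image of `J`, with the arbitrary elements obtained from the
source ones by inversion of the transformation. -/
noncomputable def target (p : Params) (θ : ArbitraryElement) (J : Set ℝ) : ArbitraryElement where
  I := p.T '' J
  f τ ξ := p.κ ^ 2 / p.Δ * θ.f (p.Tinv τ) (p.Xinv (p.Tinv τ) ξ)
  lam τ := p.c0 * (p.Δ / p.κ ^ 2) * θ.lam (p.Tinv τ)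

variable {θ : ArbitraryElement} {J : Set ℝ}

theorem continuousOn_T (hd : ∀ s ∈ J, p.γ * s + p.δ ≠ 0) : ContinuousOn p.T J := fun t ht =>
  (p.hasDerivAt_T (hd t ht)).continuousAt.continuousWithinAt

theorem smooth_Tinv : ContDiffOn ℝ ∞ p.Tinv {τ | p.α - p.γ * τ ≠ 0} :=
  ContDiffOn.div (by fun_prop) (by fun_prop) fun _ h => h

theorem image_T_eq (hΔ : p.Δ ≠ 0) (hd : ∀ s ∈ J, p.γ * s + p.δ ≠ 0) :
    p.T '' J = {τ | p.α - p.γ * τ ≠ 0} ∩ p.Tinv ⁻¹' J := by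
  ext τ
  constructor
  · rintro ⟨t, ht, rfl⟩
    refine ⟨?_, ?_⟩
    · rw [mem_ofPred_eq, sub_γ_mul_T (hd t ht)]
      exact div_ne_zero hΔ (hd t ht)
    · rwa [mem_preimage, Tinv_T hΔ (hd t ht)]
  · rintro ⟨h1, h2⟩
    exact ⟨_, h2, T_Tinv hΔ h1⟩

theorem isOpen_image_T (hΔ : p.Δ ≠ 0) (hJ : IsOpen J) (hd : ∀ s ∈ J, p.γ * s + p.δ ≠ 0) :
    IsOpen (p.T '' J) := by
  rw [image_T_eq hΔ hd]
  exact smooth_Tinv.continuousOn.isOpen_inter_preimage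
    (isOpen_ne_fun (by fun_prop) continuous_const) hJ

theorem target_f_T_X (hp : p.Valid) (hr : p.γ * t + p.δ ≠ 0) (x : ℝ) :
    (p.target θ J).f (p.T t) (p.X t x) = p.κ ^ 2 / p.Δ * θ.f t x := by
  simp only [target, Tinv_T hp.1 hr, Xinv_X hp.2.1 hr]

theorem target_lam_T (hp : p.Valid) (hr : p.γ * t + p.δ ≠ 0) :
    (p.target θ J).lam (p.T t) = p.c0 * (p.Δ / p.κ ^ 2) * θ.lam t := by
  simp only [target, Tinv_T hp.1 hr]

theorem target_f_T (hθ : IsPotential θ) (hp : p.Valid) (ht : t ∈ θ.I)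
    (hr : p.γ * t + p.δ ≠ 0) : ∃ B C, (p.target θ J).f (p.T t)
      = fun ξ => (p.γ * t + p.δ) ^ 2 / p.Δ * θ.f2 t * ξ ^ 2 + B * ξ + C := by
  have hκ := hp.2.1
  have hΔ := hp.1
  set r := p.γ * t + p.δ with hrdef
  set m := p.μ1 * t + p.μ0 with hm
  refine ⟨r / p.Δ * (p.κ * θ.f1 t - 2 * m * θ.f2 t),
    1 / p.Δ * (p.κ ^ 2 * θ.f0 t - p.κ * m * θ.f1 t + m ^ 2 * θ.f2 t), ?_⟩
  funext ξ
  simp only [target, Tinv_T hp.1 hr, hθ.f_eq ht, Xinv, ← hrdef, sub_sub, ← hm]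
  field_simp
  ring

theorem isPotential_target (hθ : IsPotential θ) (hp : p.Valid) (hJI : J ⊆ θ.I) (hJ : IsOpen J)
    (hJc : IsConnected J) (hd : ∀ s ∈ J, p.γ * s + p.δ ≠ 0) : IsPotential (p.target θ J) := by
  obtain ⟨hΔ, hκ, hc₀⟩ := hp
  have hp : p.Valid := ⟨hΔ, hκ, hc₀⟩
  have sTinv : ContDiffOn ℝ ∞ p.Tinv (p.T '' J) :=
    smooth_Tinv.mono (by rw [image_T_eq hΔ hd]; exact inter_subset_left)
  have hmaps : ∀ τ ∈ p.T '' J, p.Tinv τ ∈ J := by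
    rintro τ ⟨t, ht, rfl⟩
    rwa [Tinv_T hΔ (hd t ht)]
  refine ⟨isOpen_image_T hΔ hJ hd, hJc.image _ (continuousOn_T hd), ?_, ?_, ?_, ?_, ?_, ?_⟩
  · have s1 : ContDiffOn ℝ ∞ (fun q : ℝ × ℝ => p.Tinv q.1) ((p.T '' J) ×ˢ univ) :=
      sTinv.comp contDiff_fst.contDiffOn fun q hq => hq.1
    refine contDiffOn_const.mul (hθ.smooth_f.comp (s1.prodMk ?_)
      fun q hq => mk_mem_prod (hJI (hmaps _ hq.1)) (mem_univ _))
    have s2 : ContDiffOn ℝ ∞ (fun q : ℝ × ℝ => (q.2 * (p.γ * p.Tinv q.1 + p.δ)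
        - p.μ1 * p.Tinv q.1 - p.μ0) / p.κ) ((p.T '' J) ×ˢ univ) := by fun_prop
    exact s2
  · exact contDiffOn_const.mul (hθ.smooth_lam.comp sTinv fun τ hτ => hJI (hmaps _ hτ))
  · rintro _ ⟨t, ht, rfl⟩ x
    obtain ⟨B, C, h⟩ := target_f_T (J := J) hθ hp (hJI ht) (hd t ht)
    rw [h, iteratedDeriv_succ, ArbitraryElement.iteratedDeriv_two_quadratic, deriv_const]
  · rintro _ ⟨t, ht, rfl⟩ x
    have hr := hd t ht
    obtain ⟨B, C, h⟩ := target_f_T (J := J) hθ hp (hJI ht) hr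
    have dl : HasDerivAt θ.lam (2 * θ.f2 t * θ.lam t) (p.Tinv (p.T t)) := by
      rw [Tinv_T hΔ hr]; exact hθ.hasDerivAt_lam (hJI ht)
    have d : HasDerivAt (p.target θ J).lam _ (p.T t) :=
      (dl.comp _ (hasDerivAt_Tinv hΔ hr)).const_mul (p.c0 * (p.Δ / p.κ ^ 2))
    rw [d.deriv, h, ArbitraryElement.iteratedDeriv_two_quadratic, target_lam_T hp hr]
    ring
  · rintro _ ⟨t, ht, rfl⟩
    obtain ⟨x, hx⟩ := hθ.f_ne_zero t (hJI ht)
    refine ⟨p.X t x, ?_⟩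
    rw [target_f_T_X hp (hd t ht)]
    exact mul_ne_zero (div_ne_zero (pow_ne_zero 2 hκ) hΔ) hx
  · rintro _ ⟨t, ht, rfl⟩
    rw [target_lam_T hp (hd t ht)]
    exact mul_ne_zero (mul_ne_zero hc₀ (div_ne_zero hΔ (pow_ne_zero 2 hκ)))
      (hθ.lam_ne_zero t (hJI ht))

theorem target_mem_P2 (hθ : θ ∈ P2) (hp : p.Valid) (hJI : J ⊆ θ.I) (hJ : IsOpen J)
    (hJc : IsConnected J) (hd : ∀ s ∈ J, p.γ * s + p.δ ≠ 0) : p.target θ J ∈ P2 := by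
  refine ⟨isPotential_target hθ.1 hp hJI hJ hJc hd, fun J' hJ' ho hne => ?_⟩
  rintro ⟨c, hc⟩
  refine hθ.2 (J ∩ p.T ⁻¹' J') (inter_subset_left.trans hJI)
    ((continuousOn_T hd).isOpen_inter_preimage hJ ho) ?_ ⟨p.Δ / p.κ ^ 2 * c, ?_⟩
  · obtain ⟨τ, hτ⟩ := hne
    obtain ⟨t, ht, rfl⟩ := hJ' hτ
    exact ⟨t, ht, hτ⟩
  · rintro t ⟨ht, hτ⟩ x
    have h := hc _ hτ (p.X t x)
    rw [target_f_T_X hp (hd t ht)] at h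
    have h1 := hp.1
    have h2 := hp.2.1
    rw [← h]
    field_simp

/-- The point transformation with the given constants over a domain `J` of times. -/
noncomputable def toPointTransformation (p : Params) (hθ : IsPotential θ) (hp : p.Valid)
    (hJI : J ⊆ θ.I) (hJ : IsOpen J) (hJc : IsConnected J) (hd : ∀ s ∈ J, p.γ * s + p.δ ≠ 0)
    {t₀ : ℝ} (ht₀ : t₀ ∈ J) : PointTransformation := by
  have hsm : ContDiffOn ℝ ∞ (fun q : ℝ × ℝ × ℝ =>
      (p.T q.1, p.X q.1 q.2.1, p.V θ t₀ q.1 q.2.1 q.2.2)) (J ×ˢ univ) := by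
    have hκ := hp.2.1
    have sr : ContDiffOn ℝ ∞ (fun q : ℝ × ℝ × ℝ => p.γ * q.1 + p.δ) (J ×ˢ univ) := by fun_prop
    have hr : ∀ q ∈ J ×ˢ (univ : Set (ℝ × ℝ)), p.γ * q.1 + p.δ ≠ 0 := fun q hq => hd _ hq.1
    have sl : ContDiffOn ℝ ∞ (fun q : ℝ × ℝ × ℝ => θ.lam q.1) (J ×ˢ univ) :=
      hθ.smooth_lam.comp contDiff_fst.contDiffOn fun q hq => hJI hq.1
    have sV0 : ContDiffOn ℝ ∞ (fun q : ℝ × ℝ × ℝ => p.V0 θ t₀ q.1) (J ×ˢ univ) :=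
      (smooth_V0 hθ hκ hJI hJ hJc.isPreconnected hd ht₀).comp contDiff_fst.contDiffOn
        fun q hq => hq.1
    refine ContDiffOn.prodMk (ContDiffOn.div (by fun_prop) sr hr)
      (ContDiffOn.prodMk (ContDiffOn.div (by fun_prop) sr hr) (contDiffOn_const.mul
        (ContDiffOn.add (ContDiffOn.add (ContDiffOn.sub (by fun_prop) (ContDiffOn.mul
          (ContDiffOn.div (contDiffOn_const.mul sl) (contDiffOn_const.mul sr) fun q hq =>
            mul_ne_zero two_ne_zero (hr q hq)) (by fun_prop)))
          (ContDiffOn.mul (ContDiffOn.mul (contDiffOn_const.div (contDiffOn_const.mul sr)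
            fun q hq => mul_ne_zero hκ (hr q hq)) sl) (by fun_prop))) sV0)))
  refine ⟨J ×ˢ univ, fun q => (p.T q.1, p.X q.1 q.2.1, p.V θ t₀ q.1 q.2.1 q.2.2),
    hJ.prod isOpen_univ, hJc.prod isConnected_univ, hsm, fun q hq => ?_⟩
  have hr := hd _ hq.1
  have dm := ((hsm.contDiffAt ((hJ.prod isOpen_univ).mem_nhds hq)).differentiableAt
    (by simp)).hasFDerivAt
  set A := fderiv ℝ (fun q : ℝ × ℝ × ℝ =>
    (p.T q.1, p.X q.1 q.2.1, p.V θ t₀ q.1 q.2.1 q.2.2)) q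
  have eT : ∀ e, (A e).1 = p.Δ / (p.γ * q.1 + p.δ) ^ 2 * e.1 := fun e =>
    congrArg (fun B : ℝ × ℝ × ℝ →L[ℝ] ℝ => B e)
      (dm.fst.unique ((p.hasDerivAt_T hr).comp_hasFDerivAt q hasFDerivAt_fst))
  have eXx : (A (0, 1, 0)).2.1 = p.κ / (p.γ * q.1 + p.δ) := by
    have h : HasDerivAt (fun y : ℝ => p.X q.1 (q.2.1 + y)) (p.κ / (p.γ * q.1 + p.δ)) 0 :=
      (p.hasDerivAt_X q.1 (q.2.1 + 0)).comp_const_add _ _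
    refine (dm.snd.fst.hasLineDerivAt (0, 1, 0)).unique ?_
    simpa [HasLineDerivAt] using h
  have eXv : (A (0, 0, 1)).2.1 = 0 := by
    refine (dm.snd.fst.hasLineDerivAt (0, 0, 1)).unique ?_
    simpa [HasLineDerivAt] using hasDerivAt_const (0 : ℝ) (p.X q.1 q.2.1)
  have eVv : (A (0, 0, 1)).2.2 = p.c0 := by
    have h : HasDerivAt (fun y : ℝ => p.V θ t₀ q.1 q.2.1 (q.2.2 + y)) (p.c0 * 1) 0 :=
      (((((hasDerivAt_id (0 : ℝ)).const_add q.2.2).sub_const _).add_const _).add_const _).const_mul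
        p.c0
    refine (dm.snd.snd.hasLineDerivAt (0, 0, 1)).unique ?_
    simpa [HasLineDerivAt] using h
  rw [det_of_real_prod_prod, eT, eT, eT, eXx, eXv, eVv]
  have hpos : p.Δ / (p.γ * q.1 + p.δ) ^ 2 * (p.κ / (p.γ * q.1 + p.δ) * p.c0) ≠ 0 :=
    mul_ne_zero (div_ne_zero hp.1 (pow_ne_zero 2 hr)) (mul_ne_zero (div_ne_zero hp.2.1 hr) hp.2.2)
  convert! hpos using 1
  ring

end Params

/-- Every potential equation with `f ≠ const` admits all transformations of the explicit form. -/
theorem exists_target {θ : ArbitraryElement} (hθ : θ ∈ P2) {p : Params} (hp : p.Valid) {J : Set ℝ}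
    (hJI : J ⊆ θ.I) (hJ : IsOpen J) (hJc : IsConnected J) (hd : ∀ s ∈ J, p.γ * s + p.δ ≠ 0)
    {t₀ : ℝ} (ht₀ : t₀ ∈ J) :
    ∃ (φ : PointTransformation) (θ' : ArbitraryElement),
      φ.dom = J ×ˢ Set.univ ∧ θ'.I = p.T '' J ∧ (θ, φ, θ') ∈ equivalenceGroupoid P2 ∧
        HasForm θ φ θ' t₀ p := by
  set φ := p.toPointTransformation hθ.1 hp hJI hJ hJc hd ht₀
  have hdom : φ.dom = J ×ˢ univ := rfl
  have hmap : ∀ q, φ.map q = (p.T q.1, p.X q.1 q.2.1, p.V θ t₀ q.1 q.2.1 q.2.2) := fun q => rfl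
  have htimes : φ.times = J := by
    rw [PointTransformation.times, hdom, fst_image_prod _ univ_nonempty]
  have hθ' := p.target_mem_P2 hθ hp hJI hJ hJc hd
  have hb : φ.Between θ (p.target θ J) := fun q hq =>
    ⟨hJI hq.1, mem_image_of_mem _ hq.1⟩
  have hform : HasForm θ φ (p.target θ J) t₀ p := by
    refine hasForm_of_relations hθ.1 hθ'.1 hb hp (by rwa [htimes]) (fun t x v _ => hmap _) ?_ ?_
    · exact fun q hq => Params.target_f_T_X hp (hd _ hq.1) q.2.1
    · exact fun q hq => Params.target_lam_T hp (hd _ hq.1)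
  exact ⟨φ, p.target θ J, hdom, rfl,
    ⟨hθ, hθ', hform.mapsEquation hθ.1 hθ'.1 hb (by rwa [htimes])⟩, hform⟩

end PotentialBurgers

theorem proposition2 :
    -- the admissible transformations are exactly the triples of the explicit form
    (∀ (θ : PotentialBurgers.ArbitraryElement) (φ : PotentialBurgers.PointTransformation)
        (θ' : PotentialBurgers.ArbitraryElement), ∀ t₀ ∈ φ.times,
      ((θ, φ, θ') ∈ PotentialBurgers.equivalenceGroupoid PotentialBurgers.P2 ↔
        θ ∈ PotentialBurgers.P2 ∧ θ' ∈ PotentialBurgers.P2 ∧ φ.Between θ θ' ∧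
          ∃ p : PotentialBurgers.Params, PotentialBurgers.HasForm θ φ θ' t₀ p)) ∧
    -- the constants are determined up to a common nonzero multiplier of `α, …, κ`
    (∀ (θ : PotentialBurgers.ArbitraryElement) (φ : PotentialBurgers.PointTransformation)
        (θ' : PotentialBurgers.ArbitraryElement), ∀ t₀ ∈ φ.times,
      ∀ p q : PotentialBurgers.Params, PotentialBurgers.HasForm θ φ θ' t₀ p →
        (PotentialBurgers.HasForm θ φ θ' t₀ q ↔ ∃ m : ℝ, m ≠ 0 ∧ q = p.scale m)) ∧
    -- the source equation and the constants are arbitrary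
    (∀ θ ∈ PotentialBurgers.P2, ∀ p : PotentialBurgers.Params, p.Valid →
      ∀ J ⊆ θ.I, IsOpen J → IsConnected J → (∀ t ∈ J, p.γ * t + p.δ ≠ 0) → ∀ t₀ ∈ J,
      ∃ (φ : PotentialBurgers.PointTransformation) (θ' : PotentialBurgers.ArbitraryElement),
        φ.dom = J ×ˢ Set.univ ∧ θ'.I = p.T '' J ∧
        (θ, φ, θ') ∈ PotentialBurgers.equivalenceGroupoid PotentialBurgers.P2 ∧
        PotentialBurgers.HasForm θ φ θ' t₀ p) := by
  refine ⟨fun θ φ θ' t₀ ht₀ => ⟨?_, ?_⟩, fun θ φ θ' t₀ ht₀ p q h =>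
    PotentialBurgers.hasForm_iff_exists_scale h ht₀, fun θ hθ p hp J hJI hJ hJc hd t₀ ht₀ =>
    PotentialBurgers.exists_target hθ hp hJI hJ hJc hd ht₀⟩
  · rintro ⟨hθ, hθ', hφ⟩
    exact ⟨hθ, hθ', hφ.1, PotentialBurgers.exists_hasForm hθ hθ'.1 hφ ht₀⟩
  · rintro ⟨hθ, hθ', hb, p, h⟩
    exact ⟨hθ, hθ', h.mapsEquation hθ.1 hθ'.1 hb ht₀⟩
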